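/- All graphs are finite, without loops or parallel edges. A linear arrangement of a graph $G=(V,E)$ is a bijection $\alpha:V\to\{1,\dots,|V|\}$; its net cost is $\sum_{uv\in E}(|\alpha(u)-\alpha(v)|-1)$, and $\mathrm{ola}^+(G)$ is the minimum net cost of a linear arrangement of $G$. LAPAGV is the problem of deciding, for a graph $G$ and a positive integer $k$ (the parameter), whether $\mathrm{ola}^+(G)\le k$. A bridge $e$ of a connected graph $G$ is $k$-separating if both components of $G-e$ have more than $k$ vertices. A vertex $v$ of degree 2 with non-adjacent neighbours $u_1,u_2$ is $k$-suppressible if both edges $vu_1,vu_2$ are $k$-separating bridges; suppressing $v$ means deleting $v$ and adding the edge $u_1u_2$. Graphs are given to algorithms by adjacency lists. An algorithm is a program of a random access machine with addition, truncated subtraction, comparison and indirect addressing, each operation taking one time step (uniform cost). **Theorem.** 1. If $G$ is connected and $v$ is an $\mathrm{ola}^+(G)$-suppressible vertex of $G$, then the graph $G'$ obtained from $G$ by suppressing $v$ satisfies $\mathrm{ola}^+(G')=\mathrm{ola}^+(G)$. 2. There is an absolute constant $C$ such that for every algorithm $A$ there is an algorithm $B$ with the following property. For all integers $k\ge 1$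 and $f\ge 0$: if $A$ decides within time $f$ whether $\mathrm{ola}^+(H)\le k$, for every connected graph $H$ with at most $5k+2$ vertices and at most $6k+1$ edges, then $B$ decides within time $C\,(m+n+f)$ whether $\mathrm{ola}^+(G)\le k$, for all $n,m$ and every connected graph $G$ with at most $n$ vertices and at most $m$ edges. That is, if $f(5k+2,6k+1)$ denotes a time sufficient for this check on connected graphs of at most that size, then time $O(m+n+f(5k+2,6k+1))$ is sufficient on connected graphs with $n$ vertices and $m$ edges. 3. There is an algorithm that, given an integer $k\ge1$ and a connected graph $G$ with $n$ vertices and $m$ edges, computes in time $O(n+m)$ (with an absolute constant) a connected graph $H$ without $k$-suppressible vertices such that, up to renaming of vertices, $H$ is obtained from $G$ by successively suppressing vertices, each of them $k$-suppressible in the current graph. For this $H$ one has $\mathrm{ola}^+(H)\le k$ if and only if $\mathrm{ola}^+(G)\le k$; and if $\mathrm{ola}^+(G)\le k$, then $\mathrm{ola}^+(H)=\mathrm{ola}^+(G)$ and $H$ has at most $5k+2$ vertices and at most $6k+1$ edges. 4. LAPAGV on connected graphs has a linear problem kernel that can be computed in linear time: there is an algorithm that, given an integer $k\ge1$ and a connected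 graph $G$ with $n$ vertices and $m$ edges, computes in time $O(n+m)$ (with an absolute constant) an integer $k'$ with $1\le k'\le k$ and a connected graph $H$ with at most $5k+2$ vertices and at most $6k+1$ edges such that $\mathrm{ola}^+(H)\le k'$ if and only if $\mathrm{ola}^+(G)\le k$. -/

import Mathlib

namespace LinArr

/-! ### Linear arrangements and net cost -/

section Graphs

variable {V : Type*}

/-- A linear arrangement of the finite vertex set `V`: a one-to-one mapping of `V` onto
`{1, …, |V|}`. -/
def IsLinearArrangement (α : V → ℕ) : Prop :=
  Set.BijOn α Set.univ (Set.Icc 1 (Nat.card V))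

/-- The length `|α u - α v|` of the edge `uv` relative to `α`. -/
def edgeLength (α : V → ℕ) : Sym2 V → ℕ :=
  Sym2.lift ⟨fun u v => Nat.dist (α u) (α v), fun u v => Nat.dist_comm (α u) (α v)⟩

/-- The net cost of `α`: the sum of `length - 1` over all edges. (For an injective `α` every edge
has length at least `1`, so the subtraction does not truncate.) -/
noncomputable def netCost (α : V → ℕ) (G : SimpleGraph V) : ℕ :=
  ∑ᶠ e ∈ G.edgeSet, (edgeLength α e - 1)

/-- `ola⁺(G)`: the least net cost of a linear arrangement of the finite graph `G`. -/
noncomputable def olaPlus (G : SimpleGraph V) : ℕ :=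
  sInf {c : ℕ | ∃ α : V → ℕ, IsLinearArrangement α ∧ netCost α G = c}

/-- `e` is a `k`-separating bridge of the connected graph `G`: it is a bridge, and the components of
`G - e` all have more than `k` vertices. -/
def IsSeparatingBridge (G : SimpleGraph V) (k : ℕ) (e : Sym2 V) : Prop :=
  e ∈ G.edgeSet ∧ G.IsBridge e ∧
    ∀ C : (G.deleteEdges {e}).ConnectedComponent, k < C.supp.ncard

/-- `v` is `k`-suppressible: it has exactly two neighbours, these are not adjacent, and both edges
at `v` are `k`-separating bridges. -/
def IsSuppressible (G : SimpleGraph V) (k : ℕ) (v : V) : Prop :=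
  ∃ u₁ u₂ : V, u₁ ≠ u₂ ∧ G.neighborSet v = {u₁, u₂} ∧ ¬ G.Adj u₁ u₂ ∧
    IsSeparatingBridge G k s(v, u₁) ∧ IsSeparatingBridge G k s(v, u₂)

/-- The graph obtained from `G` by removing `v` and joining its neighbours by an edge. It is used
only for vertices `v` with exactly two neighbours. -/
def suppress (G : SimpleGraph V) (v : V) : SimpleGraph {w : V // w ≠ v} where
  Adj a b := G.Adj a b ∨ (a ≠ b ∧ G.Adj v a ∧ G.Adj v b)
  symm := ⟨fun _ _ h => h.elim (fun h => Or.inl h.symm)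
    (fun h => Or.inr ⟨h.1.symm, h.2.2, h.2.1⟩)⟩
  loopless := ⟨fun _ h => h.elim (fun h => G.irrefl h) (fun h => h.1 rfl)⟩

end Graphs

/-- `ReducesTo k G H`: up to renaming of vertices, `H` is obtained from `G` by a finite sequence of
suppressions, each of a vertex that is `k`-suppressible in the current graph. -/
inductive ReducesTo (k : ℕ) : {V W : Type} → SimpleGraph V → SimpleGraph W → Prop
  | iso {V W : Type} {G : SimpleGraph V} {H : SimpleGraph W} (e : G ≃g H) : ReducesTo k G H
  | step {V W : Type} {G : SimpleGraph V} {H : SimpleGraph W} (v : V)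
      (hv : IsSuppressible G k v) (h : ReducesTo k (suppress G v) H) : ReducesTo k G H

/-! ### Random access machines under the uniform cost criterion

A program works on registers `0, 1, 2, …` and on arrays `0, 1, 2, …`; registers and array cells
hold natural numbers. Registers and arrays are named statically, array cells are addressed
indirectly through registers. (A program mentions only finitely many registers and arrays, so they
can be interleaved in a single memory with constant overhead per instruction.) -/

/-- Memory contents. -/
structure Store where
  reg : ℕ → ℕ
  arr : ℕ → ℕ → ℕ

/-- Memory after `x := c`. -/
def Store.setReg (s : Store) (x c : ℕ) : Store :=
  { s with reg := Function.update s.reg x c }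

/-- Memory after `a[i] := c`. -/
def Store.setArr (s : Store) (a i c : ℕ) : Store :=
  { s with arr := Function.update s.arr a (Function.update (s.arr a) i c) }

/-- Programs. Arithmetic is restricted to addition and (truncated) subtraction. -/
inductive Prog
  /-- `x := c` -/
  | const (x c : ℕ)
  /-- `x := y + z` -/
  | add (x y z : ℕ)
  /-- `x := y - z`, truncated at `0` -/
  | sub (x y z : ℕ)
  /-- `x := a[y]` -/
  | load (x a y : ℕ)
  /-- `a[y] := x` -/
  | store (a y x : ℕ)
  /-- `p; q` -/
  | seq (p q : Prog)
  /-- `if x < y then p else q` -/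
  | ite (x y : ℕ) (p q : Prog)
  /-- `while x < y do p` -/
  | while (x y : ℕ) (p : Prog)

/-- `Run p s t s'`: started in memory `s`, the program `p` halts after exactly `t` steps in memory
`s'`. Each assignment and each evaluation of a test is one step. -/
inductive Run : Prog → Store → ℕ → Store → Prop
  | const (x c : ℕ) (s : Store) : Run (.const x c) s 1 (s.setReg x c)
  | add (x y z : ℕ) (s : Store) : Run (.add x y z) s 1 (s.setReg x (s.reg y + s.reg z))
  | sub (x y z : ℕ) (s : Store) : Run (.sub x y z) s 1 (s.setReg x (s.reg y - s.reg z))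
  | load (x a y : ℕ) (s : Store) : Run (.load x a y) s 1 (s.setReg x (s.arr a (s.reg y)))
  | store (a y x : ℕ) (s : Store) : Run (.store a y x) s 1 (s.setArr a (s.reg y) (s.reg x))
  | seq {p q : Prog} {s₁ s₂ s₃ : Store} {t₁ t₂ : ℕ} (hp : Run p s₁ t₁ s₂) (hq : Run q s₂ t₂ s₃) :
      Run (.seq p q) s₁ (t₁ + t₂) s₃
  | iteTrue {x y : ℕ} {p q : Prog} {s s' : Store} {t : ℕ} (h : s.reg x < s.reg y)
      (hp : Run p s t s') : Run (.ite x y p q) s (t + 1) s'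
  | iteFalse {x y : ℕ} {p q : Prog} {s s' : Store} {t : ℕ} (h : ¬ s.reg x < s.reg y)
      (hq : Run q s t s') : Run (.ite x y p q) s (t + 1) s'
  | whileTrue {x y : ℕ} {p : Prog} {s₁ s₂ s₃ : Store} {t₁ t₂ : ℕ} (h : s₁.reg x < s₁.reg y)
      (hp : Run p s₁ t₁ s₂) (hw : Run (.while x y p) s₂ t₂ s₃) :
      Run (.while x y p) s₁ (t₁ + t₂ + 1) s₃
  | whileFalse {x y : ℕ} {p : Prog} {s : Store} (h : ¬ s.reg x < s.reg y) :
      Run (.while x y p) s 1 s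

/-! ### Adjacency lists in memory -/

/-- `L` is a family of adjacency lists of `G`: the list of `v` enumerates the neighbours of `v`, in
some order, without repetition. -/
def IsAdjLists {n : ℕ} (L : Fin n → List (Fin n)) (G : SimpleGraph (Fin n)) : Prop :=
  ∀ v, (L v).Nodup ∧ ∀ w, w ∈ L v ↔ G.Adj v w

/-- The concatenation of the lists of the vertices `0, 1, …, n - 1`. -/
def concatLists {n : ℕ} (L : Fin n → List (Fin n)) : List ℕ :=
  (List.ofFn L).flatten.map Fin.val

/-- The position in `concatLists L` at which the list of vertex `i` starts; for `i = n` the total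
length. -/
def listStart {n : ℕ} (L : Fin n → List (Fin n)) (i : ℕ) : ℕ :=
  ((List.ofFn L).take i).flatten.length

/-- The memory that holds exactly the instance `(L, k)`: register `0` holds the number `n` of
vertices, register `1` holds `k`, the cells `0, …, n` of array `0` hold the starting positions of
the adjacency lists, and array `1` holds their concatenation; everything else is `0`. -/
def inputStore {n : ℕ} (k : ℕ) (L : Fin n → List (Fin n)) : Store where
  reg x := if x = 0 then n else if x = 1 then k else 0
  arr a i :=
    if a = 0 then (if i ≤ n then listStart L i else 0)
    else if a = 1 then (concatLists L).getD i 0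
    else 0

/-- The memory `s` holds the instance `(L, k)` as an output: same places as for an input, and
whatever else is in memory is ignored. -/
def HoldsInstance {n : ℕ} (s : Store) (k : ℕ) (L : Fin n → List (Fin n)) : Prop :=
  s.reg 0 = n ∧ s.reg 1 = k ∧ (∀ i, i ≤ n → s.arr 0 i = listStart L i) ∧
    ∀ i, i < (concatLists L).length → s.arr 1 i = (concatLists L).getD i 0

/-- For the parameter `k`, the program `A` decides within `T` steps whether `ola⁺(G) ≤ k`, for all
connected graphs `G` with at most `N` vertices and at most `M` edges, given by adjacency lists.
It accepts by leaving `1` in register `0`. -/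
def DecidesWithin (A : Prog) (k N M T : ℕ) : Prop :=
  ∀ (n : ℕ) (G : SimpleGraph (Fin n)) (L : Fin n → List (Fin n)),
    G.Connected → IsAdjLists L G → n ≤ N → G.edgeSet.ncard ≤ M →
      ∃ (t : ℕ) (s : Store), Run A (inputStore k L) t s ∧ t ≤ T ∧
        (s.reg 0 = 1 ↔ olaPlus G ≤ k)

end LinArr

/-! The net cost of an arrangement is the number of overlaps, i.e. of pairs of an edge and a vertex
strictly between its ends (`netCost_eq_overlapCount`). Overlaps depend only on the order of the
vertices, so any injective map to `ℤ` may serve as an arrangement.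

Bridges. A side `X` of a bridge of a connected graph is connected, so a vertex outside `X` that has
vertices of `X` before and behind it lies inside an edge of `X`. If one side encloses the other,
each enclosed vertex costs at least one. Hence, if both sides are larger than the cost, one side
contains the first vertex and the other the last, and the two sides can be sorted apart without
raising the cost (`IsCutEdge.exists_sorted`, `IsCutEdge.exists_separated`): a new overlap of the
bridge with `z` is paid for by an old overlap of `z` with an edge of the opposite side, which
disappears. For a suppressible vertex `v` there is thus an optimal arrangement in which one side
precedes `v` and the other follows. Merging the two edges at `v`, or inserting `v` between the
sorted sides of the suppressed graph, does not increase the cost (`Splits.olaPlus_suppress_le`,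
`Splits.olaPlus_le_suppress`).

Size. In an arrangement of cost at most `k`, at most `3k` vertices take part in overlaps. With at
least `5k+3` vertices, a vertex that takes part in none remains even when `k+1` positions are
discarded at either end. No edge passes over it and its own edges join consecutive positions, so it
is suppressible (`card_le_of_not_isSuppressible`). At most `|V|-1` edges have length one and every
other edge costs at least one, which bounds the number of edges (`ncard_edgeSet_add_one_le`).

Linear time. Call `v` splitting if it has two neighbours and separates them. Suppressing a splitting
vertex neither creates nor destroys other splitting vertices and does not change the sides, except
that the suppressed vertex is no longer counted (`Splits.suppressAt`, `Splits.of_suppressAt`). So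
suppressibility in the current graph means: splitting in the original graph, with more than `k`
remaining vertices on each side. These numbers only decrease, hence a vertex that fails once fails
forever and a single sweep suffices (`Settled.mono`).

Splitting vertices are recognized by depth-first search. Every edge joins an ancestor to a
descendant, so the number of edges leaving a subtree is the sum, over the subtree, of the numbers of
edges going up minus those going down (`sum_up_eq`). A vertex of degree two other than the root
splits the graph iff at most one edge leaves its subtree; for the root the subtree of a child is
tested. Sweeping in reverse order of discovery, all sums are passed on to the parent. Edges at
splitting vertices are tree edges; the positions of a tree edge in the two lists are linked, so a
suppression overwrites two list entries in constant time and the lists of the other vertices keep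
their lengths.

If the reduced graph exceeds the size bounds, the answer is negative. Otherwise the given decision
procedure is run on it in fresh memory, or it is output as the kernel; the kernel of a too large
instance is `K₄` with parameter `1`. -/

namespace LinArr

/-! ### Net cost as the number of overlaps -/

section Arrangements

variable {V : Type*}

/-- The triples `(u, v, z)` such that `uv` is an edge and `z` lies strictly between `u` and `v`,
where `u` comes first. -/
def overlaps (G : SimpleGraph V) (α : V → ℤ) : Set (V × V × V) :=
  {p | G.Adj p.1 p.2.1 ∧ α p.1 < α p.2.2 ∧ α p.2.2 < α p.2.1}

/-- The number of pairs of an edge and a vertex strictly inside it. -/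
noncomputable def overlapCount (G : SimpleGraph V) (α : V → ℤ) : ℕ := (overlaps G α).ncard

theorem mem_overlaps {G : SimpleGraph V} {α : V → ℤ} {u v z : V} :
    (u, v, z) ∈ overlaps G α ↔ G.Adj u v ∧ α u < α z ∧ α z < α v := Iff.rfl

/-- Reversing an arrangement swaps the two ends in every overlap. This permits assuming which side
of a bridge comes first. -/
theorem overlapCount_neg [Finite V] (G : SimpleGraph V) (α : V → ℤ) :
    overlapCount G (fun v => -α v) ≤ overlapCount G α := by
  refine Set.ncard_le_ncard_of_injOn (fun p => (p.2.1, p.1, p.2.2)) ?_ ?_ (Set.toFinite _)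
  · rintro ⟨u, v, z⟩ ⟨h1, h2, h3⟩
    exact ⟨h1.symm, by simpa using h3, by simpa using h2⟩
  · rintro ⟨u, v, z⟩ _ ⟨u', v', z'⟩ _ h
    simp only [Prod.mk.injEq] at h ⊢
    tauto

theorem overlapCount_le_of_order [Finite V] (G : SimpleGraph V) {α β : V → ℤ}
    (h : ∀ u v, β u < β v → α u < α v) : overlapCount G β ≤ overlapCount G α :=
  Set.ncard_le_ncard (fun _ hp => ⟨hp.1, h _ _ hp.2.1, h _ _ hp.2.2⟩) (Set.toFinite _)

theorem IsLinearArrangement.injective {α : V → ℕ} (h : IsLinearArrangement α) :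
    Function.Injective α := fun _ _ hab => h.injOn (Set.mem_univ _) (Set.mem_univ _) hab

/-- For a linear arrangement, edges correspond to pairs of adjacent vertices in increasing order. -/
theorem bijOn_increasing_edges {G : SimpleGraph V} {α : V → ℕ} (h : Function.Injective α) :
    Set.BijOn (fun p : V × V => s(p.1, p.2)) {p | G.Adj p.1 p.2 ∧ α p.1 < α p.2} G.edgeSet := by
  refine ⟨fun p hp => hp.1, ?_, ?_⟩
  · rintro ⟨a, b⟩ hp ⟨c, d⟩ hq hpq
    simp only [Sym2.eq_iff] at hpq
    rcases hpq with ⟨h1, h2⟩ | ⟨h1, h2⟩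
    · simp [h1, h2]
    · subst h1 h2
      exact absurd hp.2 (lt_asymm hq.2)
  · intro e
    induction e with
    | h a b =>
      intro he
      have hab : G.Adj a b := he
      rcases lt_or_gt_of_ne (h.ne hab.ne) with h1 | h1
      · exact ⟨(a, b), ⟨hab, h1⟩, rfl⟩
      · exact ⟨(b, a), ⟨hab.symm, h1⟩, Sym2.eq_swap⟩

theorem IsLinearArrangement.ncard_between [Finite V] {α : V → ℕ} (h : IsLinearArrangement α)
    (u v : V) : {z | α u < α z ∧ α z < α v}.ncard = α v - α u - 1 := by
  have hb : Set.BijOn α {z | α u < α z ∧ α z < α v} (Set.Ioo (α u) (α v)) := by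
    refine ⟨fun z hz => hz, h.injOn.mono (Set.subset_univ _), fun i hi => ?_⟩
    have hu := h.mapsTo (Set.mem_univ u)
    have hv := h.mapsTo (Set.mem_univ v)
    have : i ∈ Set.Icc 1 (Nat.card V) :=
      ⟨by have := hi.1; omega, hi.2.le.trans hv.2⟩
    obtain ⟨z, -, rfl⟩ := h.surjOn this
    exact ⟨z, hi, rfl⟩
  rw [← hb.injOn.ncard_image, hb.image_eq, ← Finset.coe_Ioo, Set.ncard_coe_finset, Nat.card_Ioo]

/-- The positions are filled without gaps, so an edge of length `l` has exactly `l - 1` vertices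
strictly inside. -/
theorem netCost_eq_overlapCount [Finite V] {α : V → ℕ} (h : IsLinearArrangement α)
    (G : SimpleGraph V) : netCost α G = overlapCount G (fun v => (α v : ℤ)) := by
  classical
  have := Fintype.ofFinite V
  have h1 := finsum_mem_eq_of_bijOn (f := fun p : V × V => α p.2 - α p.1 - 1)
    (g := fun e => edgeLength α e - 1) _ (bijOn_increasing_edges (G := G) h.injective) (by
      rintro ⟨a, b⟩ hp
      simp only [edgeLength, Sym2.lift_mk]
      rw [Nat.dist_eq_sub_of_le hp.2.le])
  rw [netCost, ← h1, overlapCount]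
  -- The overlaps are grouped by their edge, each edge being directed upwards.
  have h2 : overlaps G (fun v => (α v : ℤ)) = (fun x : Σ _ : V × V, V => (x.1.1, x.1.2, x.2)) ''
      (((Finset.univ.filter fun p : V × V => G.Adj p.1 p.2 ∧ α p.1 < α p.2).sigma
        fun p => Finset.univ.filter fun z => α p.1 < α z ∧ α z < α p.2 :
          Finset (Σ _ : V × V, V)) : Set (Σ _ : V × V, V)) := by
    ext ⟨u, v, z⟩
    simp only [mem_overlaps, Set.mem_image, Finset.mem_coe, Finset.mem_sigma, Finset.mem_filter,
      Finset.mem_univ, true_and, Prod.mk.injEq, Sigma.exists, Prod.exists, Nat.cast_lt]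
    constructor
    · rintro ⟨h1, h2, h3⟩
      exact ⟨u, v, z, ⟨⟨h1, h2.trans h3⟩, h2, h3⟩, rfl, rfl, rfl⟩
    · rintro ⟨u, v, z, ⟨⟨h1, -⟩, h2, h3⟩, rfl, rfl, rfl⟩
      exact ⟨h1, h2, h3⟩
  rw [h2, Set.InjOn.ncard_image, Set.ncard_coe_finset, Finset.card_sigma]
  · rw [finsum_mem_eq_finite_toFinset_sum _ (Set.toFinite _)]
    refine Finset.sum_congr (by ext; simp) fun p hp => ?_
    rw [← h.ncard_between, ← Set.ncard_coe_finset]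
    simp
  · rintro ⟨⟨a, b⟩, c⟩ _ ⟨⟨a', b'⟩, c'⟩ _ h
    simp only [Prod.mk.injEq] at h
    obtain ⟨rfl, rfl, rfl⟩ := h
    rfl

theorem exists_linearArrangement_of_injective [Finite V] {α : V → ℤ} (h : Function.Injective α) :
    ∃ β : V → ℕ, IsLinearArrangement β ∧ ∀ u v, β u < β v ↔ α u < α v := by
  classical
  have := Fintype.ofFinite V
  -- The rank of `v`. Counting with `≤` includes `v` itself, so ranks start at `1`.
  let β : V → ℕ := fun v => (Finset.univ.filter fun w => α w ≤ α v).card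
  have hmono : ∀ u v, α u < α v → β u < β v := by
    intro u v huv
    refine Finset.card_lt_card ⟨fun w hw => ?_, fun hs => ?_⟩
    · simp only [Finset.mem_filter, Finset.mem_univ, true_and] at hw ⊢
      exact hw.trans huv.le
    · have := hs (Finset.mem_filter.2 ⟨Finset.mem_univ v, le_rfl⟩)
      simp only [Finset.mem_filter, Finset.mem_univ, true_and] at this
      omega
  have hiff : ∀ u v, β u < β v ↔ α u < α v := by
    refine fun u v => ⟨fun h1 => ?_, hmono u v⟩
    by_contra h2
    rcases eq_or_lt_of_le (not_lt.1 h2) with h3 | h3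
    · rw [h h3] at h1
      exact lt_irrefl _ h1
    · exact lt_asymm h1 (hmono _ _ h3)
  have hinj : Function.Injective β := by
    intro u v huv
    by_contra hne
    rcases lt_or_gt_of_ne (h.ne hne) with h1 | h1
    · exact absurd (hmono _ _ h1) (by omega)
    · exact absurd (hmono _ _ h1) (by omega)
  have hmaps : Set.MapsTo β Set.univ (Set.Icc 1 (Nat.card V)) := by
    intro v _
    refine ⟨Finset.card_pos.2 ⟨v, by simp⟩, ?_⟩
    rw [Nat.card_eq_fintype_card]
    exact Finset.card_le_univ _
  refine ⟨β, ⟨hmaps, hinj.injOn, ?_⟩, hiff⟩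
  have himg : β '' Set.univ = Set.Icc 1 (Nat.card V) := by
    refine Set.eq_of_subset_of_ncard_le hmaps.image_subset ?_ (Set.toFinite _)
    rw [hinj.injOn.ncard_image, Set.ncard_univ, ← Finset.coe_Icc, Set.ncard_coe_finset,
      Nat.card_Icc]
    omega
  exact himg.ge

/-- Arrangements with gaps are admitted here, so that blocks of vertices can be moved by adding
integers, without renumbering. -/
theorem olaPlus_le_overlapCount [Finite V] (G : SimpleGraph V) {α : V → ℤ}
    (h : Function.Injective α) : olaPlus G ≤ overlapCount G α := by
  obtain ⟨β, hβ, hlt⟩ := exists_linearArrangement_of_injective h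
  have h1 : olaPlus G ≤ overlapCount G (fun v => (β v : ℤ)) :=
    Nat.sInf_le ⟨β, hβ, netCost_eq_overlapCount hβ G⟩
  refine h1.trans ?_
  exact overlapCount_le_of_order G fun u v huv => (hlt u v).1 (by exact_mod_cast huv)

theorem exists_linearArrangement_olaPlus [Finite V] (G : SimpleGraph V) :
    ∃ α : V → ℕ, IsLinearArrangement α ∧
      overlapCount G (fun v => (α v : ℤ)) = olaPlus G := by
  -- The infimum of an empty set would be `0`; it is attained because some arrangement exists.
  have hne : {c : ℕ | ∃ α : V → ℕ, IsLinearArrangement α ∧ netCost α G = c}.Nonempty := by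
    have e := Finite.equivFin V
    obtain ⟨β, hβ, -⟩ := exists_linearArrangement_of_injective
      (α := fun v => ((e v : ℕ) : ℤ)) (fun a b hab => e.injective (Fin.ext (by simpa using hab)))
    exact ⟨_, β, hβ, rfl⟩
  obtain ⟨α, hα, hc⟩ := Nat.sInf_mem hne
  exact ⟨α, hα, by rw [← netCost_eq_overlapCount hα, hc]; rfl⟩

theorem exists_injective_olaPlus [Finite V] (G : SimpleGraph V) :
    ∃ α : V → ℤ, Function.Injective α ∧ overlapCount G α = olaPlus G := by
  obtain ⟨α, hα, h⟩ := exists_linearArrangement_olaPlus G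
  exact ⟨_, fun a b hab => hα.injective (by simpa using hab), h⟩

theorem olaPlus_iso_le {W : Type*} [Finite V] [Finite W] {G : SimpleGraph V} {H : SimpleGraph W}
    (e : G ≃g H) : olaPlus G ≤ olaPlus H := by
  obtain ⟨α, hα, h⟩ := exists_injective_olaPlus H
  rw [← h]
  refine (olaPlus_le_overlapCount G (hα.comp e.injective)).trans ?_
  refine Set.ncard_le_ncard_of_injOn (fun p => (e p.1, e p.2.1, e p.2.2)) ?_ ?_ (Set.toFinite _)
  · rintro ⟨a, b, c⟩ ⟨h1, h2⟩
    exact ⟨e.map_adj_iff.2 h1, h2⟩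
  · rintro ⟨u, v, z⟩ _ ⟨u', v', z'⟩ _ h
    simpa using h

theorem olaPlus_iso {W : Type*} [Finite V] [Finite W] {G : SimpleGraph V} {H : SimpleGraph W}
    (e : G ≃g H) : olaPlus G = olaPlus H :=
  (olaPlus_iso_le e).antisymm (olaPlus_iso_le e.symm)

/-! ### Bridges in arrangements -/

theorem exists_adj_boundary {G : SimpleGraph V} (hG : G.Connected) {Y : Set V} {a b : V}
    (ha : a ∈ Y) (hb : b ∉ Y) : ∃ u v, G.Adj u v ∧ u ∈ Y ∧ v ∉ Y := by
  obtain ⟨p⟩ := hG.preconnected a b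
  obtain ⟨d, -, h1, h2⟩ := p.exists_boundary_dart Y ha hb
  exact ⟨d.fst, d.snd, d.adj, h1, h2⟩

/-- `xy` is the only edge between `X` and its complement. -/
structure IsCutEdge (G : SimpleGraph V) (X : Set V) (x y : V) : Prop where
  adj : G.Adj x y
  left : x ∈ X
  right : y ∉ X
  unique : ∀ a b, a ∈ X → b ∉ X → G.Adj a b → a = x ∧ b = y

theorem IsCutEdge.compl {G : SimpleGraph V} {X : Set V} {x y : V} (h : IsCutEdge G X x y) :
    IsCutEdge G Xᶜ y x where
  adj := h.adj.symm
  left := h.right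
  right := fun hn => hn h.left
  unique a b ha hb hab := (h.unique b a (not_not.1 hb) ha hab.symm).symm

/-- A side of a bridge of a connected graph is connected. -/
theorem IsCutEdge.exists_adj {G : SimpleGraph V} {X : Set V} {x y : V} (h : IsCutEdge G X x y)
    (hG : G.Connected) {P : V → Prop} {a b : V} (ha : a ∈ X) (hPa : P a) (hb : b ∈ X)
    (hPb : ¬ P b) : ∃ u v, G.Adj u v ∧ u ∈ X ∧ v ∈ X ∧ P u ∧ ¬ P v := by
  by_contra hcon
  push Not at hcon
  -- Of the two parts of `X` cut out by `P`, the one without `x` is used: an edge leaving it cannot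
  -- be the bridge, hence stays in `X`.
  by_cases hx : P x
  · obtain ⟨u, v, huv, ⟨hu, hPu⟩, hv⟩ := exists_adj_boundary hG (Y := {w | w ∈ X ∧ ¬ P w}) (a := b)
      (b := a) ⟨hb, hPb⟩ (fun h => h.2 hPa)
    by_cases hvX : v ∈ X
    · have hPv : P v := not_not.1 fun hn => hv ⟨hvX, hn⟩
      exact hPu (hcon v u huv.symm hvX hu hPv)
    · exact hPu ((h.unique u v hu hvX huv).1 ▸ hx)
  · obtain ⟨u, v, huv, ⟨hu, hPu⟩, hv⟩ := exists_adj_boundary hG (Y := {w | w ∈ X ∧ P w}) (a := a)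
      (b := b) ⟨ha, hPa⟩ (fun h => hPb h.2)
    by_cases hvX : v ∈ X
    · exact hv ⟨hvX, hcon u v huv hu hvX hPu⟩
    · exact hx ((h.unique u v hu hvX huv).1 ▸ hPu)

/-- By connectedness of `X`, some edge inside `X` leads from before `z` to not before `z`; as `z ∉
X`, it passes strictly over `z`. -/
theorem IsCutEdge.exists_overlap {G : SimpleGraph V} {X : Set V} {x y : V}
    (h : IsCutEdge G X x y) (hG : G.Connected) {α : V → ℤ} (hα : Function.Injective α) {a b z : V}
    (ha : a ∈ X) (hb : b ∈ X) (hz : z ∉ X) (haz : α a < α z) (hzb : α z < α b) :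
    ∃ u v, u ∈ X ∧ v ∈ X ∧ (u, v, z) ∈ overlaps G α := by
  obtain ⟨u, v, huv, hu, hv, h1, h2⟩ := h.exists_adj hG (P := fun w => α w < α z) ha haz hb
    (not_lt.2 hzb.le)
  refine ⟨u, v, hu, hv, huv, h1, lt_of_le_of_ne (not_lt.1 h2) fun he => ?_⟩
  have := hα he
  simp only at this
  exact hz (this ▸ hv)

/-- If one side of a bridge is enclosed by the other side, the arrangement is expensive. -/
theorem IsCutEdge.ncard_le_of_enclosed [Finite V] {G : SimpleGraph V} {X : Set V} {x y : V}
    (h : IsCutEdge G X x y) (hG : G.Connected) {α : V → ℤ} (hα : Function.Injective α)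
    (h1 : ∀ z ∉ X, ∃ a ∈ X, α a < α z) (h2 : ∀ z ∉ X, ∃ b ∈ X, α z < α b) :
    Xᶜ.ncard ≤ overlapCount G α := by
  have : ∀ z : V, ∃ p : V × V, z ∉ X → (p.1, p.2, z) ∈ overlaps G α := by
    intro z
    by_cases hz : z ∈ X
    · exact ⟨(z, z), fun h => absurd hz h⟩
    · obtain ⟨a, ha, haz⟩ := h1 z hz
      obtain ⟨b, hb, hzb⟩ := h2 z hz
      obtain ⟨u, v, -, -, huv⟩ := h.exists_overlap hG hα ha hb hz haz hzb
      exact ⟨(u, v), fun _ => huv⟩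
  choose f hf using this
  refine Set.ncard_le_ncard_of_injOn (fun z => ((f z).1, (f z).2, z)) (fun z hz => hf z hz) ?_
    (Set.toFinite _)
  intro z _ z' _ hzz
  simp only [Prod.mk.injEq] at hzz
  exact hzz.2.2

/-- Moving one side of a bridge in front of the other side does not increase the cost, provided
that it starts and ends first. -/
theorem IsCutEdge.exists_sorted [Finite V] {G : SimpleGraph V} {X : Set V} {x y : V}
    (h : IsCutEdge G X x y) (hG : G.Connected) {α : V → ℤ} (hα : Function.Injective α)
    (h1 : ∀ a ∈ X, ∃ b ∉ X, α a < α b) (h2 : ∀ b ∉ X, ∃ a ∈ X, α a < α b) :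
    ∃ β : V → ℤ, Function.Injective β ∧ overlapCount G β ≤ overlapCount G α ∧
      (∀ a ∈ X, ∀ b ∉ X, β a < β b) ∧ (∀ a ∈ X, ∀ b ∈ X, β a < β b ↔ α a < α b) ∧
      (∀ a ∉ X, ∀ b ∉ X, β a < β b ↔ α a < α b) := by
  classical
  -- `N` exceeds the spread of `α`, so translating the complement of `X` by `N` moves it behind `X`.
  obtain ⟨N, hN⟩ : ∃ N : ℤ, ∀ a b, α a < α b + N := by
    obtain ⟨N, hN⟩ := (Set.finite_range fun p : V × V => α p.1 - α p.2).bddAbove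
    refine ⟨N + 1, fun a b => ?_⟩
    have : α a - α b ≤ N := hN ⟨(a, b), rfl⟩
    omega
  let β : V → ℤ := fun w => if w ∈ X then α w else α w + N
  have hX : ∀ a ∈ X, β a = α a := fun a ha => if_pos ha
  have hY : ∀ a ∉ X, β a = α a + N := fun a ha => if_neg ha
  have hXY : ∀ a ∈ X, ∀ b ∉ X, β a < β b := fun a ha b hb => by
    rw [hX a ha, hY b hb]; exact hN a b
  have hXX : ∀ a ∈ X, ∀ b ∈ X, β a < β b ↔ α a < α b := fun a ha b hb => by
    rw [hX a ha, hX b hb]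
  have hYY : ∀ a ∉ X, ∀ b ∉ X, β a < β b ↔ α a < α b := fun a ha b hb => by
    rw [hY a ha, hY b hb]; omega
  have hβ : Function.Injective β := by
    intro a b hab
    by_cases ha : a ∈ X <;> by_cases hb : b ∈ X
    · rw [hX a ha, hX b hb] at hab; exact hα hab
    · exact absurd hab (hXY a ha b hb).ne
    · exact absurd hab (hXY b hb a ha).ne'
    · rw [hY a ha, hY b hb] at hab; exact hα (by omega)
  refine ⟨β, hβ, ?_, hXY, hXX, hYY⟩
  -- an edge on the other side over `z`, whenever the bridge is moved over `z`
  have key : ∀ z, (x, y, z) ∈ overlaps G β → (x, y, z) ∉ overlaps G α →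
      ∃ u v, (u, v, z) ∈ overlaps G α ∧ ((u ∈ X ↔ v ∈ X) ∧ (u ∈ X ↔ z ∉ X)) := by
    rintro z ⟨hxy, hz1, hz2⟩ hn
    simp only at hz1 hz2
    by_cases hz : z ∈ X
    · have hz1' := (hXX x h.left z hz).1 hz1
      have hyz : α y < α z := by
        refine lt_of_le_of_ne (not_lt.1 fun hlt => hn ⟨hxy, hz1', hlt⟩) fun he => ?_
        exact h.right (hα he ▸ hz)
      obtain ⟨b, hb, hzb⟩ := h1 z hz
      obtain ⟨u, v, hu, hv, huv⟩ := h.compl.exists_overlap hG hα (z := z) h.right hb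
        (fun hn => hn hz) hyz hzb
      exact ⟨u, v, huv, iff_of_false hu hv, iff_of_false hu (not_not.2 hz)⟩
    · have hz2' := (hYY z hz y h.right).1 hz2
      have hzx : α z < α x := by
        refine lt_of_le_of_ne (not_lt.1 fun hlt => hn ⟨hxy, hlt, hz2'⟩) fun he => ?_
        exact hz (hα he ▸ h.left)
      obtain ⟨a, ha, haz⟩ := h2 z hz
      obtain ⟨u, v, hu, hv, huv⟩ := h.exists_overlap hG hα ha h.left hz haz hzx
      exact ⟨u, v, huv, iff_of_true hu hv, iff_of_true hu hz⟩
  have : ∀ z : V, ∃ p : V × V, (x, y, z) ∈ overlaps G β → (x, y, z) ∉ overlaps G α →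
      (p.1, p.2, z) ∈ overlaps G α ∧ ((p.1 ∈ X ↔ p.2 ∈ X) ∧ (p.1 ∈ X ↔ z ∉ X)) := by
    intro z
    by_cases hz : (x, y, z) ∈ overlaps G β ∧ (x, y, z) ∉ overlaps G α
    · obtain ⟨u, v, huv⟩ := key z hz.1 hz.2
      exact ⟨(u, v), fun _ _ => huv⟩
    · exact ⟨(z, z), fun h1 h2 => absurd ⟨h1, h2⟩ hz⟩
  choose f hf using this
  -- overlaps of the sorted arrangement other than those of the bridge
  have hsame : ∀ u v z, (u, v, z) ∈ overlaps G β → ¬ (u = x ∧ v = y) →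
      (u, v, z) ∈ overlaps G α ∧ (u ∈ X ↔ v ∈ X) ∧ (u ∈ X ↔ z ∈ X) := by
    rintro u v z ⟨huv, hz1, hz2⟩ hne
    simp only at huv hz1 hz2
    by_cases hu : u ∈ X
    · have hv : v ∈ X := by
        by_contra hv
        exact hne (h.unique u v hu hv huv)
      have hz : z ∈ X := by
        by_contra hz
        exact lt_asymm hz2 (hXY v hv z hz)
      exact ⟨⟨huv, (hXX u hu z hz).1 hz1, (hXX z hz v hv).1 hz2⟩, iff_of_true hu hv,
        iff_of_true hu hz⟩
    · have hz : z ∉ X := fun hz => lt_asymm hz1 (hXY z hz u hu)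
      have hv : v ∉ X := fun hv => lt_asymm hz2 (hXY v hv z hz)
      exact ⟨⟨huv, (hYY u hu z hz).1 hz1, (hYY z hz v hv).1 hz2⟩, iff_of_false hu hv,
        iff_of_false hu hz⟩
  have hrx : ¬ (x ∈ X ↔ y ∈ X) := fun hn => h.right (hn.1 h.left)
  -- Old overlaps are kept. A new one belongs to the bridge and is sent to the old overlap of `z`
  -- with an edge of the side opposite to `z`.
  refine Set.ncard_le_ncard_of_injOn (fun p => if p ∈ overlaps G α then p else
    ((f p.2.2).1, (f p.2.2).2, p.2.2)) ?_ ?_ (Set.toFinite _)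
  · rintro ⟨u, v, z⟩ hp
    by_cases hpα : (u, v, z) ∈ overlaps G α
    · simp [hpα]
    · simp only [hpα, if_false]
      have hxy : u = x ∧ v = y := by
        by_contra hne
        exact hpα (hsame u v z hp hne).1
      obtain ⟨rfl, rfl⟩ := hxy
      exact (hf z hp hpα).1
  -- A redirected overlap never equals a kept one: its edge lies in the side opposite to `z`,
  -- whereas an edge over `z` in the sorted arrangement is the bridge or lies in the side of `z`.
  · have main : ∀ u v z, (u, v, z) ∈ overlaps G β → (u, v, z) ∉ overlaps G α →
        ∀ u' v', (u', v', z) ∈ overlaps G β → (u', v', z) ∈ overlaps G α →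
          (f z).1 = u' → (f z).2 = v' → False := by
      intro u v z hp hpα u' v' hp' hpα' e1 e2
      have hxy : u = x ∧ v = y := by
        by_contra hne
        exact hpα (hsame u v z hp hne).1
      obtain ⟨rfl, rfl⟩ := hxy
      obtain ⟨-, h3, h4⟩ := hf z hp hpα
      rw [e1, e2] at h3
      rw [e1] at h4
      by_cases hne : u' = u ∧ v' = v
      · exact hrx (hne.1 ▸ hne.2 ▸ h3)
      · have := (hsame u' v' z hp' hne).2.2
        tauto
    rintro ⟨u, v, z⟩ hp ⟨u', v', z'⟩ hp' heq
    by_cases hpα : (u, v, z) ∈ overlaps G α <;> by_cases hpα' : (u', v', z') ∈ overlaps G α <;>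
      simp only [hpα, hpα', if_true, if_false, Prod.mk.injEq] at heq
    · simpa using heq
    · obtain ⟨e1, e2, rfl⟩ := heq
      exact (main u' v' z hp' hpα' u v hp hpα e1.symm e2.symm).elim
    · obtain ⟨e1, e2, rfl⟩ := heq
      exact (main u v z hp hpα u' v' hp' hpα' e1 e2).elim
    · obtain ⟨-, -, rfl⟩ := heq
      have hxy : u = x ∧ v = y := by
        by_contra hne
        exact hpα (hsame u v z hp hne).1
      have hxy' : u' = x ∧ v' = y := by
        by_contra hne
        exact hpα' (hsame u' v' z hp' hne).1
      rw [hxy.1, hxy.2, hxy'.1, hxy'.2]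

/-- If the cost is less than the size of both sides of a bridge, the two sides can be separated. -/
theorem IsCutEdge.exists_separated [Finite V] {G : SimpleGraph V} {X : Set V} {x y : V}
    (h : IsCutEdge G X x y) (hG : G.Connected) {α : V → ℤ} (hα : Function.Injective α)
    (hX : overlapCount G α < X.ncard) (hY : overlapCount G α < Xᶜ.ncard) :
    ∃ β : V → ℤ, Function.Injective β ∧ overlapCount G β ≤ overlapCount G α ∧
      ∀ a ∈ X, ∀ b ∉ X, β a < β b := by
  -- `h1` says that the last vertex is outside `X`, `h2` that the first is in `X`. If exactly one
  -- holds, one side encloses the other, which is too expensive; if both fail, the arrangement is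
  -- reversed.
  by_cases h1 : ∀ a ∈ X, ∃ b ∉ X, α a < α b <;> by_cases h2 : ∀ b ∉ X, ∃ a ∈ X, α a < α b
  · obtain ⟨β, h3, h4, h5, -⟩ := h.exists_sorted hG hα h1 h2
    exact ⟨β, h3, h4, h5⟩
  · exfalso
    push Not at h2
    obtain ⟨b, hb, hbX⟩ := h2
    have := h.compl.ncard_le_of_enclosed hG hα
      (fun z hz => ⟨b, hb, lt_of_le_of_ne (hbX z (not_not.1 hz)) fun he => hb (by
        rw [hα he]; exact not_not.1 hz)⟩)
      (fun z hz => h1 z (not_not.1 hz))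
    rw [compl_compl] at this
    omega
  · exfalso
    push Not at h1
    obtain ⟨a, ha, haX⟩ := h1
    have := h.ncard_le_of_enclosed hG hα h2
      (fun z hz => ⟨a, ha, lt_of_le_of_ne (haX z hz) fun he => hz (by rw [hα he]; exact ha)⟩)
    omega
  · push Not at h1 h2
    obtain ⟨a, ha, haX⟩ := h1
    obtain ⟨b, hb, hbX⟩ := h2
    have hn := overlapCount_neg G α
    obtain ⟨β, h3, h4, h5, -⟩ := h.exists_sorted hG (α := fun v => -α v)
      (fun u v huv => hα (by simpa using huv))
      (fun u hu => ⟨b, hb, neg_lt_neg (lt_of_le_of_ne (hbX u hu) fun he => hb (by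
        rw [hα he]; exact hu))⟩)
      (fun u hu => ⟨a, ha, neg_lt_neg (lt_of_le_of_ne (haX u hu) fun he => hu (by
        rw [hα he]; exact ha))⟩)
    exact ⟨β, h3, h4.trans hn, h5⟩

end Arrangements


/-! ### Suppression of a splitting vertex preserves the optimal cost -/

section Suppression

variable {V : Type*}

/-- The neighbours of `v` are exactly `u₁ ∈ A` and `u₂ ∉ A`, and every path from `A` to the rest of
the graph passes through `v ∉ A`. -/
structure Splits (G : SimpleGraph V) (v : V) (A : Set V) (u₁ u₂ : V) : Prop where
  left : u₁ ∈ A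
  right : u₂ ∉ A
  notMem : v ∉ A
  adj_iff : ∀ w, G.Adj v w ↔ w = u₁ ∨ w = u₂
  sep : ∀ a ∈ A, ∀ b ∉ A, b ≠ v → ¬ G.Adj a b

namespace Splits

variable {G : SimpleGraph V} {v : V} {A : Set V} {u₁ u₂ : V}

theorem adj_left (h : Splits G v A u₁ u₂) : G.Adj v u₁ := (h.adj_iff u₁).2 (Or.inl rfl)

theorem adj_right (h : Splits G v A u₁ u₂) : G.Adj v u₂ := (h.adj_iff u₂).2 (Or.inr rfl)

theorem ne (h : Splits G v A u₁ u₂) : u₁ ≠ u₂ := fun he => h.right (he ▸ h.left)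

theorem not_adj (h : Splits G v A u₁ u₂) : ¬ G.Adj u₁ u₂ :=
  h.sep _ h.left _ h.right h.adj_right.ne'

theorem symm (h : Splits G v A u₁ u₂) : Splits G v (insert v A)ᶜ u₂ u₁ where
  left := fun hn => hn.elim (fun he => h.adj_right.ne he.symm) h.right
  right := fun hn => hn (Or.inr h.left)
  notMem := fun hn => hn (Or.inl rfl)
  adj_iff w := (h.adj_iff w).trans or_comm
  sep a ha b hb hbv hab := by
    have hb' : b ∈ A := (not_not.1 hb).resolve_left hbv
    exact h.sep b hb' a (fun hn => ha (Or.inr hn)) (fun hn => ha (Or.inl hn)) hab.symm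

theorem isCutEdge_left (h : Splits G v A u₁ u₂) : IsCutEdge G A u₁ v where
  adj := h.adj_left.symm
  left := h.left
  right := h.notMem
  unique a b ha hb hab := by
    have hbv : b = v := by
      by_contra hne
      exact h.sep a ha b hb hne hab
    subst hbv
    exact ⟨((h.adj_iff a).1 hab.symm).resolve_right fun he => h.right (he ▸ ha), rfl⟩

theorem isCutEdge_right (h : Splits G v A u₁ u₂) : IsCutEdge G (insert v A) v u₂ := by
  have := h.symm.isCutEdge_left.compl
  rwa [compl_compl] at this

/-- Without the edge `v u₁` no edge leaves `A`, while every vertex is still reachable from `u₁` or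
from `v`. So the components are `A` and its complement. -/
theorem isSeparatingBridge_left (h : Splits G v A u₁ u₂) (hG : G.Connected) [Finite V] {k : ℕ}
    (h1 : k < A.ncard) (h2 : k < Aᶜ.ncard) : IsSeparatingBridge G k s(v, u₁) := by
  have hclosed : ∀ a b, (G.deleteEdges {s(v, u₁)}).Reachable a b → a ∈ A → b ∈ A := by
    rintro a b ⟨p⟩ ha
    by_contra hb
    obtain ⟨d, -, h3, h4⟩ := p.exists_boundary_dart A ha hb
    have hd := d.adj
    rw [SimpleGraph.deleteEdges_adj] at hd
    obtain ⟨h5, h6⟩ := h.isCutEdge_left.unique _ _ h3 h4 hd.1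
    exact hd.2 (by rw [h5, h6]; exact Sym2.eq_swap)
  have hcov : ∀ w, (G.deleteEdges {s(v, u₁)}).Reachable u₁ w ∨
      (G.deleteEdges {s(v, u₁)}).Reachable v w := by
    intro w
    by_contra hw
    obtain ⟨a, b, hab, ha, hb⟩ := exists_adj_boundary hG
      (Y := {w | (G.deleteEdges {s(v, u₁)}).Reachable u₁ w ∨
        (G.deleteEdges {s(v, u₁)}).Reachable v w}) (a := v) (b := w) (Or.inr .rfl) hw
    by_cases he : s(a, b) = s(v, u₁)
    · rcases Sym2.eq_iff.1 he with ⟨rfl, rfl⟩ | ⟨rfl, rfl⟩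
      · exact hb (Or.inl .rfl)
      · exact hb (Or.inr .rfl)
    · have hadj : (G.deleteEdges {s(v, u₁)}).Adj a b := by
        rw [SimpleGraph.deleteEdges_adj]; exact ⟨hab, he⟩
      exact hb (ha.imp (fun hr => hr.trans hadj.reachable) fun hr => hr.trans hadj.reachable)
  refine ⟨h.adj_left, ?_, ?_⟩
  · rw [SimpleGraph.isBridge_iff]
    exact fun hr => h.notMem (hclosed _ _ hr.symm h.left)
  · intro C
    induction C using SimpleGraph.ConnectedComponent.ind with
    | _ w =>
    by_cases hw : w ∈ A
    · refine h1.trans_le (Set.ncard_le_ncard (fun a ha => ?_) (Set.toFinite _))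
      have key : ∀ a ∈ A, (G.deleteEdges {s(v, u₁)}).Reachable u₁ a := fun a ha =>
        (hcov a).resolve_right fun hr => h.notMem (hclosed _ _ hr.symm ha)
      rw [SimpleGraph.ConnectedComponent.mem_supp_iff, SimpleGraph.ConnectedComponent.eq]
      exact (key a ha).symm.trans (key w hw)
    · refine h2.trans_le (Set.ncard_le_ncard (fun a ha => ?_) (Set.toFinite _))
      have key : ∀ a ∉ A, (G.deleteEdges {s(v, u₁)}).Reachable v a := fun a ha =>
        (hcov a).resolve_left fun hr => ha (hclosed _ _ hr h.left)
      rw [SimpleGraph.ConnectedComponent.mem_supp_iff, SimpleGraph.ConnectedComponent.eq]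
      exact (key a ha).symm.trans (key w hw)

theorem ncard_right_le [Finite V] : (insert v A)ᶜ.ncard ≤ Aᶜ.ncard :=
  Set.ncard_le_ncard (Set.compl_subset_compl.2 (Set.subset_insert _ _)) (Set.toFinite _)

/-- With `IsSuppressible.exists_splits` and `IsSuppressible.lt_ncard`, this turns suppressibility
into a splitting set and two cardinalities, the form used in all later arguments. -/
theorem isSuppressible [Finite V] (h : Splits G v A u₁ u₂) (hG : G.Connected) {k : ℕ}
    (h1 : k < A.ncard) (h2 : k < (insert v A)ᶜ.ncard) : IsSuppressible G k v := by
  refine ⟨u₁, u₂, h.ne, ?_, h.not_adj, h.isSeparatingBridge_left hG h1 (h2.trans_le ncard_right_le),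
    h.symm.isSeparatingBridge_left hG h2 ?_⟩
  · ext w
    exact h.adj_iff w
  · rw [compl_compl]
    exact h1.trans_le (Set.ncard_le_ncard (Set.subset_insert _ _) (Set.toFinite _))

theorem lt_ncard_left_of_isSeparatingBridge [Finite V] (h : Splits G v A u₁ u₂) {k : ℕ}
    (hb : IsSeparatingBridge G k s(v, u₁)) : k < A.ncard := by
  refine (hb.2.2 ((G.deleteEdges {s(v, u₁)}).connectedComponentMk u₁)).trans_le
    (Set.ncard_le_ncard (fun a ha => ?_) (Set.toFinite _))
  rw [SimpleGraph.ConnectedComponent.mem_supp_iff, SimpleGraph.ConnectedComponent.eq] at ha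
  obtain ⟨p⟩ := ha.symm
  by_contra hn
  obtain ⟨d, -, h3, h4⟩ := p.exists_boundary_dart A h.left hn
  have hd := d.adj
  rw [SimpleGraph.deleteEdges_adj] at hd
  obtain ⟨h5, h6⟩ := h.isCutEdge_left.unique _ _ h3 h4 hd.1
  exact hd.2 (by rw [h5, h6]; exact Sym2.eq_swap)

end Splits

variable {G : SimpleGraph V} {v : V} {k : ℕ}

/-- For `A` one takes the component of `u₁` after deletion of the bridge `v u₁`. -/
theorem IsSuppressible.exists_splits (h : IsSuppressible G k v) :
    ∃ A u₁ u₂, Splits G v A u₁ u₂ := by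
  obtain ⟨u₁, u₂, hne, hN, hnadj, hb1, hb2⟩ := h
  have hadj : ∀ w, G.Adj v w ↔ w = u₁ ∨ w = u₂ := fun w => by
    have : w ∈ G.neighborSet v ↔ w ∈ ({u₁, u₂} : Set V) := by rw [hN]
    simpa using this
  have hbr := SimpleGraph.isBridge_iff.1 hb1.2.1
  refine ⟨{w | (G.deleteEdges {s(v, u₁)}).Reachable u₁ w}, u₁, u₂, .rfl, fun hr => hbr ?_,
    fun hr => hbr hr.symm, hadj, fun a ha b hb hbv hab => hb ?_⟩
  · have : (G.deleteEdges {s(v, u₁)}).Adj u₂ v := by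
      rw [SimpleGraph.deleteEdges_adj]
      refine ⟨((hadj u₂).2 (Or.inr rfl)).symm, fun he => ?_⟩
      rcases Sym2.eq_iff.1 he with ⟨rfl, h1⟩ | ⟨h1, -⟩
      · exact hne h1.symm
      · exact hne h1.symm
    exact (hr.trans this.reachable).symm
  · have : (G.deleteEdges {s(v, u₁)}).Adj a b := by
      rw [SimpleGraph.deleteEdges_adj]
      refine ⟨hab, fun he => ?_⟩
      rcases Sym2.eq_iff.1 he with ⟨rfl, rfl⟩ | ⟨rfl, rfl⟩
      · exact hbr ha.symm
      · exact hbv rfl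
    exact ha.trans this.reachable

theorem IsSuppressible.lt_ncard [Finite V] {A : Set V} {u₁ u₂ : V} (h : IsSuppressible G k v)
    (hs : Splits G v A u₁ u₂) : k < A.ncard ∧ k < (insert v A)ᶜ.ncard := by
  obtain ⟨w₁, w₂, hne, hN, -, hb1, hb2⟩ := h
  have h1 : u₁ ∈ ({w₁, w₂} : Set V) := by rw [← hN]; exact hs.adj_left
  have h2 : u₂ ∈ ({w₁, w₂} : Set V) := by rw [← hN]; exact hs.adj_right
  have hb : ∀ u ∈ ({w₁, w₂} : Set V), IsSeparatingBridge G k s(v, u) := by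
    rintro u (rfl | rfl)
    exacts [hb1, hb2]
  exact ⟨hs.lt_ncard_left_of_isSeparatingBridge (hb _ h1),
    hs.symm.lt_ncard_left_of_isSeparatingBridge (hb _ h2)⟩

/-- Sending `v` to its neighbour `u` and fixing everything else maps each edge of `G` to an edge or
a single vertex of the suppressed graph, hence walks to walks. -/
theorem suppress_connected (hG : G.Connected) {u : V} (hu : G.Adj v u) :
    (suppress G v).Connected := by
  classical
  let f : V → {w : V // w ≠ v} := fun w => if hw : w = v then ⟨u, hu.ne'⟩ else ⟨w, hw⟩
  have hfv : f v = ⟨u, hu.ne'⟩ := dif_pos rfl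
  have hf : ∀ w (hw : w ≠ v), f w = ⟨w, hw⟩ := fun w hw => dif_neg hw
  have hstep : ∀ b, G.Adj v b → (suppress G v).Reachable (f v) (f b) := by
    intro b hb
    by_cases hub : u = b
    · rw [hfv, hf b hb.ne']
      subst hub
      exact .rfl
    · rw [hfv, hf b hb.ne']
      exact SimpleGraph.Adj.reachable (Or.inr ⟨fun he => hub (congrArg Subtype.val he), hu, hb⟩)
  have hadj : ∀ a b, G.Adj a b → (suppress G v).Reachable (f a) (f b) := by
    intro a b hab
    by_cases ha : a = v
    · subst ha; exact hstep b hab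
    · by_cases hb : b = v
      · subst hb; exact (hstep a hab.symm).symm
      · rw [hf a ha, hf b hb]
        exact SimpleGraph.Adj.reachable (Or.inl hab)
  have hwalk : ∀ a b, G.Walk a b → (suppress G v).Reachable (f a) (f b) := by
    intro a b p
    induction p with
    | nil => exact .rfl
    | cons h _ ih => exact (hadj _ _ h).trans ih
  have : Nonempty {w : V // w ≠ v} := ⟨⟨u, hu.ne'⟩⟩
  refine ⟨fun a b => ?_⟩
  obtain ⟨p⟩ := hG.preconnected a b
  simpa [hf a a.2, hf b b.2] using hwalk _ _ p

namespace Splits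

variable {A : Set V} {u₁ u₂ : V}

theorem isCutEdge_suppress (h : Splits G v A u₁ u₂) :
    IsCutEdge (suppress G v) {w | (w : V) ∈ A} ⟨u₁, h.adj_left.ne'⟩ ⟨u₂, h.adj_right.ne'⟩ where
  adj := Or.inr ⟨fun he => h.ne (congrArg Subtype.val he), h.adj_left, h.adj_right⟩
  left := h.left
  right := h.right
  unique := by
    rintro ⟨a, hav⟩ ⟨b, hbv⟩ ha hb (hab | ⟨-, h1, h2⟩)
    · exact absurd hab (h.sep a ha b hb hbv)
    · have h3 : a = u₁ := ((h.adj_iff a).1 h1).resolve_right fun he => h.right (he ▸ ha)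
      have h4 : b = u₂ := ((h.adj_iff b).1 h2).resolve_left fun he => hb (by
        show b ∈ A
        rw [he]; exact h.left)
      exact ⟨Subtype.ext h3, Subtype.ext h4⟩

/-- An optimal arrangement is sorted at both bridges, so that `A` precedes `v` and the rest follows.
An overlap of the new edge with `z` is then charged to `u₁ v` if `z ∈ A` and to `v u₂` otherwise. -/
theorem olaPlus_suppress_le [Finite V] (h : Splits G v A u₁ u₂) (hG : G.Connected)
    (h1 : olaPlus G < A.ncard) (h2 : olaPlus G < (insert v A)ᶜ.ncard) :
    olaPlus (suppress G v) ≤ olaPlus G := by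
  obtain ⟨α, hα, hc⟩ := exists_injective_olaPlus G
  rw [← hc] at h1 h2
  obtain ⟨β, hβ, hle, hAB⟩ := h.isCutEdge_left.exists_separated hG hα h1
    (h2.trans_le ncard_right_le)
  have hu2 : u₂ ∉ insert v A := fun hn => hn.elim (fun he => h.adj_right.ne' he) h.right
  have hlow : ∀ b ∉ insert v A, ∃ a ∈ insert v A, β a < β b := fun b hb =>
    ⟨u₁, Or.inr h.left, hAB _ h.left _ fun hn => hb (Or.inr hn)⟩
  -- The last vertex lies beyond `v`: otherwise that side is enclosed by `A ∪ {v}`, and the cost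
  -- would be at least its size.
  obtain ⟨γ, hγ, hle', hsep, hin, -⟩ := h.isCutEdge_right.exists_sorted hG hβ (by
    by_contra hcon
    push Not at hcon
    obtain ⟨a, ha, hmax⟩ := hcon
    have := h.isCutEdge_right.ncard_le_of_enclosed hG hβ hlow fun z hz =>
      ⟨a, ha, lt_of_le_of_ne (hmax z hz) fun he => hz (hβ he ▸ ha)⟩
    omega) hlow
  have hAv : ∀ a ∈ A, γ a < γ v := fun a ha =>
    (hin a (Or.inr ha) v (Or.inl rfl)).2 (hAB a ha v h.notMem)
  have hvB : ∀ b ∉ insert v A, γ v < γ b := fun b hb => hsep v (Or.inl rfl) b hb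
  rw [← hc]
  refine (olaPlus_le_overlapCount (suppress G v) (α := fun w => γ w)
    (hγ.comp Subtype.val_injective)).trans (le_trans ?_ (hle'.trans hle))
  -- the new edge splits into its two halves
  classical
  refine Set.ncard_le_ncard_of_injOn (fun p => if G.Adj p.1 p.2.1 then (↑p.1, ↑p.2.1, ↑p.2.2) else
    if (p.2.2 : V) ∈ A then (u₁, v, ↑p.2.2) else (v, u₂, ↑p.2.2)) ?_ ?_ (Set.toFinite _)
  · rintro ⟨⟨a, hav⟩, ⟨b, hbv⟩, ⟨z, hzv⟩⟩ ⟨hab, h3, h4⟩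
    simp only at h3 h4
    by_cases hG' : G.Adj a b
    · simp only [hG', if_true]
      exact ⟨hG', h3, h4⟩
    · obtain ⟨-, ha, hb⟩ := hab.resolve_left hG'
      simp only at ha hb
      have hab' : a = u₁ ∧ b = u₂ := by
        rcases (h.adj_iff a).1 ha with rfl | rfl <;> rcases (h.adj_iff b).1 hb with rfl | rfl
        · exact absurd (h3.trans h4) (lt_irrefl _)
        · exact ⟨rfl, rfl⟩
        · exact absurd (h3.trans h4) (not_lt.2 (hsep _ (Or.inr h.left) _ hu2).le)
        · exact absurd (h3.trans h4) (lt_irrefl _)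
      obtain ⟨rfl, rfl⟩ := hab'
      simp only [hG', if_false]
      by_cases hz : z ∈ A
      · simp only [hz, if_true]
        exact ⟨h.adj_left.symm, h3, hAv z hz⟩
      · simp only [hz, if_false]
        exact ⟨h.adj_right, hvB z fun hn => hn.elim hzv hz, h4⟩
  · have hpair : ∀ a b z : {w : V // w ≠ v}, (a, b, z) ∈ overlaps (suppress G v) (fun w => γ w) →
        ¬ G.Adj a b → (a : V) = u₁ ∧ (b : V) = u₂ := by
      rintro ⟨a, hav⟩ ⟨b, hbv⟩ ⟨z, hzv⟩ ⟨hab, h3, h4⟩ hG'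
      obtain ⟨-, ha, hb⟩ := hab.resolve_left hG'
      simp only at ha hb h3 h4
      rcases (h.adj_iff a).1 ha with rfl | rfl <;> rcases (h.adj_iff b).1 hb with rfl | rfl
      · exact absurd (h3.trans h4) (lt_irrefl _)
      · exact ⟨rfl, rfl⟩
      · exact absurd (h3.trans h4) (not_lt.2 (hsep _ (Or.inr h.left) _ hu2).le)
      · exact absurd (h3.trans h4) (lt_irrefl _)
    rintro ⟨a, b, z⟩ hp ⟨a', b', z'⟩ hp' heq
    simp only at heq
    have e3 : z = z' := by
      apply Subtype.ext
      split_ifs at heq <;> simp only [Prod.mk.injEq] at heq <;> exact heq.2.2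
    subst e3
    by_cases h5 : G.Adj a b <;> by_cases h6 : G.Adj a' b'
    · simp only [h5, h6, if_true, Prod.mk.injEq] at heq
      simp only [Prod.mk.injEq, and_true]
      exact ⟨Subtype.ext heq.1, Subtype.ext heq.2.1⟩
    · simp only [h5, h6, if_true, if_false] at heq
      split_ifs at heq <;> simp only [Prod.mk.injEq] at heq
      · exact absurd heq.2.1 b.2
      · exact absurd heq.1 a.2
    · simp only [h5, h6, if_true, if_false] at heq
      split_ifs at heq <;> simp only [Prod.mk.injEq] at heq
      · exact absurd heq.2.1.symm b'.2
      · exact absurd heq.1.symm a'.2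
    · obtain ⟨h7, h8⟩ := hpair a b z hp h5
      obtain ⟨h9, h10⟩ := hpair a' b' z hp' h6
      simp only [Prod.mk.injEq, and_true]
      exact ⟨Subtype.ext (h7.trans h9.symm), Subtype.ext (h8.trans h10.symm)⟩

/-- In an optimal arrangement of the suppressed graph with sorted sides, `v` is inserted between the
sides. No edge passes over `v`, and the overlaps of `u₁ v` and `v u₂` together become overlaps of
`u₁ u₂`. -/
theorem olaPlus_le_suppress [Finite V] (h : Splits G v A u₁ u₂) (hG : G.Connected)
    (h1 : olaPlus (suppress G v) < A.ncard) (h2 : olaPlus (suppress G v) < (insert v A)ᶜ.ncard) :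
    olaPlus G ≤ olaPlus (suppress G v) := by
  classical
  obtain ⟨α, hα, hc⟩ := exists_injective_olaPlus (suppress G v)
  rw [← hc] at h1 h2 ⊢
  have hcard : ∀ B : Set V, v ∉ B → {w : {w : V // w ≠ v} | (w : V) ∈ B}.ncard = B.ncard := by
    intro B hB
    rw [← Subtype.val_injective.injOn.ncard_image]
    congr 1
    ext w
    simp only [Set.mem_image, Set.mem_ofPred_eq, Subtype.exists, exists_and_left, exists_prop,
      exists_eq_right_right]
    exact ⟨fun h => h.1, fun h => ⟨h, fun he => hB (he ▸ h)⟩⟩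
  obtain ⟨β, hβ, hle, hAB⟩ := h.isCutEdge_suppress.exists_separated
    (suppress_connected hG h.adj_left) hα (by rwa [hcard A h.notMem]) (by
      rw [← hcard _ (fun hn : v ∈ (insert v A)ᶜ => hn (Or.inl rfl))] at h2
      refine h2.trans_le (Set.ncard_le_ncard (fun w hw hn => hw (Or.inr hn)) (Set.toFinite _)))
  refine le_trans ?_ hle
  -- `M` is the last position used by `A`; moving the other side up by one frees the position `M +
  -- 1` for `v`.
  obtain ⟨M, hMA, hMB⟩ : ∃ M, (∀ w : {w : V // w ≠ v}, (w : V) ∈ A → β w ≤ M) ∧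
      ∀ w : {w : V // w ≠ v}, (w : V) ∉ A → M < β w := by
    obtain ⟨m, hm, hmax⟩ := Set.exists_max_image {w : {w : V // w ≠ v} | (w : V) ∈ A} β
      (Set.toFinite _) ⟨⟨u₁, h.adj_left.ne'⟩, h.left⟩
    exact ⟨β m, hmax, fun w hw => hAB m hm w hw⟩
  let γ : V → ℤ := fun w => if hw : w = v then M + 1 else
    if w ∈ A then β ⟨w, hw⟩ else β ⟨w, hw⟩ + 1
  have hγv : γ v = M + 1 := dif_pos rfl
  have hγA : ∀ w (hw : w ≠ v), w ∈ A → γ w = β ⟨w, hw⟩ := fun w hw hA => by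
    simp only [γ, dif_neg hw, if_pos hA]
  have hγB : ∀ w (hw : w ≠ v), w ∉ A → γ w = β ⟨w, hw⟩ + 1 := fun w hw hA => by
    simp only [γ, dif_neg hw, if_neg hA]
  have hltA : ∀ w (hw : w ≠ v), w ∈ A → γ w < γ v := fun w hw hA => by
    have := hMA ⟨w, hw⟩ hA
    rw [hγv, hγA w hw hA]; omega
  have hltB : ∀ w (hw : w ≠ v), w ∉ A → γ v < γ w := fun w hw hA => by
    have := hMB ⟨w, hw⟩ hA
    rw [hγv, hγB w hw hA]; omega
  have hiff : ∀ a b (ha : a ≠ v) (hb : b ≠ v), γ a < γ b ↔ β ⟨a, ha⟩ < β ⟨b, hb⟩ := by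
    intro a b ha hb
    by_cases haA : a ∈ A <;> by_cases hbA : b ∈ A
    · rw [hγA a ha haA, hγA b hb hbA]
    · rw [hγA a ha haA, hγB b hb hbA]
      have := hAB ⟨a, ha⟩ haA ⟨b, hb⟩ hbA
      omega
    · rw [hγB a ha haA, hγA b hb hbA]
      have := hAB ⟨b, hb⟩ hbA ⟨a, ha⟩ haA
      omega
    · rw [hγB a ha haA, hγB b hb hbA]
      omega
  have hγ : Function.Injective γ := by
    have hne : ∀ w, w ≠ v → γ w ≠ γ v := fun w hw => by
      by_cases hA : w ∈ A
      · exact (hltA w hw hA).ne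
      · exact (hltB w hw hA).ne'
    intro a b hab
    by_cases ha : a = v <;> by_cases hb : b = v
    · rw [ha, hb]
    · exact absurd (ha ▸ hab.symm) (hne b hb)
    · exact absurd (hb ▸ hab) (hne a ha)
    · have h3 := hiff a b ha hb
      have h4 := hiff b a hb ha
      have : β ⟨a, ha⟩ = β ⟨b, hb⟩ := by rw [hab] at h3 h4; omega
      exact congrArg Subtype.val (hβ this)
  refine (olaPlus_le_overlapCount G hγ).trans ?_
  have hx : (suppress G v).Adj ⟨u₁, h.adj_left.ne'⟩ ⟨u₂, h.adj_right.ne'⟩ :=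
    h.isCutEdge_suppress.adj
  -- no edge passes over `v`
  have hz : ∀ a b, (a, b, v) ∉ overlaps G γ := by
    rintro a b ⟨hab, h3, h4⟩
    simp only at hab h3 h4
    have hav : a ≠ v := fun he => by rw [he] at h3; exact lt_irrefl _ h3
    have hbv : b ≠ v := fun he => by rw [he] at h4; exact lt_irrefl _ h4
    have haA : a ∈ A := by
      by_contra hn
      exact lt_asymm h3 (hltB a hav hn)
    have hbA : b ∉ A := fun hn => lt_asymm h4 (hltA b hbv hn)
    exact h.sep a haA b hbA hbv hab
  -- The value of the following map `e` at `v` is arbitrary.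
  let W := {w : V // w ≠ v}
  let e : V → W := fun w => if hw : w = v then ⟨u₁, h.adj_left.ne'⟩ else ⟨w, hw⟩
  have he : ∀ w (hw : w ≠ v), e w = ⟨w, hw⟩ := fun w hw => dif_neg hw
  have hl : ∀ b z, (v, b, z) ∈ overlaps G γ → b = u₂ ∧ z ∉ A := by
    rintro b z ⟨hab, h3, h4⟩
    simp only at hab h3 h4
    have hzv : z ≠ v := fun he => by rw [he] at h3; exact lt_irrefl _ h3
    refine ⟨((h.adj_iff b).1 hab).resolve_left fun hb => ?_, fun hn => lt_asymm h3 (hltA z hzv hn)⟩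
    subst hb
    exact lt_asymm (h3.trans h4) (hltA _ h.adj_left.ne' h.left)
  have hr : ∀ a z, (a, v, z) ∈ overlaps G γ → a = u₁ ∧ z ∈ A := by
    rintro a z ⟨hab, h3, h4⟩
    simp only at hab h3 h4
    have hzv : z ≠ v := fun he => by rw [he] at h4; exact lt_irrefl _ h4
    refine ⟨((h.adj_iff a).1 hab.symm).resolve_right fun hb => ?_, ?_⟩
    · subst hb
      exact lt_asymm (h3.trans h4) (hltB _ h.adj_right.ne' h.right)
    · by_contra hn
      exact lt_asymm h4 (hltB z hzv hn)
  -- The inner vertex tells the two halves apart: it is in `A` under `u₁ v` and outside `A` under `v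
  -- u₂`. No other overlap is sent to `u₁ u₂`, which is not an edge of `G`.
  refine Set.ncard_le_ncard_of_injOn (fun p => if p.1 = v ∨ p.2.1 = v then
    ((⟨u₁, h.adj_left.ne'⟩, ⟨u₂, h.adj_right.ne'⟩, e p.2.2) : W × W × W) else
      (e p.1, e p.2.1, e p.2.2)) ?_ ?_ (Set.toFinite _)
  · rintro ⟨a, b, z⟩ hp
    have hzv : z ≠ v := fun he => hz a b (he ▸ hp)
    by_cases ha : a = v
    · subst ha
      obtain ⟨rfl, hzA⟩ := hl b z hp
      simp only [true_or, if_true, he z hzv]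
      exact ⟨hx, (hiff _ _ _ _).1 ((hltA _ h.adj_left.ne' h.left).trans (hltB z hzv hzA)),
        (hiff _ _ _ _).1 hp.2.2⟩
    · by_cases hb : b = v
      · subst hb
        obtain ⟨rfl, hzA⟩ := hr a z hp
        simp only [or_true, if_true, he z hzv]
        exact ⟨hx, (hiff _ _ _ _).1 hp.2.1,
          (hiff _ _ _ _).1 ((hltA z hzv hzA).trans (hltB _ h.adj_right.ne' h.right))⟩
      · simp only [ha, hb, or_self, if_false, he z hzv, he a ha, he b hb]
        exact ⟨Or.inl hp.1, (hiff _ _ _ _).1 hp.2.1, (hiff _ _ _ _).1 hp.2.2⟩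
  · rintro ⟨a, b, z⟩ hp ⟨a', b', z'⟩ hp' heq
    have hzv : z ≠ v := fun he => hz a b (he ▸ hp)
    have hzv' : z' ≠ v := fun he => hz a' b' (he ▸ hp')
    have e3 : z = z' := by
      have : e z = e z' := by
        simp only at heq
        split_ifs at heq <;> simp only [Prod.mk.injEq] at heq
        exacts [heq.2.2, heq.2.2, heq.2.2, heq.2.2]
      rw [he z hzv, he z' hzv'] at this
      exact congrArg Subtype.val this
    subst e3
    have hnew : ∀ a b, (a, b, z) ∈ overlaps G γ → ¬ (a = v ∨ b = v) →
        ¬ (e a = ⟨u₁, h.adj_left.ne'⟩ ∧ e b = ⟨u₂, h.adj_right.ne'⟩) := by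
      rintro a b hab hne ⟨h3, h4⟩
      rw [not_or] at hne
      rw [he a hne.1] at h3
      rw [he b hne.2] at h4
      have h5 := congrArg Subtype.val h3
      have h6 := congrArg Subtype.val h4
      simp only at h5 h6
      exact h.not_adj (h5 ▸ h6 ▸ hab.1)
    by_cases h3 : a = v ∨ b = v <;> by_cases h4 : a' = v ∨ b' = v
    · rcases h3 with rfl | rfl <;> rcases h4 with rfl | rfl
      · rw [(hl b z hp).1, (hl b' z hp').1]
      · exact absurd (hr a' z hp').2 (hl b z hp).2
      · exact absurd (hr a z hp).2 (hl b' z hp').2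
      · rw [(hr a z hp).1, (hr a' z hp').1]
    · simp only [h3, h4, if_true, if_false, Prod.mk.injEq] at heq
      exact absurd ⟨heq.1.symm, heq.2.1.symm⟩ (hnew a' b' hp' h4)
    · simp only [h3, h4, if_true, if_false, Prod.mk.injEq] at heq
      exact absurd ⟨heq.1, heq.2.1⟩ (hnew a b hp h3)
    · simp only [h3, h4, if_false, Prod.mk.injEq] at heq
      rw [not_or] at h3 h4
      rw [he a h3.1, he b h3.2, he a' h4.1, he b' h4.2] at heq
      simp only [Prod.mk.injEq, and_true]
      exact ⟨congrArg Subtype.val heq.1, congrArg Subtype.val heq.2.1⟩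

end Splits

theorem IsSuppressible.connected_suppress (h : IsSuppressible G k v) (hG : G.Connected) :
    (suppress G v).Connected := by
  obtain ⟨A, u₁, u₂, hs⟩ := h.exists_splits
  exact suppress_connected hG hs.adj_left

theorem IsSuppressible.olaPlus_suppress [Finite V] (h : IsSuppressible G k v) (hG : G.Connected)
    (hk : olaPlus G ≤ k) : olaPlus (suppress G v) = olaPlus G := by
  obtain ⟨A, u₁, u₂, hs⟩ := h.exists_splits
  obtain ⟨h1, h2⟩ := h.lt_ncard hs
  have := hs.olaPlus_suppress_le hG (by omega) (by omega)
  exact this.antisymm (hs.olaPlus_le_suppress hG (by omega) (by omega))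

/-- Either hypothesis `≤ k` makes both sides larger than the cost at hand, so nothing about the
other graph has to be known beforehand. This is what the algorithm needs, for which `ola⁺` is
unknown. -/
theorem IsSuppressible.olaPlus_suppress_le_iff [Finite V] (h : IsSuppressible G k v)
    (hG : G.Connected) : olaPlus (suppress G v) ≤ k ↔ olaPlus G ≤ k := by
  refine ⟨fun hk => ?_, fun hk => (h.olaPlus_suppress hG hk).le.trans hk⟩
  obtain ⟨A, u₁, u₂, hs⟩ := h.exists_splits
  obtain ⟨h1, h2⟩ := h.lt_ncard hs
  exact (hs.olaPlus_le_suppress hG (by omega) (by omega)).trans hk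

end Suppression

theorem ReducesTo.olaPlus_iff {k : ℕ} {V W : Type} {G : SimpleGraph V} {H : SimpleGraph W}
    (h : ReducesTo k G H) : Finite V → G.Connected →
    H.Connected ∧ (olaPlus H ≤ k ↔ olaPlus G ≤ k) ∧ (olaPlus G ≤ k → olaPlus H = olaPlus G) := by
  induction h with
  | iso e =>
    intro _ hG
    have := Finite.of_equiv _ e.toEquiv
    rw [olaPlus_iso e]
    exact ⟨e.connected_iff.1 hG, Iff.rfl, fun _ => rfl⟩
  | step v hv h ih =>
    intro _ hG
    obtain ⟨h1, h2, h3⟩ := ih inferInstance (hv.connected_suppress hG)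
    have h4 := hv.olaPlus_suppress_le_iff hG
    exact ⟨h1, h2.trans h4, fun hk => (h3 (h4.2 hk)).trans (hv.olaPlus_suppress hG hk)⟩


/-! ### Size of graphs without suppressible vertices -/

section Size

variable {V : Type*} {α : V → ℕ}

theorem IsLinearArrangement.ncard_Icc (h : IsLinearArrangement α) {a b : ℕ} (ha : 1 ≤ a)
    (hb : b ≤ Nat.card V) : {z | a ≤ α z ∧ α z ≤ b}.ncard = b + 1 - a := by
  have hb : Set.BijOn α {z | a ≤ α z ∧ α z ≤ b} (Set.Icc a b) := by
    refine ⟨fun z hz => hz, h.injOn.mono (Set.subset_univ _), fun i hi => ?_⟩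
    obtain ⟨z, -, rfl⟩ := h.surjOn ⟨ha.trans hi.1, hi.2.trans hb⟩
    exact ⟨z, hi, rfl⟩
  rw [← hb.injOn.ncard_image, hb.image_eq, ← Finset.coe_Icc, Set.ncard_coe_finset, Nat.card_Icc]

theorem IsLinearArrangement.exists_between (h : IsLinearArrangement α) (u v : V)
    (huv : α u + 1 < α v) : ∃ z, α z = α u + 1 := by
  obtain ⟨z, -, hz⟩ := h.surjOn (a := α u + 1)
    ⟨by omega, huv.le.trans (h.mapsTo (Set.mem_univ v)).2⟩
  exact ⟨z, hz⟩

theorem mem_overlaps_natCast {G : SimpleGraph V} {u v z : V} :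
    (u, v, z) ∈ overlaps G (fun w => (α w : ℤ)) ↔ G.Adj u v ∧ α u < α z ∧ α z < α v := by
  rw [mem_overlaps, Nat.cast_lt, Nat.cast_lt]

variable [Finite V]

/-- At most `|V| - 1` edges join consecutive positions, being determined by their first end; every
longer edge overlaps the vertex right after its first end. -/
theorem ncard_edgeSet_add_one_le [Nonempty V] (G : SimpleGraph V) :
    G.edgeSet.ncard + 1 ≤ Nat.card V + olaPlus G := by
  obtain ⟨α, hα, hc⟩ := exists_linearArrangement_olaPlus G
  have hpos : 0 < Nat.card V := Nat.card_pos
  rw [← hc, ← (bijOn_increasing_edges (G := G) hα.injective).image_eq,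
    (bijOn_increasing_edges hα.injective).injOn.ncard_image]
  have hshort : {p : V × V | G.Adj p.1 p.2 ∧ α p.1 + 1 = α p.2}.ncard ≤ Nat.card V - 1 := by
    have : (Set.Icc 1 (Nat.card V - 1)).ncard = Nat.card V - 1 := by
      rw [← Finset.coe_Icc, Set.ncard_coe_finset, Nat.card_Icc]; omega
    rw [← this]
    refine Set.ncard_le_ncard_of_injOn (fun p => α p.1) ?_ ?_ (Set.toFinite _)
    · rintro ⟨u, v⟩ ⟨-, h⟩
      have h1 := hα.mapsTo (Set.mem_univ u)
      have h2 := hα.mapsTo (Set.mem_univ v)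
      simp only [Set.mem_Icc] at h h1 h2 ⊢
      omega
    · rintro ⟨u, v⟩ ⟨-, h⟩ ⟨u', v'⟩ ⟨-, h'⟩ he
      simp only at h h' he
      rw [hα.injective he, hα.injective (h.symm.trans ((congrArg (· + 1) he).trans h'))]
  have hlong : {p : V × V | G.Adj p.1 p.2 ∧ α p.1 + 1 < α p.2}.ncard ≤
      overlapCount G (fun v => (α v : ℤ)) := by
    have : ∀ p : V × V, ∃ z, α p.1 + 1 < α p.2 → α z = α p.1 + 1 := by
      rintro ⟨u, v⟩
      by_cases h : α u + 1 < α v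
      · obtain ⟨z, hz⟩ := hα.exists_between u v h
        exact ⟨z, fun _ => hz⟩
      · exact ⟨u, fun h' => absurd h' h⟩
    choose f hf using this
    refine Set.ncard_le_ncard_of_injOn (fun p => (p.1, p.2, f p)) ?_ ?_ (Set.toFinite _)
    · rintro ⟨u, v⟩ ⟨h1, h2⟩
      have hz : α (f (u, v)) = α u + 1 := hf (u, v) h2
      simp only at h1 h2
      exact mem_overlaps_natCast.2
        ⟨h1, by show α u < _; omega, by show _ < α v; omega⟩
    · rintro ⟨u, v⟩ - ⟨u', v'⟩ - he
      simp only [Prod.mk.injEq] at he ⊢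
      exact ⟨he.1, he.2.1⟩
  have hunion : {p : V × V | G.Adj p.1 p.2 ∧ α p.1 < α p.2} ⊆
      {p : V × V | G.Adj p.1 p.2 ∧ α p.1 + 1 = α p.2} ∪
        {p : V × V | G.Adj p.1 p.2 ∧ α p.1 + 1 < α p.2} := by
    rintro p ⟨h1, h2⟩
    rcases Nat.lt_or_ge (α p.1 + 1) (α p.2) with h3 | h3
    · exact Or.inr ⟨h1, h3⟩
    · exact Or.inl ⟨h1, by omega⟩
  have h1 := Set.ncard_le_ncard hunion (Set.toFinite _)
  have h2 := Set.ncard_union_le {p : V × V | G.Adj p.1 p.2 ∧ α p.1 + 1 = α p.2}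
    {p : V × V | G.Adj p.1 p.2 ∧ α p.1 + 1 < α p.2}
  omega

/-- A vertex in no overlap, with more than `k` positions on either side, splits the graph between
its two neighbours in the order and is suppressible. In a larger graph such a vertex is found by
counting. -/
theorem card_le_of_not_isSuppressible {G : SimpleGraph V} {k : ℕ} (hG : G.Connected)
    (hns : ∀ v, ¬ IsSuppressible G k v) (hk : olaPlus G ≤ k) : Nat.card V ≤ 5 * k + 2 := by
  obtain ⟨α, hα, hc⟩ := exists_linearArrangement_olaPlus G
  rw [← hc] at hk
  by_contra hlarge
  let O := overlaps G (fun v => (α v : ℤ))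
  let T : Set V := (fun p => p.1) '' O ∪ (fun p => p.2.1) '' O ∪ (fun p => p.2.2) '' O
  have hT : T.ncard ≤ 3 * k := by
    have h0 : O.ncard ≤ k := hk
    have h1 := Set.ncard_union_le ((fun p => p.1) '' O ∪ (fun p => p.2.1) '' O)
      ((fun p => p.2.2) '' O)
    have h2 := Set.ncard_union_le ((fun p => p.1) '' O) ((fun p => p.2.1) '' O)
    have h3 := Set.ncard_image_le (f := fun p : V × V × V => p.1) (Set.toFinite O)
    have h4 := Set.ncard_image_le (f := fun p : V × V × V => p.2.1) (Set.toFinite O)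
    have h5 := Set.ncard_image_le (f := fun p : V × V × V => p.2.2) (Set.toFinite O)
    simp only [T]
    omega
  -- There are `|V| - 2k - 2 ≥ 3k + 1` middle positions, more than the at most `3k` vertices in
  -- overlaps.
  have hM := hα.ncard_Icc (a := k + 2) (b := Nat.card V - k - 1) (by omega) (by omega)
  have hnot : ¬ {z | k + 2 ≤ α z ∧ α z ≤ Nat.card V - k - 1} ⊆ T := fun hs => by
    have := Set.ncard_le_ncard hs (Set.toFinite _)
    omega
  obtain ⟨w, ⟨hw1, hw2⟩, hwT⟩ := Set.not_subset.1 hnot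
  have hover : ∀ a b, G.Adj a b → α a < α w → ¬ α w < α b := fun a b hab h1 h2 =>
    hwT (Or.inr ⟨(a, b, w), mem_overlaps_natCast.2 ⟨hab, h1, h2⟩, rfl⟩)
  have hleft : ∀ x, G.Adj w x → α x < α w → α x + 1 = α w := by
    intro x hx hlt
    by_contra hne
    have hlt' : α x + 1 < α w := by omega
    obtain ⟨z, hz⟩ := hα.exists_between x w hlt'
    exact hwT (Or.inl (Or.inr ⟨(x, w, z), mem_overlaps_natCast.2
      ⟨hx.symm, by omega, by omega⟩, rfl⟩))
  have hright : ∀ x, G.Adj w x → α w < α x → α w + 1 = α x := by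
    intro x hx hlt
    by_contra hne
    have hlt' : α w + 1 < α x := by omega
    obtain ⟨z, hz⟩ := hα.exists_between w x hlt'
    exact hwT (Or.inl (Or.inl ⟨(w, x, z), mem_overlaps_natCast.2
      ⟨hx, by omega, by omega⟩, rfl⟩))
  let A : Set V := {x | α x < α w}
  have hltcard : α w + k + 1 ≤ Nat.card V := by omega
  obtain ⟨l₀, -, hl₀⟩ := hα.surjOn (a := 1) ⟨le_rfl, by omega⟩
  obtain ⟨r₀, -, hr₀⟩ := hα.surjOn (a := Nat.card V) ⟨by omega, le_rfl⟩
  -- Some edge leaves the set of vertices before `w`; as no edge passes over `w`, it ends in `w`.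
  -- The same argument from the right gives the second neighbour.
  obtain ⟨l, b, hlb, hlA, hbA⟩ := exists_adj_boundary hG (Y := A) (a := l₀) (b := w)
    (by show α l₀ < α w; omega) (by show ¬ α w < α w; omega)
  have hbw : b = w := by
    have h1 : ¬ α b < α w := hbA
    have h2 := hover l b hlb hlA
    exact hα.injective (by omega)
  subst hbw
  obtain ⟨r, c, hrc, hrA, hcA⟩ := exists_adj_boundary hG (Y := {x | α b < α x}) (a := r₀) (b := b)
    (by show α b < α r₀; omega) (by show ¬ α b < α b; omega)
  have hcb : c = b := by
    have h1 : ¬ α b < α c := hcA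
    have h2 : ¬ α c < α b := fun h => hover c r hrc.symm h hrA
    exact hα.injective (by omega)
  subst hcb
  have hlA' : α l < α c := hlA
  have hrA' : α c < α r := hrA
  have hs : Splits G c A l r := by
    refine ⟨hlA, by show ¬ α r < α c; omega, by show ¬ α c < α c; omega, fun x => ?_, ?_⟩
    · constructor
      · intro hx
        rcases lt_or_gt_of_ne (hα.injective.ne hx.ne) with h1 | h1
        · exact Or.inr (hα.injective ((hright x hx h1).symm.trans (hright r hrc.symm hrA)))
        · have h2 := hleft x hx h1
          have h3 := hleft l hlb.symm hlA
          exact Or.inl (hα.injective (by omega))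
      · rintro (rfl | rfl)
        exacts [hlb.symm, hrc.symm]
    · intro a ha b hb hbc hab
      have h1 : α b ≠ α c := hα.injective.ne hbc
      have h2 : ¬ α b < α c := hb
      exact hover a b hab ha (by omega)
  refine hns c (hs.isSuppressible hG ?_ ?_)
  · have h1 := hα.ncard_Icc (a := 1) (b := α c - 1) le_rfl (by omega)
    have h2 : {z | 1 ≤ α z ∧ α z ≤ α c - 1} ⊆ A := by
      rintro z ⟨h3, h4⟩
      show α z < α c
      omega
    have := Set.ncard_le_ncard h2 (Set.toFinite _)
    omega
  · have h1 := hα.ncard_Icc (a := α c + 1) (b := Nat.card V) (by omega) le_rfl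
    have h2 : {z | α c + 1 ≤ α z ∧ α z ≤ Nat.card V} ⊆ (insert c A)ᶜ := by
      rintro z ⟨h3, h4⟩ (rfl | h5)
      · omega
      · have : α z < α c := h5
        omega
    have := Set.ncard_le_ncard h2 (Set.toFinite _)
    omega

theorem ncard_edgeSet_le_of_not_isSuppressible {G : SimpleGraph V} {k : ℕ} (hG : G.Connected)
    (hns : ∀ v, ¬ IsSuppressible G k v) (hk : olaPlus G ≤ k) : G.edgeSet.ncard ≤ 6 * k + 1 := by
  have := hG.nonempty
  have h1 := ncard_edgeSet_add_one_le G
  have h2 := card_le_of_not_isSuppressible hG hns hk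
  omega

end Size


/-! ### Splitting vertices under successive suppressions -/

section Induced

variable {V : Type*}

/-- Suppression of `v` without changing the vertex set: `v` becomes isolated. -/
def suppressAt (g : SimpleGraph V) (v : V) : SimpleGraph V where
  Adj a b := a ≠ v ∧ b ≠ v ∧ (g.Adj a b ∨ (a ≠ b ∧ g.Adj v a ∧ g.Adj v b))
  symm := ⟨fun _ _ h => ⟨h.2.1, h.1, h.2.2.elim (fun h => Or.inl h.symm)
    (fun h => Or.inr ⟨h.1.symm, h.2.2, h.2.1⟩)⟩⟩
  loopless := ⟨fun _ h => h.2.2.elim (fun h => g.irrefl h) (fun h => h.1 rfl)⟩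

theorem suppressAt_adj {g : SimpleGraph V} {v a b : V} : (suppressAt g v).Adj a b ↔
    a ≠ v ∧ b ≠ v ∧ (g.Adj a b ∨ (a ≠ b ∧ g.Adj v a ∧ g.Adj v b)) := Iff.rfl

/-- Suppression in an induced subgraph. -/
def suppressInduceIso (g : SimpleGraph V) (s : Set V) (v : V) (hv : v ∈ s) :
    suppress (g.induce s) ⟨v, hv⟩ ≃g (suppressAt g v).induce (s \ {v}) where
  toFun w := ⟨w.1.1, w.1.2, fun he => w.2 (Subtype.ext he)⟩
  invFun w := ⟨⟨w.1, w.2.1⟩, fun he => w.2.2 (congrArg Subtype.val he)⟩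
  left_inv _ := rfl
  right_inv _ := rfl
  map_rel_iff' := by
    rintro ⟨⟨a, ha⟩, hav⟩ ⟨⟨b, hb⟩, hbv⟩
    have h1 : a ≠ v := fun he => hav (Subtype.ext he)
    have h2 : b ≠ v := fun he => hbv (Subtype.ext he)
    simp [suppress, suppressAt, h1, h2]

namespace Splits

variable {g : SimpleGraph V} {v w : V} {A B : Set V} {u₁ u₂ x₁ x₂ : V}

theorem symm_symm (h : Splits g v (insert v A)ᶜ u₁ u₂) (hv : v ∉ A) : Splits g v A u₂ u₁ := by
  have := h.symm
  have hA : (insert v (insert v A)ᶜ)ᶜ = A := by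
    ext a
    by_cases ha : a = v
    · subst ha; simp [hv]
    · simp [ha]
  rwa [hA] at this

/-- If `w` is adjacent to `v`, then `w = u₁` and the other neighbour `x` of `w`, again in `A`, takes
its place. Otherwise the neighbours of `v` do not change. -/
theorem suppressAt_of_mem (h : Splits g v A u₁ u₂) (hw : Splits g w B x₁ x₂) (hwA : w ∈ A) :
    ∃ u₁' u₂', Splits (suppressAt g w) v A u₁' u₂' := by
  have hvw : v ≠ w := fun he => h.notMem (he ▸ hwA)
  have hnb : ∀ x, g.Adj w x → x = v ∨ x ∈ A := fun x hx => by
    by_contra hn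
    rw [not_or] at hn
    exact h.sep w hwA x hn.2 hn.1 hx
  have hsep : ∀ a ∈ A, ∀ b ∉ A, b ≠ v → ¬ (LinArr.suppressAt g w).Adj a b := by
    rintro a ha b hb hbv ⟨-, -, hab | ⟨-, -, hwb⟩⟩
    · exact h.sep a ha b hb hbv hab
    · exact (hnb b hwb).elim hbv hb
  have hu2w : u₂ ≠ w := fun he => h.right (he ▸ hwA)
  by_cases hvx : g.Adj w v
  · have hu1 : w = u₁ := ((h.adj_iff w).1 hvx.symm).resolve_right hu2w.symm
    obtain ⟨x, hx⟩ : ∃ x, ∀ y, g.Adj w y ↔ y = v ∨ y = x := by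
      rcases (hw.adj_iff v).1 hvx with rfl | rfl
      · exact ⟨x₂, hw.adj_iff⟩
      · exact ⟨x₁, fun y => (hw.adj_iff y).trans or_comm⟩
    have hxne : x ≠ v := by
      rintro rfl
      have h1 := (hx x₁).1 hw.adj_left
      have h2 := (hx x₂).1 hw.adj_right
      exact hw.ne ((or_self_iff.1 h1).trans (or_self_iff.1 h2).symm)
    have hwx := (hx x).2 (Or.inr rfl)
    refine ⟨x, u₂, (hnb x hwx).resolve_left hxne, h.right, h.notMem, fun y => ?_, hsep⟩
    constructor
    · rintro ⟨-, hyw, hy | ⟨hvy, -, hwy⟩⟩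
      · exact Or.inr (((h.adj_iff y).1 hy).resolve_left fun he => hyw (he.trans hu1.symm))
      · exact Or.inl (((hx y).1 hwy).resolve_left hvy.symm)
    · rintro (rfl | rfl)
      · exact ⟨hvw, hwx.ne', Or.inr ⟨hxne.symm, hvx, hwx⟩⟩
      · exact ⟨hvw, hu2w, Or.inl h.adj_right⟩
  · refine ⟨u₁, u₂, h.left, h.right, h.notMem, fun y => ?_, hsep⟩
    rw [suppressAt_adj, ← h.adj_iff]
    constructor
    · rintro ⟨-, -, hy | hy⟩
      exacts [hy, absurd hy.2.1 hvx]
    · exact fun hy => ⟨hvw, fun he => hvx (he ▸ hy.symm), Or.inl hy⟩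

/-- Splitting vertices remain splitting when another one is suppressed. -/
theorem suppressAt (h : Splits g v A u₁ u₂) (hw : Splits g w B x₁ x₂) (hvw : v ≠ w) :
    ∃ u₁' u₂', Splits (suppressAt g w) v A u₁' u₂' := by
  by_cases hwA : w ∈ A
  · exact h.suppressAt_of_mem hw hwA
  · obtain ⟨y₁, y₂, hy⟩ := h.symm.suppressAt_of_mem hw
      (fun hn => hn.elim (fun he => hvw he.symm) hwA)
    exact ⟨y₂, y₁, hy.symm_symm h.notMem⟩

/-- The vertex `w` is put back into the side of its neighbour `x₁`. Since `x₁ x₂` is an edge after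
suppression, `x₂` is `v` or in `A`, so `w` has no neighbour beyond `v`. -/
theorem of_suppressAt_of_mem (h : Splits (LinArr.suppressAt g w) v A u₁ u₂)
    (hw : Splits g w B x₁ x₂) (hvw : v ≠ w) (hx : x₁ ∈ A) :
    ∃ A' u₁' u₂', Splits g v A' u₁' u₂' := by
  have hx12 : (LinArr.suppressAt g w).Adj x₁ x₂ :=
    ⟨hw.adj_left.ne', hw.adj_right.ne', Or.inr ⟨hw.ne, hw.adj_left, hw.adj_right⟩⟩
  have hx2 : x₂ = v ∨ x₂ ∈ A := by
    by_contra hn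
    rw [not_or] at hn
    exact h.sep _ hx _ hn.2 hn.1 hx12
  have hx1v : x₁ ≠ v := fun he => h.notMem (he ▸ hx)
  have hu2w : u₂ ≠ w := h.adj_right.2.1
  have hsep : ∀ a ∈ insert w A, ∀ b ∉ insert w A, b ≠ v → ¬ g.Adj a b := by
    intro a ha b hb hbv hab
    have hbw : b ≠ w := fun he => hb (Or.inl he)
    have hbA : b ∉ A := fun hn => hb (Or.inr hn)
    by_cases haw : a = w
    · subst haw
      rcases (hw.adj_iff b).1 hab with rfl | rfl
      · exact hbA hx
      · exact hx2.elim hbv hbA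
    · exact h.sep a (ha.resolve_left haw) b hbA hbv ⟨haw, hbw, Or.inl hab⟩
  have hu2 : u₂ ∉ insert w A := fun hn => hn.elim hu2w h.right
  have hv : v ∉ insert w A := fun hn => hn.elim hvw h.notMem
  by_cases hxv : x₂ = v
  · have hu1 : x₁ = u₁ := ((h.adj_iff x₁).1 (hxv ▸ hx12.symm)).resolve_right
      fun he => h.right (he ▸ hx)
    refine ⟨insert w A, w, u₂, Or.inl rfl, hu2, hv, fun y => ⟨fun hy => ?_, ?_⟩, hsep⟩
    · by_cases hyw : y = w
      · exact Or.inl hyw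
      · refine Or.inr (((h.adj_iff y).1 ⟨hvw, hyw, Or.inl hy⟩).resolve_left fun he => ?_)
        rw [he, ← hu1, ← hxv] at hy
        exact hw.not_adj hy.symm
    · rintro (rfl | rfl)
      · exact hxv ▸ hw.adj_right.symm
      · rcases h.adj_right.2.2 with h1 | ⟨h1, -, h2⟩
        · exact h1
        · rcases (hw.adj_iff _).1 h2 with h3 | h3
          · exact absurd (h3 ▸ hx) h.right
          · exact absurd (h3.trans hxv).symm h1
  · have hnadj : ¬ g.Adj w v := fun hn =>
      ((hw.adj_iff v).1 hn).elim (fun he => hx1v he.symm) fun he => hxv he.symm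
    refine ⟨insert w A, u₁, u₂, Or.inr h.left, hu2, hv, fun y => ?_, hsep⟩
    rw [← h.adj_iff, suppressAt_adj]
    constructor
    · exact fun hy => ⟨hvw, fun he => hnadj (he ▸ hy.symm), Or.inl hy⟩
    · rintro ⟨-, -, hy | hy⟩
      exacts [hy, absurd hy.2.1 hnadj]

/-- Suppression does not create splitting vertices. -/
theorem of_suppressAt (h : Splits (LinArr.suppressAt g w) v A u₁ u₂) (hw : Splits g w B x₁ x₂)
    (hvw : v ≠ w) : ∃ A' u₁' u₂', Splits g v A' u₁' u₂' := by
  by_cases h1 : x₁ ∈ A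
  · exact h.of_suppressAt_of_mem hw hvw h1
  · by_cases h2 : x₂ ∈ A
    · exact h.of_suppressAt_of_mem hw.symm hvw h2
    -- Neither neighbour of `w` is in `A` and at most one is `v`, so some neighbour lies on the
    -- opposite side.
    · by_cases h3 : x₁ = v
      · refine h.symm.of_suppressAt_of_mem hw.symm hvw fun hn => hn.elim (fun he => ?_) h2
        exact hw.ne (h3.trans he.symm)
      · exact h.symm.of_suppressAt_of_mem hw hvw fun hn => hn.elim h3 h1

/-- All edges of `g` have their ends in `s`, so splitting is the same in `g` and in the induced
graph. -/
theorem of_induce {s : Set V} (hs : ∀ a b, g.Adj a b → a ∈ s) {v u₁ u₂ : s} {A : Set s}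
    (h : Splits (g.induce s) v A u₁ u₂) : Splits g v (Subtype.val '' A) u₁ u₂ := by
  have hmem : ∀ a : s, (a : V) ∈ Subtype.val '' A ↔ a ∈ A := fun a =>
    Subtype.val_injective.mem_set_image
  refine ⟨(hmem _).2 h.left, fun hn => h.right ((hmem _).1 hn), fun hn => h.notMem ((hmem _).1 hn),
    fun w => ?_, ?_⟩
  · constructor
    · intro hw
      have := (h.adj_iff ⟨w, hs _ _ hw.symm⟩).1 hw
      exact this.imp (congrArg Subtype.val) (congrArg Subtype.val)
    · rintro (rfl | rfl)
      exacts [h.adj_left, h.adj_right]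
  · rintro _ ⟨a, ha, rfl⟩ b hb hbv hab
    have hbs := hs _ _ hab.symm
    exact h.sep a ha ⟨b, hbs⟩ (fun hn => hb ((hmem ⟨b, hbs⟩).2 hn))
      (fun he => hbv (congrArg Subtype.val he)) hab

theorem induce {s : Set V} (hs : ∀ a b, g.Adj a b → a ∈ s) (h : Splits g v A u₁ u₂) :
    Splits (g.induce s) ⟨v, hs _ _ h.adj_left⟩ (Subtype.val ⁻¹' A) ⟨u₁, hs _ _ h.adj_left.symm⟩
      ⟨u₂, hs _ _ h.adj_right.symm⟩ where
  left := h.left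
  right := h.right
  notMem := h.notMem
  adj_iff w := by
    rw [Subtype.ext_iff, Subtype.ext_iff, ← h.adj_iff]
    rfl
  sep a ha b hb hbv := h.sep a ha b hb fun he => hbv (Subtype.ext he)

theorem ncard_preimage_val {s B : Set V} :
    (Subtype.val ⁻¹' B : Set s).ncard = (B ∩ s).ncard := by
  rw [← Subtype.val_injective.injOn.ncard_image, Subtype.image_preimage_coe, Set.inter_comm]

theorem ncard_preimage_compl {s : Set V} (hv : v ∈ s) :
    (insert (⟨v, hv⟩ : s) (Subtype.val ⁻¹' A))ᶜ.ncard = (s \ insert v A).ncard := by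
  rw [← Subtype.val_injective.injOn.ncard_image]
  congr 1
  ext a
  simp only [Set.mem_image, Set.mem_compl_iff, Set.mem_insert_iff, Set.mem_preimage, not_or,
    Subtype.exists, Subtype.mk.injEq, exists_and_right, exists_eq_right, Set.mem_sdiff]
  exact ⟨fun ⟨⟨h0, h1⟩, h2⟩ => ⟨h0, h1, h2⟩, fun ⟨h0, h1, h2⟩ => ⟨⟨h0, h1⟩, h2⟩⟩

theorem isSuppressible_induce {s : Set V} [Finite s] (hs : ∀ a b, g.Adj a b → a ∈ s) {k : ℕ}
    (h : Splits g v A u₁ u₂) (hG : (g.induce s).Connected) (h1 : k < (A ∩ s).ncard)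
    (h2 : k < (s \ insert v A).ncard) :
    IsSuppressible (g.induce s) k ⟨v, hs _ _ h.adj_left⟩ :=
  (h.induce hs).isSuppressible hG (by rwa [ncard_preimage_val]) (by rwa [ncard_preimage_compl])

end Splits

theorem IsSuppressible.lt_ncard_induce {g : SimpleGraph V} {s A : Set V} [Finite s] {v u₁ u₂ : V}
    (hs : ∀ a b, g.Adj a b → a ∈ s) {k : ℕ} (hv : v ∈ s) (h : IsSuppressible (g.induce s) k ⟨v, hv⟩)
    (hA : Splits g v A u₁ u₂) : k < (A ∩ s).ncard ∧ k < (s \ insert v A).ncard := by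
  have := h.lt_ncard (hA.induce hs)
  rwa [Splits.ncard_preimage_val, Splits.ncard_preimage_compl] at this

end Induced

/-! ### Transport along isomorphisms and composition of reductions -/

section Iso

variable {V W : Type*}

theorem Splits.iso {G : SimpleGraph V} {H : SimpleGraph W} (e : H ≃g G) {v u₁ u₂ : V} {A : Set V}
    (h : Splits G v A u₁ u₂) : Splits H (e.symm v) (e ⁻¹' A) (e.symm u₁) (e.symm u₂) where
  left := by simpa using h.left
  right := by simpa using h.right
  notMem := by simpa using h.notMem
  adj_iff w := by
    have : H.Adj (e.symm v) w ↔ G.Adj v (e w) := by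
      rw [← e.map_adj_iff, RelIso.apply_symm_apply]
    rw [this, h.adj_iff, RelIso.eq_symm_apply, RelIso.eq_symm_apply]
  sep a ha b hb hbv hab := h.sep (e a) ha (e b) hb
    (fun he => hbv (by rw [← he, RelIso.symm_apply_apply])) (e.map_adj_iff.2 hab)

theorem IsSuppressible.iso [Finite V] {G : SimpleGraph V} {H : SimpleGraph W} (e : H ≃g G) {v : V}
    {k : ℕ} (h : IsSuppressible G k v) (hG : G.Connected) : IsSuppressible H k (e.symm v) := by
  have := Finite.of_equiv _ e.symm.toEquiv
  obtain ⟨A, u₁, u₂, hs⟩ := h.exists_splits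
  obtain ⟨h1, h2⟩ := h.lt_ncard hs
  have hcard : ∀ B : Set V, (e ⁻¹' B).ncard = B.ncard := fun B => by
    rw [← e.injective.injOn.ncard_image, Set.image_preimage_eq _ e.surjective]
  refine (hs.iso e).isSuppressible (e.connected_iff.2 hG) (by rwa [hcard]) ?_
  have : (insert (e.symm v) (e ⁻¹' A))ᶜ = e ⁻¹' (insert v A)ᶜ := by
    ext w
    simp [RelIso.eq_symm_apply]
  rwa [this, hcard]

/-- Isomorphic graphs remain isomorphic when corresponding vertices are suppressed. -/
def suppressIso {G : SimpleGraph V} {H : SimpleGraph W} (e : H ≃g G) (v : V) :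
    suppress H (e.symm v) ≃g suppress G v where
  toEquiv := e.toEquiv.subtypeEquiv fun w => by
    rw [Ne, Ne, RelIso.eq_symm_apply]; rfl
  map_rel_iff' := by
    rintro ⟨a, ha⟩ ⟨b, hb⟩
    have key : ∀ w, H.Adj (e.symm v) w ↔ G.Adj v (e w) := fun w => by
      rw [← e.map_adj_iff, RelIso.apply_symm_apply]
    have hab : G.Adj (e a) (e b) ↔ H.Adj a b := e.map_adj_iff
    show (G.Adj (e a) (e b) ∨ _ ∧ G.Adj v (e a) ∧ G.Adj v (e b)) ↔ (H.Adj a b ∨ _)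
    rw [hab, ← key, ← key]
    simp

end Iso

/-- The definition allows renaming only at the end of a sequence of suppressions; each step is
transported along the isomorphism to allow it at the start, as needed for composition. -/
theorem ReducesTo.iso_left {k : ℕ} {V W : Type} {G : SimpleGraph V} {H : SimpleGraph W}
    (h : ReducesTo k G H) : Finite V → G.Connected → ∀ {U : Type} {F : SimpleGraph U},
      (F ≃g G) → ReducesTo k F H := by
  induction h with
  | iso e => exact fun _ _ _ _ e' => .iso (e'.trans e)
  | step v hv h ih =>
    exact fun _ hG _ _ e' => .step (e'.symm v) (hv.iso e' hG)
      (ih inferInstance (hv.connected_suppress hG) (suppressIso e' v))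

theorem ReducesTo.trans {k : ℕ} {V W U : Type} {G : SimpleGraph V} {H : SimpleGraph W}
    {K : SimpleGraph U} (h : ReducesTo k G H) (h' : ReducesTo k H K) :
    Finite V → G.Connected → ReducesTo k G K := by
  induction h with
  | iso e =>
    intro _ hG
    have := Finite.of_equiv _ e.toEquiv
    exact h'.iso_left this (e.connected_iff.1 hG) e
  | step v hv h ih =>
    exact fun _ hG => .step v hv (ih h' inferInstance (hv.connected_suppress hG))

theorem ReducesTo.suppressAt {k : ℕ} {V W : Type} [Finite V] {G : SimpleGraph V}
    {g : SimpleGraph W} {s : Set W} (h : ReducesTo k G (g.induce s)) (hG : G.Connected) {v : W}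
    (hv : v ∈ s) (hs : IsSuppressible (g.induce s) k ⟨v, hv⟩) :
    ReducesTo k G ((suppressAt g v).induce (s \ {v})) :=
  h.trans (.step _ hs (.iso (suppressInduceIso g s v hv))) ‹_› hG


infixr:60 " ;; " => Prog.seq

/-! ### Semantics of programs -/

section Semantics

namespace Prog

/-- The registers that a program may change. -/
def regs : Prog → List ℕ
  | const x _ => [x]
  | add x _ _ => [x]
  | sub x _ _ => [x]
  | load x _ _ => [x]
  | store _ _ _ => []
  | seq p q => p.regs ++ q.regs
  | ite _ _ p q => p.regs ++ q.regs
  | .while _ _ p => p.regs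

/-- The arrays that a program may change. -/
def arrs : Prog → List ℕ
  | const _ _ => []
  | add _ _ _ => []
  | sub _ _ _ => []
  | load _ _ _ => []
  | store a _ _ => [a]
  | seq p q => p.arrs ++ q.arrs
  | ite _ _ p q => p.arrs ++ q.arrs
  | .while _ _ p => p.arrs

/-- Programs without loops. -/
def LoopFree : Prog → Prop
  | seq p q => p.LoopFree ∧ q.LoopFree
  | ite _ _ p q => p.LoopFree ∧ q.LoopFree
  | .while _ _ _ => False
  | _ => True

/-- The effect of a loop-free program. -/
def eval : Prog → Store → Store
  | const x c, s => s.setReg x c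
  | add x y z, s => s.setReg x (s.reg y + s.reg z)
  | sub x y z, s => s.setReg x (s.reg y - s.reg z)
  | load x a y, s => s.setReg x (s.arr a (s.reg y))
  | store a y x, s => s.setArr a (s.reg y) (s.reg x)
  | seq p q, s => q.eval (p.eval s)
  | ite x y p q, s => if s.reg x < s.reg y then p.eval s else q.eval s
  | .while _ _ _, s => s

/-- A bound for the running time of a loop-free program. -/
def cost : Prog → ℕ
  | seq p q => p.cost + q.cost
  | ite _ _ p q => max p.cost q.cost + 1
  | _ => 1

end Prog

/-- Started in `s`, the program `p` halts within `T` steps in a memory that satisfies `Q`. -/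
def HaltsWithin (p : Prog) (s : Store) (T : ℕ) (Q : Store → Prop) : Prop :=
  ∃ (t : ℕ) (s' : Store), Run p s t s' ∧ t ≤ T ∧ Q s'

theorem Prog.run_eval {p : Prog} (h : p.LoopFree) (s : Store) :
    ∃ t, Run p s t (p.eval s) ∧ t ≤ p.cost := by
  induction p generalizing s with
  | const x c => exact ⟨1, .const x c s, le_rfl⟩
  | add x y z => exact ⟨1, .add x y z s, le_rfl⟩
  | sub x y z => exact ⟨1, .sub x y z s, le_rfl⟩
  | load x a y => exact ⟨1, .load x a y s, le_rfl⟩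
  | store a y x => exact ⟨1, .store a y x s, le_rfl⟩
  | seq p q hp hq =>
    obtain ⟨t₁, h1, h2⟩ := hp h.1 s
    obtain ⟨t₂, h3, h4⟩ := hq h.2 (p.eval s)
    exact ⟨_, .seq h1 h3, Nat.add_le_add h2 h4⟩
  | ite x y p q hp hq =>
    by_cases hxy : s.reg x < s.reg y
    · obtain ⟨t, h1, h2⟩ := hp h.1 s
      refine ⟨t + 1, ?_, Nat.succ_le_succ (h2.trans (le_max_left _ _))⟩
      simp only [eval, if_pos hxy]
      exact .iteTrue hxy h1
    · obtain ⟨t, h1, h2⟩ := hq h.2 s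
      refine ⟨t + 1, ?_, Nat.succ_le_succ (h2.trans (le_max_right _ _))⟩
      simp only [eval, if_neg hxy]
      exact .iteFalse hxy h1
  | _ => exact h.elim

theorem Run.reg_eq {p : Prog} {s s' : Store} {t : ℕ} (h : Run p s t s') {x : ℕ}
    (hx : x ∉ p.regs) : s'.reg x = s.reg x := by
  induction h with
  | const | add | sub | load =>
    simp only [Prog.regs, List.mem_singleton] at hx
    simp [Store.setReg, hx]
  | store => rfl
  | seq _ _ ih1 ih2 =>
    simp only [Prog.regs, List.mem_append, not_or] at hx
    rw [ih2 hx.2, ih1 hx.1]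
  | iteTrue _ _ ih =>
    simp only [Prog.regs, List.mem_append, not_or] at hx
    exact ih hx.1
  | iteFalse _ _ ih =>
    simp only [Prog.regs, List.mem_append, not_or] at hx
    exact ih hx.2
  | whileTrue _ _ _ ih1 ih2 => rw [ih2 hx, ih1 hx]
  | whileFalse => rfl

theorem Run.arr_eq {p : Prog} {s s' : Store} {t : ℕ} (h : Run p s t s') {a : ℕ}
    (ha : a ∉ p.arrs) : s'.arr a = s.arr a := by
  induction h with
  | store b =>
    simp only [Prog.arrs, List.mem_singleton] at ha
    simp [Store.setArr, ha]
  | const | add | sub | load => rfl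
  | seq _ _ ih1 ih2 =>
    simp only [Prog.arrs, List.mem_append, not_or] at ha
    rw [ih2 ha.2, ih1 ha.1]
  | iteTrue _ _ ih =>
    simp only [Prog.arrs, List.mem_append, not_or] at ha
    exact ih ha.1
  | iteFalse _ _ ih =>
    simp only [Prog.arrs, List.mem_append, not_or] at ha
    exact ih ha.2
  | whileTrue _ _ _ ih1 ih2 => rw [ih2 ha, ih1 ha]
  | whileFalse => rfl

/-- The memory `s'` agrees with `s` on everything that `p` cannot change. -/
def Prog.Frame (p : Prog) (s s' : Store) : Prop :=
  (∀ x, x ∉ p.regs → s'.reg x = s.reg x) ∧ ∀ a, a ∉ p.arrs → s'.arr a = s.arr a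

theorem Run.frame {p : Prog} {s s' : Store} {t : ℕ} (h : Run p s t s') : p.Frame s s' :=
  ⟨fun _ => h.reg_eq, fun _ => h.arr_eq⟩

/-- Registers and arrays that a program does not mention as targets are unchanged; with this,
specifications need only describe what changes. -/
theorem HaltsWithin.frame {p : Prog} {s : Store} {T : ℕ} {Q : Store → Prop}
    (h : HaltsWithin p s T Q) : HaltsWithin p s T fun s' => Q s' ∧ p.Frame s s' := by
  obtain ⟨t, s', h1, h2, h3⟩ := h
  exact ⟨t, s', h1, h2, h3, h1.frame⟩

theorem HaltsWithin.mono {p : Prog} {s : Store} {T T' : ℕ} {Q Q' : Store → Prop}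
    (h : HaltsWithin p s T Q) (hT : T ≤ T') (hQ : ∀ s', Q s' → Q' s') : HaltsWithin p s T' Q' := by
  obtain ⟨t, s', h1, h2, h3⟩ := h
  exact ⟨t, s', h1, h2.trans hT, hQ s' h3⟩

theorem HaltsWithin.seq {p q : Prog} {s : Store} {T₁ T₂ : ℕ} {R Q : Store → Prop}
    (hp : HaltsWithin p s T₁ R) (hq : ∀ s', R s' → HaltsWithin q s' T₂ Q) :
    HaltsWithin (.seq p q) s (T₁ + T₂) Q := by
  obtain ⟨t₁, s₁, h1, h2, h3⟩ := hp
  obtain ⟨t₂, s₂, h4, h5, h6⟩ := hq s₁ h3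
  exact ⟨_, s₂, .seq h1 h4, Nat.add_le_add h2 h5, h6⟩

theorem HaltsWithin.of_loopFree {p : Prog} (h : p.LoopFree) {s : Store} {Q : Store → Prop}
    (hQ : Q (p.eval s)) : HaltsWithin p s p.cost Q := by
  obtain ⟨t, h1, h2⟩ := Prog.run_eval h s
  exact ⟨t, _, h1, h2, hQ⟩

theorem HaltsWithin.ite {x y : ℕ} {p q : Prog} {s : Store} {T : ℕ} {Q : Store → Prop}
    (hp : s.reg x < s.reg y → HaltsWithin p s T Q) (hq : ¬ s.reg x < s.reg y → HaltsWithin q s T Q) :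
    HaltsWithin (.ite x y p q) s (T + 1) Q := by
  by_cases h : s.reg x < s.reg y
  · obtain ⟨t, s', h1, h2, h3⟩ := hp h
    exact ⟨_, s', .iteTrue h h1, Nat.succ_le_succ h2, h3⟩
  · obtain ⟨t, s', h1, h2, h3⟩ := hq h
    exact ⟨_, s', .iteFalse h h1, Nat.succ_le_succ h2, h3⟩

theorem Prog.eval_frame {p : Prog} (h : p.LoopFree) (s : Store) : p.Frame s (p.eval s) := by
  obtain ⟨t, h1, -⟩ := Prog.run_eval h s
  exact h1.frame

/-- A loop with a loop-free body whose invariant bounds the number of remaining iterations. -/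
theorem HaltsWithin.while {x y : ℕ} {p : Prog} (hp : p.LoopFree) {s₀ : Store}
    (I : ℕ → Store → Prop)
    (hI : ∀ m s, I m s → p.Frame s₀ s → s.reg x < s.reg y → ∃ m' < m, I m' (p.eval s))
    {m : ℕ} (h0 : I m s₀) :
    HaltsWithin (.while x y p) s₀ (m * (p.cost + 1) + 1)
      fun s => (∃ m', I m' s) ∧ ¬ s.reg x < s.reg y := by
  have key : ∀ m s, I m s → p.Frame s₀ s →
      HaltsWithin (.while x y p) s (m * (p.cost + 1) + 1)
        fun s => (∃ m', I m' s) ∧ ¬ s.reg x < s.reg y := by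
    intro m
    induction m using Nat.strong_induction_on with
    | _ m ih =>
      intro s hs hf
      by_cases h : s.reg x < s.reg y
      · obtain ⟨m', hm, h1⟩ := hI m s hs hf h
        obtain ⟨t₁, h2, h3⟩ := Prog.run_eval hp s
        obtain ⟨t₂, s', h4, h5, h6⟩ := ih m' hm (p.eval s) h1
          ⟨fun z hz => (h2.reg_eq hz).trans (hf.1 z hz),
            fun z hz => (h2.arr_eq hz).trans (hf.2 z hz)⟩
        refine ⟨_, s', .whileTrue h h2 h4, ?_, h6⟩
        have : (m' + 1) * (p.cost + 1) ≤ m * (p.cost + 1) := Nat.mul_le_mul_right _ hm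
        rw [Nat.succ_mul] at this
        omega
      · exact ⟨1, s, .whileFalse h, by omega, ⟨m, hs⟩, h⟩
  exact key m s₀ h0 ⟨fun _ _ => rfl, fun _ _ => rfl⟩

@[simp] theorem Store.setReg_reg (s : Store) (x c y : ℕ) :
    (s.setReg x c).reg y = if y = x then c else s.reg y := by
  simp [Store.setReg, Function.update_apply]

@[simp] theorem Store.setReg_arr (s : Store) (x c : ℕ) : (s.setReg x c).arr = s.arr := rfl

@[simp] theorem Store.setArr_reg (s : Store) (a i c : ℕ) : (s.setArr a i c).reg = s.reg := rfl

@[simp] theorem Store.setArr_arr (s : Store) (a i c b : ℕ) :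
    (s.setArr a i c).arr b = if b = a then Function.update (s.arr a) i c else s.arr b := by
  simp [Store.setArr, Function.update_apply]

end Semantics


/-! ### Adjacency arrays -/

section AdjacencyArrays

/-- `st 0, …, st n` is a division of the positions `0, …, M - 1` into `n` consecutive blocks. -/
structure IsOffsets (n M : ℕ) (st : ℕ → ℕ) : Prop where
  zero : st 0 = 0
  last : st n = M
  mono : ∀ v < n, st v ≤ st (v + 1)

theorem IsOffsets.le {n M : ℕ} {st : ℕ → ℕ} (h : IsOffsets n M st) {u v : ℕ} (huv : u ≤ v)
    (hv : v ≤ n) : st u ≤ st v := by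
  induction v, huv using Nat.le_induction with
  | base => exact le_rfl
  | succ v huv ih => exact (ih (by omega)).trans (h.mono v (by omega))

theorem IsOffsets.block_unique {n M : ℕ} {st : ℕ → ℕ} (h : IsOffsets n M st) {u v j : ℕ}
    (hu : u < n) (hv : v < n) (hju : st u ≤ j) (hju' : j < st (u + 1)) (hjv : st v ≤ j)
    (hjv' : j < st (v + 1)) : u = v := by
  rcases Nat.lt_trichotomy u v with h1 | h1 | h1
  · have := h.le (show u + 1 ≤ v by omega) hv.le
    omega
  · exact h1
  · have := h.le (show v + 1 ≤ u by omega) hu.le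
    omega

theorem IsOffsets.lt {n M : ℕ} {st : ℕ → ℕ} (h : IsOffsets n M st) {u j : ℕ} (hu : u < n)
    (hj : j < st (u + 1)) : j < M := by
  have := h.le (show u + 1 ≤ n by omega) le_rfl
  rw [h.last] at this
  omega

theorem IsOffsets.exists_block {n M : ℕ} {st : ℕ → ℕ} (h : IsOffsets n M st) {j : ℕ} (hj : j < M) :
    ∃ u < n, st u ≤ j ∧ j < st (u + 1) := by
  by_contra hcon
  push Not at hcon
  have : ∀ v ≤ n, st v ≤ j := by
    intro v
    induction v with
    | zero => intro _; rw [h.zero]; omega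
    | succ v ih => exact fun hv => hcon v (by omega) (ih (by omega))
  have := this n le_rfl
  rw [h.last] at this
  omega

/-- For the vertices `v ∈ S`, the block of `v` in the array `A` lists the neighbours of `v` without
repetition; other vertices are isolated. -/
structure AdjArrays (S : Set ℕ) (st A : ℕ → ℕ) (g : SimpleGraph ℕ) : Prop where
  inj : ∀ v ∈ S, ∀ i j, st v ≤ i → i < st (v + 1) → st v ≤ j → j < st (v + 1) → A i = A j → i = j
  adj : ∀ v ∈ S, ∀ w, g.Adj v w ↔ ∃ j, st v ≤ j ∧ j < st (v + 1) ∧ A j = w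
  mem : ∀ v w, g.Adj v w → v ∈ S

end AdjacencyArrays

/-! ### Depth-first search -/

section DepthFirstSearch

/-- `a` is an ancestor of `b` in the tree of the discovered vertices (those with `disc v > 0`). -/
def Anc (disc par : ℕ → ℕ) : ℕ → ℕ → Prop :=
  Relation.ReflTransGen fun x y => 0 < disc y ∧ par y = x

/-- The result of a depth-first search with root `0`: discovery numbers `1, …, n`, the order of
discovery, parents, the positions at which vertices were discovered, and the owners of positions. -/
structure IsDfsTree (n : ℕ) (st A : ℕ → ℕ) (g : SimpleGraph ℕ) (ord disc par jin own : ℕ → ℕ) :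
    Prop where
  disc_pos : ∀ v < n, 0 < disc v
  lt_of_disc_pos : ∀ v, 0 < disc v → v < n
  ord_lt : ∀ i < n, ord i < n
  disc_ord : ∀ i < n, disc (ord i) = i + 1
  disc_le : ∀ v < n, disc v ≤ n
  ord_disc_sub : ∀ v < n, ord (disc v - 1) = v
  disc_root : disc 0 = 1
  par_root : par 0 = n
  par_lt : ∀ v < n, v ≠ 0 → par v < n
  disc_par : ∀ v < n, v ≠ 0 → disc (par v) < disc v
  le_jin : ∀ v < n, v ≠ 0 → st (par v) ≤ jin v
  jin_lt : ∀ v < n, v ≠ 0 → jin v < st (par v + 1)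
  target_jin : ∀ v < n, v ≠ 0 → A (jin v) = v
  own_eq : ∀ v < n, ∀ j, st v ≤ j → j < st (v + 1) → own j = v
  anc : ∀ a b, g.Adj a b → disc a < disc b → Anc disc par a b

/-- The state of a depth-first search: `cur` is the current vertex, `cnt` the number of discovered
vertices, `ptr` the next position of each discovered vertex, `F` the set of finished vertices and
`P` the set of scanned positions. -/
structure DfsState (n M : ℕ) (st A : ℕ → ℕ) (g : SimpleGraph ℕ) (cur cnt : ℕ)
    (ord disc par jin ptr own : ℕ → ℕ) (F P : Finset ℕ) : Prop where
  lt_of_disc_pos : ∀ v, 0 < disc v → v < n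
  ord_disc : ∀ i < cnt, disc (ord i) = i + 1
  disc_le : ∀ v, 0 < disc v → disc v ≤ cnt
  disc_inj : ∀ v w, 0 < disc v → disc v = disc w → v = w
  -- The number `n`, stored as the parent of the root, marks the end of the search.
  cur_spec : cur = n ∨ (0 < disc cur ∧ cur ∉ F)
  disc_root : disc 0 = 1
  par_root : par 0 = n
  par_pos : ∀ v, 0 < disc v → v ≠ 0 → 0 < disc (par v)
  disc_par : ∀ v, 0 < disc v → v ≠ 0 → disc (par v) < disc v
  le_jin : ∀ v, 0 < disc v → v ≠ 0 → st (par v) ≤ jin v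
  jin_lt : ∀ v, 0 < disc v → v ≠ 0 → jin v < st (par v + 1)
  target_jin : ∀ v, 0 < disc v → v ≠ 0 → A (jin v) = v
  -- The unfinished vertices lie on the tree path to `cur`; the parent pointers replace a stack.
  anc_cur : ∀ v, 0 < disc v → v ∉ F → Anc disc par v cur
  finished : ∀ v ∈ F, 0 < disc v ∧ ptr v = st (v + 1)
  par_notMem : ∀ v, 0 < disc v → v ∉ F → par v ∉ F
  ptr_spec : ∀ v, 0 < disc v → st v ≤ ptr v ∧ ptr v ≤ st (v + 1)
  scanned : ∀ v, 0 < disc v → ∀ j, st v ≤ j → j < ptr v → own j = v ∧ 0 < disc (A j)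
  anc : ∀ a b, g.Adj a b → 0 < disc a → disc a < disc b → Anc disc par a b
  scanned_lt : ∀ j ∈ P, j < M
  scanned_spec : ∀ j ∈ P, ∃ v, 0 < disc v ∧ st v ≤ j ∧ j < ptr v

namespace DfsState

variable {n M : ℕ} {st A : ℕ → ℕ} {g : SimpleGraph ℕ} {cur cnt : ℕ}
  {ord disc par jin ptr own : ℕ → ℕ} {F P : Finset ℕ}

theorem disc_le_of_anc (h : DfsState n M st A g cur cnt ord disc par jin ptr own F P) {a b : ℕ}
    (hab : Anc disc par a b) (ha : 0 < disc a) : 0 < disc b ∧ disc a ≤ disc b := by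
  induction hab with
  | refl => exact ⟨ha, le_rfl⟩
  | tail _ hbc ih =>
    rename_i b c hab
    obtain ⟨hc, rfl⟩ := hbc
    refine ⟨hc, ih.2.trans ?_⟩
    by_cases h0 : c = 0
    · subst h0
      have := h.lt_of_disc_pos _ ih.1
      rw [h.par_root] at this
      omega
    · exact (h.disc_par c hc h0).le

theorem initial (hO : IsOffsets n M st) (hn : 0 < n) :
    DfsState n M st A g 0 1 (fun _ => 0) (Function.update (fun _ => 0) 0 1)
      (Function.update (fun _ => 0) 0 n) (fun _ => 0) (fun _ => 0) (fun _ => 0) ∅ ∅ := by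
  have hd : ∀ v, 0 < Function.update (fun _ : ℕ => 0) 0 1 v → v = 0 := fun v hv => by
    by_contra hne
    simp [hne] at hv
  constructor <;> try simp
  · intro v hv; rw [hd v hv]; exact hn
  · intro v hv; rw [hd v hv]; simp
  · intro v w hv hvw; rw [hd v hv, hd w (hvw ▸ hv)]
  · intro v hv h0; exact absurd (hd v hv) h0
  · intro v hv h0; exact absurd (hd v hv) h0
  · intro v hv h0; exact absurd (hd v hv) h0
  · intro v hv h0; exact absurd (hd v hv) h0
  · intro v hv h0; exact absurd (hd v hv) h0
  · intro v hv; rw [hd v hv]; exact .refl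
  · intro v hv; rw [hd v hv]; exact hO.zero
  · intro a b _ ha hab
    have := hd b (by omega)
    have := hd a ha
    subst_vars
    omega

theorem cur_lt (h : DfsState n M st A g cur cnt ord disc par jin ptr own F P) (hcur : cur < n) :
    0 < disc cur ∧ cur ∉ F := h.cur_spec.resolve_left hcur.ne

/-- Going back to the parent. -/
theorem up (h : DfsState n M st A g cur cnt ord disc par jin ptr own F P) (hcur : cur < n)
    (hptr : ¬ ptr cur < st (cur + 1)) :
    DfsState n M st A g (par cur) cnt ord disc par jin ptr own (insert cur F) P := by
  obtain ⟨hc, hF⟩ := h.cur_lt hcur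
  have hpar : par cur = n ∨ (0 < disc (par cur) ∧ par cur ∉ insert cur F) := by
    by_cases h0 : cur = 0
    · exact Or.inl (h0 ▸ h.par_root)
    · refine Or.inr ⟨h.par_pos _ hc h0, fun hn => ?_⟩
      rcases Finset.mem_insert.1 hn with h1 | h1
      · have := h.disc_par _ hc h0
        rw [h1] at this
        omega
      · exact h.par_notMem _ hc hF h1
  refine { h with
    cur_spec := hpar
    anc_cur := fun v hv hvF => ?_
    finished := fun v hv => ?_
    par_notMem := fun v hv hvF hp => ?_ }
  · rw [Finset.mem_insert, not_or] at hvF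
    rcases Relation.ReflTransGen.cases_tail (h.anc_cur v hv hvF.2) with h1 | ⟨b, h1, h2⟩
    · exact absurd h1.symm hvF.1
    · rw [h2.2]; exact h1
  · rcases Finset.mem_insert.1 hv with rfl | h1
    · exact ⟨hc, by have := (h.ptr_spec _ hc).2; omega⟩
    · exact h.finished v h1
  · rw [Finset.mem_insert, not_or] at hvF
    rcases Finset.mem_insert.1 hp with h1 | h1
    · have h2 := (h.disc_le_of_anc (h.anc_cur v hv hvF.2) hv).2
      by_cases h0 : v = 0
      · rw [h0, h.par_root] at h1
        omega
      · have := h.disc_par v hv h0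
        rw [h1] at this
        omega
    · exact h.par_notMem v hv hvF.2 h1

/-- Each position is scanned only once, which makes the search linear. -/
theorem ptr_notMem (h : DfsState n M st A g cur cnt ord disc par jin ptr own F P)
    (hO : IsOffsets n M st) (hcur : cur < n) (hptr : ptr cur < st (cur + 1)) : ptr cur ∉ P := by
  intro hP
  obtain ⟨v, hv, h1, h2⟩ := h.scanned_spec _ hP
  have h3 := (h.ptr_spec v hv).2
  have := hO.block_unique (h.lt_of_disc_pos v hv) hcur h1 (by omega)
    (h.ptr_spec cur (h.cur_lt hcur).1).1 hptr
  subst this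
  omega

/-- Scanning a position whose target has been discovered already. -/
theorem scan (h : DfsState n M st A g cur cnt ord disc par jin ptr own F P)
    (hO : IsOffsets n M st) (hcur : cur < n) (hptr : ptr cur < st (cur + 1))
    (hw : 0 < disc (A (ptr cur))) :
    DfsState n M st A g cur cnt ord disc par jin (Function.update ptr cur (ptr cur + 1))
      (Function.update own (ptr cur) cur) F (insert (ptr cur) P) := by
  obtain ⟨hc, hF⟩ := h.cur_lt hcur
  have hcs := h.ptr_spec cur hc
  have hown : ∀ v, 0 < disc v → ∀ j, st v ≤ j → j < ptr v → j ≠ ptr cur := by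
    intro v hv j h1 h2 he
    have h3 := (h.ptr_spec v hv).2
    have := hO.block_unique (h.lt_of_disc_pos v hv) hcur h1 (by omega) (he ▸ hcs.1) (he ▸ hptr)
    subst this
    omega
  refine { h with
    finished := fun v hv => ?_
    ptr_spec := fun v hv => ?_
    scanned := fun v hv j h1 h2 => ?_
    scanned_lt := fun j hj => ?_
    scanned_spec := fun j hj => ?_ }
  · have : v ≠ cur := fun he => hF (he ▸ hv)
    simpa [this] using h.finished v hv
  · by_cases he : v = cur
    · subst he
      simp only [Function.update_self]
      omega
    · simpa [he] using h.ptr_spec v hv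
  · by_cases he : v = cur
    · subst he
      simp only [Function.update_self] at h2
      by_cases hj : j = ptr v
      · subst hj
        simpa using hw
      · simpa [hj] using h.scanned v hv j h1 (by omega)
    · simp only [Function.update_of_ne he] at h2
      simpa [hown v hv j h1 h2] using h.scanned v hv j h1 h2
  · rcases Finset.mem_insert.1 hj with rfl | h1
    · exact hO.lt hcur hptr
    · exact h.scanned_lt j h1
  · rcases Finset.mem_insert.1 hj with rfl | h1
    · exact ⟨cur, hc, hcs.1, by simp⟩
    · obtain ⟨v, hv, h2, h3⟩ := h.scanned_spec j h1
      refine ⟨v, hv, h2, ?_⟩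
      by_cases he : v = cur
      · subst he
        simp only [Function.update_self]
        omega
      · simpa [he] using h3

/-- Discovering a vertex. -/
theorem discover (h : DfsState n M st A g cur cnt ord disc par jin ptr own F P)
    (hO : IsOffsets n M st) (hA : AdjArrays {v | v < n} st A g) (hcur : cur < n)
    (hptr : ptr cur < st (cur + 1)) {w : ℕ} (hAw : A (ptr cur) = w) (hw : disc w = 0) :
    DfsState n M st A g w (cnt + 1) (Function.update ord cnt w) (Function.update disc w (cnt + 1))
      (Function.update par w cur) (Function.update jin w (ptr cur))
      (Function.update (Function.update ptr cur (ptr cur + 1)) w (st w))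
      (Function.update own (ptr cur) cur) F (insert (ptr cur) P) := by
  obtain ⟨hc, hF⟩ := h.cur_lt hcur
  have hcs := h.ptr_spec cur hc
  have hadj : g.Adj cur w := (hA.adj cur hcur w).2 ⟨_, hcs.1, hptr, hAw⟩
  have hwn : w < n := hA.mem w cur hadj.symm
  have hcw : cur ≠ w := hadj.ne
  have hne : ∀ v, 0 < disc v → v ≠ w := fun v hv he => by rw [he, hw] at hv; omega
  have hvis : ∀ v, 0 < Function.update disc w (cnt + 1) v → v = w ∨ 0 < disc v := by
    intro v hv
    by_cases he : v = w
    · exact Or.inl he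
    · exact Or.inr (by simpa [he] using hv)
  have hold : ∀ v, 0 < disc v → Function.update disc w (cnt + 1) v = disc v := fun v hv =>
    Function.update_of_ne (hne v hv) _ _
  have hold' : ∀ v, 0 < disc v → 0 < Function.update disc w (cnt + 1) v := fun v hv => by
    rw [hold v hv]; exact hv
  have hmono : ∀ a b, Anc disc par a b →
      Anc (Function.update disc w (cnt + 1)) (Function.update par w cur) a b := by
    intro a b hab
    refine Relation.ReflTransGen.mono (fun x y hxy => ?_) _ _ hab
    exact ⟨hold' y hxy.1, by rw [Function.update_of_ne (hne y hxy.1)]; exact hxy.2⟩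
  have hstep : ∀ a, 0 < disc a → a ∉ F →
      Anc (Function.update disc w (cnt + 1)) (Function.update par w cur) a w := fun a ha haF =>
    .tail (hmono _ _ (h.anc_cur a ha haF)) ⟨by simp, by simp⟩
  have hw0 : w ≠ 0 := fun he => by rw [he, h.disc_root] at hw; omega
  have hwF : w ∉ F := fun hn => hne w (h.finished w hn).1 rfl
  have hown : ∀ v, 0 < disc v → ∀ j, st v ≤ j → j < ptr v → j ≠ ptr cur := by
    intro v hv j h1 h2 he
    have h3 := (h.ptr_spec v hv).2
    have := hO.block_unique (h.lt_of_disc_pos v hv) hcur h1 (by omega) (he ▸ hcs.1) (he ▸ hptr)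
    subst this
    omega
  constructor
  · intro v hv
    rcases hvis v hv with rfl | h1
    exacts [hwn, h.lt_of_disc_pos v h1]
  · intro i hi
    by_cases hic : i = cnt
    · subst hic
      simp
    · have h1 := h.ord_disc i (by omega)
      have h2 : ord i ≠ w := hne _ (by omega)
      simp [hic, h2, h1]
  · intro v hv
    rcases hvis v hv with rfl | h1
    · simp
    · rw [hold v h1]
      exact (h.disc_le v h1).trans (Nat.le_succ _)
  · intro v u hv hvu
    rcases hvis v hv with rfl | h1 <;> rcases hvis u (hvu ▸ hv) with rfl | h2
    · rfl
    · rw [hold u h2, Function.update_self] at hvu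
      have := h.disc_le u h2
      omega
    · rw [hold v h1, Function.update_self] at hvu
      have := h.disc_le v h1
      omega
    · rw [hold v h1, hold u h2] at hvu
      exact h.disc_inj v u h1 hvu
  · exact Or.inr ⟨by simp, hwF⟩
  · rw [Function.update_of_ne hw0.symm]
    exact h.disc_root
  · rw [Function.update_of_ne hw0.symm]
    exact h.par_root
  · intro v hv h0
    rcases hvis v hv with rfl | h1
    · simpa [hcw] using hc
    · rw [Function.update_of_ne (hne v h1)]
      exact hold' _ (h.par_pos v h1 h0)
  · intro v hv h0
    rcases hvis v hv with rfl | h1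
    · have := h.disc_le cur hc
      simp [hcw]
      omega
    · rw [Function.update_of_ne (hne v h1), hold v h1, hold _ (h.par_pos v h1 h0)]
      exact h.disc_par v h1 h0
  · intro v hv h0
    rcases hvis v hv with rfl | h1
    · simpa using hcs.1
    · rw [Function.update_of_ne (hne v h1), Function.update_of_ne (hne v h1)]
      exact h.le_jin v h1 h0
  · intro v hv h0
    rcases hvis v hv with rfl | h1
    · simpa using hptr
    · rw [Function.update_of_ne (hne v h1), Function.update_of_ne (hne v h1)]
      exact h.jin_lt v h1 h0
  · intro v hv h0
    rcases hvis v hv with rfl | h1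
    · simpa using hAw
    · rw [Function.update_of_ne (hne v h1)]
      exact h.target_jin v h1 h0
  · intro v hv hvF
    rcases hvis v hv with rfl | h1
    · exact .refl
    · exact hstep v h1 hvF
  · intro v hv
    have h1 := h.finished v hv
    have h2 : v ≠ cur := fun he => hF (he ▸ hv)
    exact ⟨hold' v h1.1, by simp [hne v h1.1, h2, h1.2]⟩
  · intro v hv hvF
    rcases hvis v hv with rfl | h1
    · simpa using hF
    · rw [Function.update_of_ne (hne v h1)]
      exact h.par_notMem v h1 hvF
  · intro v hv
    rcases hvis v hv with rfl | h1
    · simpa using hO.mono v hwn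
    · rw [Function.update_of_ne (hne v h1)]
      by_cases he : v = cur
      · subst he
        simp only [Function.update_self]
        omega
      · simpa [he] using h.ptr_spec v h1
  · intro v hv j h1 h2
    rcases hvis v hv with rfl | h3
    · simp only [Function.update_self] at h2
      omega
    · rw [Function.update_of_ne (hne v h3)] at h2
      by_cases hj : j = ptr cur
      · have h4 : v = cur := by
          by_contra he
          rw [Function.update_of_ne he] at h2
          exact hown v h3 j h1 h2 hj
        subst hj h4
        simp [hAw]
      · have h4 : j < ptr v := by
          by_cases he : v = cur
          · subst he
            simp only [Function.update_self] at h2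
            omega
          · rwa [Function.update_of_ne he] at h2
        have h5 := h.scanned v h3 j h1 h4
        exact ⟨by rw [Function.update_of_ne hj]; exact h5.1, hold' _ h5.2⟩
  · intro a b hab ha hlt
    rcases hvis b (by omega) with rfl | hb
    · rcases hvis a ha with rfl | ha'
      · exact absurd hab (g.irrefl)
      -- Had `a` been finished, its whole block would have been scanned and the new vertex
      -- discovered earlier. So `a` is unfinished, hence an ancestor of the current vertex.
      · refine hstep a ha' fun haF => ?_
        obtain ⟨-, h2⟩ := h.finished a haF
        obtain ⟨j, h3, h4, h5⟩ := (hA.adj a (h.lt_of_disc_pos a ha') b).1 hab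
        have := (h.scanned a ha' j h3 (by omega)).2
        rw [h5, hw] at this
        omega
    · rcases hvis a ha with rfl | ha'
      · rw [hold b hb, Function.update_self] at hlt
        have := h.disc_le b hb
        omega
      · rw [hold b hb, hold a ha'] at hlt
        exact hmono a b (h.anc a b hab ha' hlt)
  · intro j hj
    rcases Finset.mem_insert.1 hj with rfl | h1
    · exact hO.lt hcur hptr
    · exact h.scanned_lt j h1
  · intro j hj
    rcases Finset.mem_insert.1 hj with rfl | h1
    · exact ⟨cur, hold' cur hc, hcs.1, by simp [hcw]⟩
    · obtain ⟨v, hv, h2, h3⟩ := h.scanned_spec j h1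
      refine ⟨v, hold' v hv, h2, ?_⟩
      rw [Function.update_of_ne (hne v hv)]
      by_cases he : v = cur
      · subst he
        simp only [Function.update_self]
        omega
      · simpa [he] using h3

/-- When the current vertex is `n`, an unfinished vertex would be an ancestor of `n`, which is
impossible as `n` is never discovered. So all blocks of discovered vertices have been scanned, the
discovered set is closed under adjacency, and by connectedness it contains every vertex. -/
theorem isDfsTree (h : DfsState n M st A g n cnt ord disc par jin ptr own F P)
    (hA : AdjArrays {v | v < n} st A g) (hG : (g.induce {v | v < n}).Connected) :
    IsDfsTree n st A g ord disc par jin own := by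
  have hn : ¬ 0 < disc n := fun hn => lt_irrefl n (h.lt_of_disc_pos n hn)
  have hF : ∀ v, 0 < disc v → v ∈ F := by
    intro v hv
    by_contra hvF
    rcases Relation.ReflTransGen.cases_tail (h.anc_cur v hv hvF) with h1 | ⟨b, -, h2⟩
    · exact hn (h1 ▸ hv)
    · exact hn h2.1
  have hvis : ∀ v < n, 0 < disc v := by
    intro v hv
    by_contra hcon
    have h0 : 0 < disc 0 := by rw [h.disc_root]; omega
    obtain ⟨⟨a, ha⟩, ⟨b, hb⟩, hab, h1, h2⟩ := exists_adj_boundary hG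
      (Y := {x | 0 < disc (x : ℕ)}) (a := ⟨0, h.lt_of_disc_pos 0 h0⟩) (b := ⟨v, hv⟩) h0 hcon
    obtain ⟨j, h3, h4, h5⟩ := (hA.adj a ha b).1 hab
    obtain ⟨h6, h7⟩ := h.finished a (hF a h1)
    exact h2 (h5 ▸ (h.scanned a h6 j h3 (by omega)).2)
  have hcnt : cnt ≤ n := by
    have := Finset.card_le_card_of_injOn (s := Finset.range cnt) (t := Finset.range n) ord
      (fun i hi => by
        have := h.ord_disc i (by simpa using hi)
        simpa using h.lt_of_disc_pos _ (by omega))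
      (fun i hi j hj hij => by
        have h1 := h.ord_disc i (by simpa using hi)
        have h2 := h.ord_disc j (by simpa using hj)
        rw [hij] at h1
        omega)
    simpa using this
  have hcnt' : n ≤ cnt := by
    have := Finset.card_le_card_of_injOn (s := Finset.range n) (t := Finset.range cnt)
      (fun v => disc v - 1)
      (fun v hv => by
        have h1 := hvis v (by simpa using hv)
        have h2 := h.disc_le v h1
        simp only [Finset.coe_range, Set.mem_Iio]
        omega)
      (fun v hv w hw hvw => by
        have h1 := hvis v (by simpa using hv)
        have h2 := hvis w (by simpa using hw)
        simp only at hvw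
        exact h.disc_inj v w h1 (by omega))
    simpa using this
  have hcn : cnt = n := le_antisymm hcnt hcnt'
  subst hcn
  exact {
    disc_pos := hvis
    lt_of_disc_pos := h.lt_of_disc_pos
    ord_lt := fun i hi => h.lt_of_disc_pos _ (by rw [h.ord_disc i hi]; omega)
    disc_ord := h.ord_disc
    disc_le := fun v hv => h.disc_le v (hvis v hv)
    ord_disc_sub := fun v hv => by
      have h1 := hvis v hv
      have h2 := h.disc_le v h1
      have h3 := h.ord_disc (disc v - 1) (by omega)
      exact h.disc_inj _ _ (by omega) (by omega)
    disc_root := h.disc_root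
    par_root := h.par_root
    par_lt := fun v hv h0 => h.lt_of_disc_pos _ (h.par_pos v (hvis v hv) h0)
    disc_par := fun v hv h0 => h.disc_par v (hvis v hv) h0
    le_jin := fun v hv h0 => h.le_jin v (hvis v hv) h0
    jin_lt := fun v hv h0 => h.jin_lt v (hvis v hv) h0
    target_jin := fun v hv h0 => h.target_jin v (hvis v hv) h0
    own_eq := fun v hv j h1 h2 => by
      have h3 := h.finished v (hF v (hvis v hv))
      exact (h.scanned v h3.1 j h1 (by omega)).1
    anc := fun a b hab hlt => h.anc a b hab (hvis a (hA.mem a b hab)) hlt }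

end DfsState

end DepthFirstSearch


/-! ### The search as a program -/

notation "rN" => (0 : ℕ)
notation "rK" => (1 : ℕ)
notation "rZero" => (2 : ℕ)
notation "rOne" => (3 : ℕ)
notation "rCur" => (4 : ℕ)
notation "rCnt" => (5 : ℕ)
notation "rPos" => (6 : ℕ)
notation "rTmp" => (7 : ℕ)
notation "rEnd" => (8 : ℕ)
notation "rTo" => (9 : ℕ)
notation "rAux" => (10 : ℕ)

notation "aStart" => (0 : ℕ)
notation "aAdj" => (1 : ℕ)
notation "aOrd" => (2 : ℕ)
notation "aDisc" => (3 : ℕ)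
notation "aPar" => (4 : ℕ)
notation "aJin" => (5 : ℕ)
notation "aPtr" => (6 : ℕ)
notation "aOwn" => (7 : ℕ)

section SearchProgram

/-- Marks the root as discovered. -/
def dfsInit : Prog :=
  .const rOne 1 ;; .store aDisc rCur rOne ;; .store aPar rCur rN ;; .const rCnt 1

/-- Makes the target `rTo` of the position `rPos` the current vertex. -/
def dfsDiscover : Prog :=
  .store aOrd rCnt rTo ;; .add rCnt rCnt rOne ;; .store aDisc rTo rCnt ;; .store aPar rTo rCur ;;
    .store aJin rTo rPos ;; .load rTmp aStart rTo ;; .store aPtr rTo rTmp ;; .add rCur rTo rZero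

/-- Scans the next position of the current vertex, or goes back to its parent. -/
def dfsBody : Prog :=
  .load rPos aPtr rCur ;; .add rTmp rCur rOne ;; .load rEnd aStart rTmp ;;
    .ite rPos rEnd
      (.add rTmp rPos rOne ;; .store aPtr rCur rTmp ;; .store aOwn rPos rCur ;;
        .load rTo aAdj rPos ;; .load rAux aDisc rTo ;; .ite rAux rOne dfsDiscover (.const rTmp 0))
      (.load rCur aPar rCur)

/-- Depth-first search from vertex `0`. -/
def dfsProg : Prog := dfsInit ;; .while rCur rN dfsBody

variable {n M : ℕ} {st A : ℕ → ℕ} {g : SimpleGraph ℕ}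

/-- The memory holds the state of a depth-first search with at most `m` steps left. -/
def DfsInv (n M : ℕ) (st A : ℕ → ℕ) (g : SimpleGraph ℕ) (m : ℕ) (s : Store) : Prop :=
  ∃ F P : Finset ℕ, M + n ≤ m + P.card + F.card ∧
    DfsState n M st A g (s.reg rCur) (s.reg rCnt) (s.arr aOrd) (s.arr aDisc) (s.arr aPar)
      (s.arr aJin) (s.arr aPtr) (s.arr aOwn) F P

/-- Every iteration of the search enlarges `P` or `F` by one element, so these bounds limit the
number of iterations to `M + n`. -/
theorem DfsState.card_le {cur cnt : ℕ} {ord disc par jin ptr own : ℕ → ℕ} {F P : Finset ℕ}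
    (h : DfsState n M st A g cur cnt ord disc par jin ptr own F P) : P.card ≤ M ∧ F.card ≤ n := by
  constructor
  · simpa using Finset.card_le_card (show P ⊆ Finset.range M from
      fun j hj => Finset.mem_range.2 (h.scanned_lt j hj))
  · simpa using Finset.card_le_card (show F ⊆ Finset.range n from
      fun j hj => Finset.mem_range.2 (h.lt_of_disc_pos j (h.finished j hj).1))

theorem dfsInv_step (hO : IsOffsets n M st) (hA : AdjArrays {v | v < n} st A g) {m : ℕ} {s : Store}
    (h : DfsInv n M st A g m s) (h2 : s.reg rZero = 0) (h3 : s.reg rOne = 1)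
    (hst : s.arr aStart = st) (hAdj : s.arr aAdj = A) (hcur : s.reg rCur < n) :
    ∃ m' < m, DfsInv n M st A g m' (dfsBody.eval s) := by
  obtain ⟨F, P, hm, h⟩ := h
  by_cases hptr : s.arr aPtr (s.reg rCur) < st (s.reg rCur + 1)
  · have hP : (insert (s.arr aPtr (s.reg rCur)) P).card = P.card + 1 :=
      Finset.card_insert_of_notMem (h.ptr_notMem hO hcur hptr)
    by_cases hw : s.arr aDisc (A (s.arr aPtr (s.reg rCur))) = 0
    · have h' := h.discover hO hA hcur hptr rfl hw
      have := h'.card_le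
      refine ⟨m - 1, by omega, F, insert (s.arr aPtr (s.reg rCur)) P, by omega, ?_⟩
      simpa [dfsBody, dfsDiscover, Prog.eval, h2, h3, hst, hAdj, hptr, hw] using h'
    · have h' := h.scan hO hcur hptr (Nat.pos_of_ne_zero hw)
      have := h'.card_le
      refine ⟨m - 1, by omega, F, insert (s.arr aPtr (s.reg rCur)) P, by omega, ?_⟩
      simpa [dfsBody, Prog.eval, h2, h3, hst, hAdj, hptr, hw] using h'
  · have h' := h.up hcur hptr
    have := h'.card_le
    have hF : (insert (s.reg rCur) F).card = F.card + 1 :=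
      Finset.card_insert_of_notMem (h.cur_lt hcur).2
    refine ⟨m - 1, by omega, insert (s.reg rCur) F, P, by omega, ?_⟩
    simpa [dfsBody, Prog.eval, h3, hst, hptr] using h'

theorem dfsProg_spec (hn : 0 < n) (hO : IsOffsets n M st) (hA : AdjArrays {v | v < n} st A g)
    (hG : (g.induce {v | v < n}).Connected) {s : Store} (hsn : s.reg rN = n)
    (hst : s.arr aStart = st) (hAdj : s.arr aAdj = A) (h2 : s.reg rZero = 0) (hc : s.reg rCur = 0)
    (harr : ∀ a, 2 ≤ a → a < 8 → s.arr a = fun _ => 0) :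
    HaltsWithin dfsProg s (20 * (M + n) + 5) fun s' => s'.reg rOne = 1 ∧
      IsDfsTree n st A g (s'.arr aOrd) (s'.arr aDisc) (s'.arr aPar) (s'.arr aJin)
        (s'.arr aOwn) := by
  have hinit : HaltsWithin dfsInit s 4 fun s' => DfsInv n M st A g (M + n) s' ∧
      s'.reg rOne = 1 := by
    refine HaltsWithin.of_loopFree (by simp [dfsInit, Prog.LoopFree]) ⟨⟨∅, ∅, by simp, ?_⟩, ?_⟩
    · simpa [dfsInit, Prog.eval, hc, hsn, harr] using DfsState.initial (A := A) (g := g) hO hn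
    · simp [dfsInit, Prog.eval]
  refine ((hinit.frame).seq (T₂ := (M + n) * (dfsBody.cost + 1) + 1) fun s₁ hs₁ => ?_).mono
    (by simp [dfsBody, dfsDiscover, Prog.cost]; omega) fun _ h => h
  obtain ⟨⟨hI, h1⟩, hf⟩ := hs₁
  have e2 : s₁.reg rZero = 0 := (hf.1 _ (by decide)).trans h2
  have e0 : s₁.reg rN = n := (hf.1 _ (by decide)).trans hsn
  have eS : s₁.arr aStart = st := (hf.2 _ (by decide)).trans hst
  have eA : s₁.arr aAdj = A := (hf.2 _ (by decide)).trans hAdj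
  refine (HaltsWithin.while (by simp [dfsBody, dfsDiscover, Prog.LoopFree]) (DfsInv n M st A g)
    (fun m s' hI' hf' hlt => ?_) hI).frame.mono le_rfl ?_
  · have e0' : s'.reg rN = n := (hf'.1 _ (by decide)).trans e0
    exact dfsInv_step hO hA hI' ((hf'.1 _ (by decide)).trans e2) ((hf'.1 _ (by decide)).trans h1)
      ((hf'.2 _ (by decide)).trans eS) ((hf'.2 _ (by decide)).trans eA) (e0' ▸ hlt)
  · rintro s' ⟨⟨⟨m', F, P, -, h⟩, hge⟩, hf'⟩
    have e0' : s'.reg rN = n := (hf'.1 _ (by decide)).trans e0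
    refine ⟨(hf'.1 _ (by decide)).trans h1, ?_⟩
    have hcur : s'.reg rCur = n := by
      by_contra hne
      have h3 := h.cur_spec.resolve_left hne
      have := h.lt_of_disc_pos _ h3.1
      omega
    rw [hcur] at h
    exact h.isDfsTree hA hG

end SearchProgram


/-! ### Back edges and twins -/

notation "rSrc" => (11 : ℕ)
notation "rX" => (12 : ℕ)
notation "rY" => (13 : ℕ)
notation "aTwin" => (8 : ℕ)
notation "aUp" => (9 : ℕ)
notation "aDown" => (10 : ℕ)

section Labels

/-- Counts the edge at the position `rPos` as going up or down in the tree. -/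
def countEdge : Prog :=
  .ite rY rX (.load rTmp aUp rSrc ;; .add rTmp rTmp rOne ;; .store aUp rSrc rTmp)
    (.load rTmp aDown rSrc ;; .add rTmp rTmp rOne ;; .store aDown rSrc rTmp)

/-- Links the position `rPos` with the position of the same edge at the parent, if it is a tree
edge going up. -/
def linkEdge : Prog :=
  .ite rTo rAux (.const rTmp 0) (.ite rAux rTo (.const rTmp 0)
    (.load rTmp aJin rSrc ;; .store aTwin rPos rTmp ;; .store aTwin rTmp rPos))

def labelBody : Prog :=
  .load rSrc aOwn rPos ;; .load rTo aAdj rPos ;; .load rX aDisc rSrc ;; .load rY aDisc rTo ;;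
    countEdge ;; .load rAux aPar rSrc ;; linkEdge ;; .add rPos rPos rOne

/-- For all vertices, counts the edges going up and down, and computes the twins of the positions of
tree edges. -/
def labelProg : Prog :=
  .const rPos 0 ;; .load rEnd aStart rN ;; .while rPos rEnd labelBody

/-- Positions of tree edges at their two ends are linked by `twin`. -/
def TwinsBelow (n : ℕ) (st A par jin twin : ℕ → ℕ) (j : ℕ) : Prop :=
  ∀ v < n, v ≠ 0 → ∀ i < j, st v ≤ i → i < st (v + 1) → A i = par v →
    twin i = jin v ∧ twin (jin v) = i

/-- The program makes one comparison per position and sends equality to the second branch, hence the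
`≤` in `down_eq`. The ends of an edge have different discovery numbers, so `IsLabelled` can use `<`.
-/
structure LabelInv (n M : ℕ) (st A disc par jin own : ℕ → ℕ) (j : ℕ) (up down twin : ℕ → ℕ) :
    Prop where
  le : j ≤ M
  up_eq : ∀ v, up v = ((Finset.range j).filter fun i => own i = v ∧ disc (A i) < disc v).card
  down_eq : ∀ v,
    down v = ((Finset.range j).filter fun i => own i = v ∧ disc v ≤ disc (A i)).card
  twins : TwinsBelow n st A par jin twin j

variable {n M : ℕ} {st A : ℕ → ℕ} {g : SimpleGraph ℕ} {ord disc par jin own : ℕ → ℕ}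

theorem card_filter_range_succ (p : ℕ → Prop) [DecidablePred p] (j : ℕ) :
    ((Finset.range (j + 1)).filter p).card =
      ((Finset.range j).filter p).card + if p j then 1 else 0 := by
  rw [Finset.range_add_one, Finset.filter_insert]
  split_ifs with h
  · rw [Finset.card_insert_of_notMem (by simp)]
  · rfl

theorem LabelInv.count {j : ℕ} {up down twin : ℕ → ℕ}
    (h : LabelInv n M st A disc par jin own j up down twin) :
    (∀ v, (if disc (A j) < disc (own j) then Function.update up (own j) (up (own j) + 1) else up) v =
      ((Finset.range (j + 1)).filter fun i => own i = v ∧ disc (A i) < disc v).card) ∧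
    (∀ v, (if disc (A j) < disc (own j) then down else
      Function.update down (own j) (down (own j) + 1)) v =
      ((Finset.range (j + 1)).filter fun i => own i = v ∧ disc v ≤ disc (A i)).card) := by
  refine ⟨fun v => ?_, fun v => ?_⟩ <;> rw [card_filter_range_succ]
  · rw [← h.up_eq]
    by_cases hlt : disc (A j) < disc (own j) <;> by_cases hv : own j = v
    · subst hv; simp [hlt]
    · simp [hlt, hv, Function.update_of_ne (Ne.symm hv)]
    · subst hv; simp [hlt]
    · simp [hlt, hv]
  · rw [← h.down_eq]
    by_cases hlt : disc (A j) < disc (own j) <;> by_cases hv : own j = v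
    · subst hv; simp [hlt]
    · simp [hlt, hv]
    · subst hv; simp [hlt, not_lt.1 hlt]
    · simp [hlt, hv, Function.update_of_ne (Ne.symm hv)]

/-- Linking does not overwrite earlier links: the entry at `jin u` is `u`, each block has no
repetition, and a clash of an upward with a downward position would make two vertices parents of
each other. -/
theorem TwinsBelow.link (hO : IsOffsets n M st) (hA : AdjArrays {v | v < n} st A g)
    (hT : IsDfsTree n st A g ord disc par jin own) {twin : ℕ → ℕ} {j : ℕ} (hj : j < M)
    (h : TwinsBelow n st A par jin twin j) (he : A j = par (own j)) :
    TwinsBelow n st A par jin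
      (Function.update (Function.update twin j (jin (own j))) (jin (own j)) j) (j + 1) := by
  obtain ⟨u, hu, hj1, hj2⟩ := hO.exists_block hj
  have hown : own j = u := hT.own_eq u hu j hj1 hj2
  rw [hown] at he ⊢
  have hAj : A j < n := hA.mem _ u (((hA.adj u hu _).2 ⟨j, hj1, hj2, rfl⟩).symm)
  have hu0 : u ≠ 0 := fun h0 => by
    rw [he, h0, hT.par_root] at hAj
    exact lt_irrefl _ hAj
  -- no two vertices are parents of each other
  have hcyc : ∀ v < n, v ≠ 0 → u = par v → v = par u → False := by
    intro v hv hv0 h1 h2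
    have h3 := hT.disc_par v hv hv0
    have h4 := hT.disc_par u hu hu0
    rw [← h1] at h3
    rw [← h2] at h4
    omega
  have hju : A (jin u) = u := hT.target_jin u hu hu0
  have hne : jin u ≠ j := fun hn => by
    rw [hn, he] at hju
    have := hT.disc_par u hu hu0
    rw [hju] at this
    exact lt_irrefl _ this
  intro v hv hv0 i hi hi1 hi2 hAi
  by_cases hij : i = j
  · subst hij
    have : u = v := hO.block_unique hu hv hj1 hj2 hi1 hi2
    subst this
    simp [Function.update_of_ne hne.symm]
  · have hvu : v ≠ u := by
      rintro rfl
      exact hij (hA.inj v hv i j hi1 hi2 hj1 hj2 (hAi.trans he.symm))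
    obtain ⟨h1, h2⟩ := h v hv hv0 i (by omega) hi1 hi2 hAi
    have hjv := hT.target_jin v hv hv0
    have hle := hT.le_jin v hv hv0
    have hlt := hT.jin_lt v hv hv0
    have n1 : i ≠ jin u := fun hn => by
      have h3 : u = par v := by rw [← hju, ← hn, hAi]
      refine hcyc v hv hv0 h3 ?_
      exact hO.block_unique hv (hT.par_lt u hu hu0) hi1 hi2 (hn ▸ hT.le_jin u hu hu0)
        (hn ▸ hT.jin_lt u hu hu0)
    have n2 : jin v ≠ jin u := fun hn => hvu (by rw [← hjv, hn, hju])
    have n3 : jin v ≠ j := fun hn => by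
      have h3 : v = par u := by rw [← hjv, hn, he]
      refine hcyc v hv hv0 ?_ h3
      exact hO.block_unique hu (hT.par_lt v hv hv0) hj1 hj2 (hn ▸ hle) (hn ▸ hlt)
    rw [Function.update_of_ne n1, Function.update_of_ne hij, Function.update_of_ne n2,
      Function.update_of_ne n3]
    exact ⟨h1, h2⟩

theorem TwinsBelow.skip (hT : IsDfsTree n st A g ord disc par jin own) {twin : ℕ → ℕ} {j : ℕ}
    (h : TwinsBelow n st A par jin twin j) (he : A j ≠ par (own j)) :
    TwinsBelow n st A par jin twin (j + 1) := by
  intro v hv hv0 i hi hi1 hi2 hAi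
  refine h v hv hv0 i (lt_of_le_of_ne (Nat.le_of_lt_succ hi) fun hij => ?_) hi1 hi2 hAi
  subst hij
  rw [hT.own_eq v hv i hi1 hi2] at he
  exact he hAi

/-- The memory during the labelling loop with at most `m` iterations left. -/
def LabelMem (n M : ℕ) (st A disc par jin own : ℕ → ℕ) (m : ℕ) (s : Store) : Prop :=
  M ≤ m + s.reg rPos ∧
    LabelInv n M st A disc par jin own (s.reg rPos) (s.arr aUp) (s.arr aDown) (s.arr aTwin)

theorem labelMem_step (hO : IsOffsets n M st) (hA : AdjArrays {v | v < n} st A g)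
    (hT : IsDfsTree n st A g ord disc par jin own) {m : ℕ} {s : Store}
    (h : LabelMem n M st A disc par jin own m s) (h1 : s.reg rOne = 1) (hAdj : s.arr aAdj = A)
    (hdisc : s.arr aDisc = disc) (hpar : s.arr aPar = par) (hjin : s.arr aJin = jin)
    (hown : s.arr aOwn = own) (hlt : s.reg rPos < M) :
    ∃ m' < m, LabelMem n M st A disc par jin own m' (labelBody.eval s) := by
  obtain ⟨hm, h⟩ := h
  obtain ⟨hup, hdown⟩ := h.count
  refine ⟨m - 1, by omega, ?_⟩
  by_cases he : A (s.reg rPos) = par (own (s.reg rPos))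
  · have htw := h.twins.link hO hA hT hlt he
    have h2 : ¬ A (s.reg rPos) < par (own (s.reg rPos)) := he.not_lt
    have h3 : ¬ par (own (s.reg rPos)) < A (s.reg rPos) := he.not_gt
    by_cases hc : disc (A (s.reg rPos)) < disc (own (s.reg rPos)) <;>
      simp only [hc, if_true, if_false] at hup hdown <;>
      refine ⟨?_, ⟨?_, ?_, ?_, ?_⟩⟩ <;>
      simp [labelBody, countEdge, linkEdge, Prog.eval, h1, hAdj, hdisc, hpar, hjin, hown, h2, h3,
        hc, -not_lt] <;>
      omega
  · have htw := h.twins.skip hT he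
    by_cases hc : disc (A (s.reg rPos)) < disc (own (s.reg rPos)) <;>
      simp only [hc, if_true, if_false] at hup hdown <;>
      rcases Nat.lt_or_gt_of_ne he with he' | he' <;>
      have he'' := Nat.lt_asymm he' <;>
      refine ⟨?_, ⟨?_, ?_, ?_, ?_⟩⟩ <;>
      simp [labelBody, countEdge, linkEdge, Prog.eval, h1, hAdj, hdisc, hpar, hown, he', he'',
        hc, -not_lt] <;>
      omega

open scoped Classical in
theorem card_block_filter (hO : IsOffsets n M st)
    (hA : AdjArrays {v | v < n} st A g) (hT : IsDfsTree n st A g ord disc par jin own) {v : ℕ}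
    (hv : v < n) (p : ℕ → Prop) [DecidablePred p] :
    ((Finset.range M).filter fun i => own i = v ∧ p (A i)).card =
      ((Finset.range n).filter fun b => g.Adj v b ∧ p b).card := by
  have hblock : ∀ i < M, own i = v → st v ≤ i ∧ i < st (v + 1) := by
    intro i hi hiv
    obtain ⟨u, hu, h1, h2⟩ := hO.exists_block hi
    have := hT.own_eq u hu i h1 h2
    have huv : u = v := this.symm.trans hiv
    exact huv ▸ ⟨h1, h2⟩
  refine Finset.card_bij (fun i _ => A i) ?_ ?_ ?_
  · intro i hi
    simp only [Finset.mem_filter, Finset.mem_range] at hi ⊢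
    obtain ⟨h1, h2⟩ := hblock i hi.1 hi.2.1
    have hadj := (hA.adj v hv (A i)).2 ⟨i, h1, h2, rfl⟩
    exact ⟨hA.mem _ _ hadj.symm, hadj, hi.2.2⟩
  · intro i hi j hj hij
    simp only [Finset.mem_filter, Finset.mem_range] at hi hj
    obtain ⟨h1, h2⟩ := hblock i hi.1 hi.2.1
    obtain ⟨h3, h4⟩ := hblock j hj.1 hj.2.1
    exact hA.inj v hv i j h1 h2 h3 h4 hij
  · intro b hb
    simp only [Finset.mem_filter, Finset.mem_range] at hb
    obtain ⟨j, h1, h2, rfl⟩ := (hA.adj v hv b).1 hb.2.1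
    exact ⟨j, by simpa using ⟨hO.lt hv h2, hT.own_eq v hv j h1 h2, hb.2.2⟩, rfl⟩

open scoped Classical in
/-- The numbers of edges going up and down, and the linked positions of tree edges. -/
structure IsLabelled (n : ℕ) (st A : ℕ → ℕ) (g : SimpleGraph ℕ)
    (disc par jin up down twin : ℕ → ℕ) : Prop where
  up_eq : ∀ v < n, up v = ((Finset.range n).filter fun b => g.Adj v b ∧ disc b < disc v).card
  down_eq : ∀ v < n,
    down v = ((Finset.range n).filter fun b => g.Adj v b ∧ disc v < disc b).card
  twin_spec : ∀ v < n, v ≠ 0 → ∀ i, st v ≤ i → i < st (v + 1) → A i = par v →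
    twin i = jin v ∧ twin (jin v) = i

theorem LabelInv.isLabelled {up down twin : ℕ → ℕ}
    (h : LabelInv n M st A disc par jin own M up down twin) (hO : IsOffsets n M st)
    (hA : AdjArrays {v | v < n} st A g) (hT : IsDfsTree n st A g ord disc par jin own) :
    IsLabelled n st A g disc par jin up down twin where
  up_eq v hv := by
    rw [h.up_eq]
    convert card_block_filter hO hA hT hv (fun b => disc b < disc v) using 2
  down_eq v hv := by
    rw [h.down_eq]
    convert card_block_filter hO hA hT hv (fun b => disc v ≤ disc b) using 2
    ext b
    simp only [Finset.mem_filter, Finset.mem_range, and_congr_right_iff]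
    intro hb hadj
    have h1 := hT.ord_disc_sub v hv
    have h2 := hT.ord_disc_sub b hb
    refine ⟨fun h3 => h3.le, fun h3 => lt_of_le_of_ne h3 fun he => ?_⟩
    rw [he] at h1
    exact hadj.ne (h1.symm.trans h2)
  twin_spec v hv hv0 i h1 h2 h3 := h.twins v hv hv0 i (hO.lt hv h2) h1 h2 h3

theorem labelProg_spec (hO : IsOffsets n M st) (hA : AdjArrays {v | v < n} st A g)
    (hT : IsDfsTree n st A g ord disc par jin own) {s : Store} (hsn : s.reg rN = n)
    (h1 : s.reg rOne = 1) (hst : s.arr aStart = st) (hAdj : s.arr aAdj = A)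
    (hdisc : s.arr aDisc = disc) (hpar : s.arr aPar = par) (hjin : s.arr aJin = jin)
    (hown : s.arr aOwn = own) (harr : ∀ a, 8 ≤ a → a < 11 → s.arr a = fun _ => 0) :
    HaltsWithin labelProg s (20 * M + 3) fun s' =>
      IsLabelled n st A g disc par jin (s'.arr aUp) (s'.arr aDown) (s'.arr aTwin) := by
  have hinit : HaltsWithin (.const rPos 0) s 1 fun s' => s'.reg rPos = 0 :=
    HaltsWithin.of_loopFree (by trivial) (by simp [Prog.eval])
  refine ((hinit.frame).seq (T₂ := 1 + (M * (labelBody.cost + 1) + 1)) fun s₁ hs₁ => ?_).mono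
    (by simp [labelBody, countEdge, linkEdge, Prog.cost]; omega) fun _ h => h
  obtain ⟨hp, hf⟩ := hs₁
  have hload : HaltsWithin (.load rEnd aStart rN) s₁ 1 fun s' => s'.reg rEnd = M := by
    refine HaltsWithin.of_loopFree (by trivial) ?_
    have e0 : s₁.reg rN = n := (hf.1 _ (by decide)).trans hsn
    have eS : s₁.arr aStart = st := (hf.2 _ (by decide)).trans hst
    simp [Prog.eval, e0, eS, hO.last]
  refine (hload.frame).seq fun s₂ hs₂ => ?_
  obtain ⟨hM, hf'⟩ := hs₂
  have hreg : ∀ x, x ≠ rPos → x ≠ rEnd → s₂.reg x = s.reg x := fun x h1 h2 =>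
    (hf'.1 x (by simp [Prog.regs, h2])).trans (hf.1 x (by simp [Prog.regs, h1]))
  have harr' : ∀ a, s₂.arr a = s.arr a := fun a =>
    (hf'.2 a (by simp [Prog.arrs])).trans (hf.2 a (by simp [Prog.arrs]))
  have hp2 : s₂.reg rPos = 0 := (hf'.1 _ (by decide)).trans hp
  refine (HaltsWithin.while (by simp [labelBody, countEdge, linkEdge, Prog.LoopFree])
    (LabelMem n M st A disc par jin own) (fun m s' hI hf'' hlt => ?_)
      (m := M) ⟨by simp, ?_⟩).frame.mono le_rfl ?_
  · have e : ∀ a, a ∉ labelBody.arrs → s'.arr a = s.arr a := fun a ha =>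
      (hf''.2 a ha).trans (harr' a)
    refine labelMem_step hO hA hT hI ?_ ((e _ (by decide)).trans hAdj)
      ((e _ (by decide)).trans hdisc) ((e _ (by decide)).trans hpar) ((e _ (by decide)).trans hjin)
      ((e _ (by decide)).trans hown) ?_
    · exact (hf''.1 _ (by decide)).trans ((hreg _ (by decide) (by decide)).trans h1)
    · have : s'.reg rEnd = M := (hf''.1 _ (by decide)).trans hM
      exact this ▸ hlt
  · rw [harr', harr', harr', harr _ (by decide) (by decide), harr _ (by decide) (by decide),
      harr _ (by decide) (by decide), hp2]
    exact ⟨by omega, by simp, by simp, fun v _ _ i hi => absurd hi (Nat.not_lt_zero i)⟩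
  · rintro s' ⟨⟨⟨m', -, hI⟩, hge⟩, hf''⟩
    have hM' : s'.reg rEnd = M := (hf''.1 _ (by decide)).trans hM
    have : s'.reg rPos = M := by
      have := hI.le
      omega
    rw [this] at hI
    exact hI.isLabelled hO hA hT

end Labels


/-! ### Subtrees of a depth-first search tree -/

section Subtrees

variable {n M : ℕ} {st A : ℕ → ℕ} {g : SimpleGraph ℕ} {ord disc par jin own : ℕ → ℕ}

namespace IsDfsTree

theorem disc_inj (hT : IsDfsTree n st A g ord disc par jin own) {v w : ℕ} (hv : v < n) (hw : w < n)
    (h : disc v = disc w) : v = w := by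
  rw [← hT.ord_disc_sub v hv, h, hT.ord_disc_sub w hw]

theorem ne_zero_of_disc (hT : IsDfsTree n st A g ord disc par jin own) {v : ℕ} (hv : 1 < disc v) :
    v ≠ 0 := by
  rintro rfl
  rw [hT.disc_root] at hv
  omega

theorem adj_par (hT : IsDfsTree n st A g ord disc par jin own)
    (hA : AdjArrays {v | v < n} st A g) {v : ℕ} (hv : v < n) (hv0 : v ≠ 0) : g.Adj v (par v) :=
  ((hA.adj _ (hT.par_lt v hv hv0) v).2
    ⟨_, hT.le_jin v hv hv0, hT.jin_lt v hv hv0, hT.target_jin v hv hv0⟩).symm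

theorem disc_le_of_anc (hT : IsDfsTree n st A g ord disc par jin own) {a b : ℕ}
    (h : Anc disc par a b) (ha : 0 < disc a) : disc a ≤ disc b := by
  have key : a < n ∧ disc a ≤ disc b ∧ 0 < disc b := by
    induction h with
    | refl => exact ⟨hT.lt_of_disc_pos a ha, le_rfl, ha⟩
    | tail _ hbc ih =>
      rename_i b c _
      obtain ⟨hc, rfl⟩ := hbc
      refine ⟨ih.1, ih.2.1.trans ?_, hc⟩
      by_cases h0 : c = 0
      · subst h0
        have := hT.lt_of_disc_pos _ ih.2.2
        rw [hT.par_root] at this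
        omega
      · exact (hT.disc_par c (hT.lt_of_disc_pos c hc) h0).le
  exact key.2.1

theorem disc_pos_of_anc {a b : ℕ} (ha : 0 < disc a) (h : Anc disc par a b) : 0 < disc b := by
  rcases Relation.ReflTransGen.cases_tail h with rfl | ⟨_, _, h1⟩
  exacts [ha, h1.1]

theorem child_ne_zero (hT : IsDfsTree n st A g ord disc par jin own) {a : ℕ} (ha : 0 < disc (par a)) :
    a ≠ 0 := by
  rintro rfl
  have := hT.lt_of_disc_pos _ ha
  rw [hT.par_root] at this
  omega

/-- Tree paths that avoid `v` stay on one side of a splitting vertex `v`. -/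
theorem mem_iff_of_anc (hT : IsDfsTree n st A g ord disc par jin own)
    (hA : AdjArrays {v | v < n} st A g) {v u₁ u₂ : ℕ} {X : Set ℕ} (hs : Splits g v X u₁ u₂)
    {x y : ℕ} (hx : 0 < disc x) (h : Anc disc par x y)
    (hne : ∀ z, Anc disc par x z → Anc disc par z y → z ≠ v) : x ∈ X ↔ y ∈ X := by
  induction h with
  | refl => rfl
  | tail hxb hbc ih =>
    rename_i b c
    have hb := disc_pos_of_anc hx hxb
    rw [ih fun z h1 h2 => hne z h1 (h2.tail hbc)]
    have hcv := hne c (hxb.tail hbc) .refl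
    have hbv := hne b hxb (.single hbc)
    obtain ⟨hc, rfl⟩ := hbc
    have hadj := hT.adj_par hA (hT.lt_of_disc_pos c hc) (hT.child_ne_zero hb)
    constructor
    · intro h1
      by_contra h2
      exact hs.sep _ h1 _ h2 hcv hadj.symm
    · intro h1
      by_contra h2
      exact hs.sep _ h1 _ h2 hbv hadj

/-- Both `b` and `w` are on the tree path to `a`. Since `b` is not below `w`, it is strictly above
it. -/
theorem anc_par_of_anc {w a b : ℕ} (hba : Anc disc par b a) (hwa : Anc disc par w a) (hwb : ¬ Anc disc par w b) :
    Anc disc par b (par w) := by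
  induction hba with
  | refl => exact absurd hwa hwb
  | tail h1 h2 ih =>
    rcases Relation.ReflTransGen.cases_tail hwa with rfl | ⟨c, h3, h4⟩
    · rw [h2.2]; exact h1
    · have := h4.2.symm.trans h2.2
      exact ih (this ▸ h3)

/-- Every edge at a splitting vertex `v` is a tree edge. If `w` is discovered after `v`, the tree
path from `v` to `w` begins with a child of `v` and from there on avoids `v`, so this child is on
the side of `w`; as `v` has one neighbour on each side, the child is `w`. If `w` is discovered
earlier, `par v` plays this role. -/
theorem par_of_splits (hT : IsDfsTree n st A g ord disc par jin own)
    (hA : AdjArrays {v | v < n} st A g) {v u₁ u₂ : ℕ} {X : Set ℕ} (hs : Splits g v X u₁ u₂)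
    {w : ℕ} (hw : g.Adj v w) : (v ≠ 0 ∧ par v = w) ∨ (w ≠ 0 ∧ par w = v) := by
  have hv := hA.mem v w hw
  have hwn := hA.mem w v hw.symm
  -- two neighbours of `v` on the same side coincide
  have huniq : ∀ x, g.Adj v x → (x ∈ X ↔ w ∈ X) → x = w := by
    intro x hx hxw
    rcases (hs.adj_iff x).1 hx with rfl | rfl <;> rcases (hs.adj_iff w).1 hw with rfl | rfl
    · rfl
    · exact absurd (hxw.1 hs.left) hs.right
    · exact absurd (hxw.2 hs.left) hs.right
    · rfl
  rcases lt_or_gt_of_ne (fun he => hw.ne (hT.disc_inj hv hwn he)) with hlt | hlt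
  · right
    rcases Relation.ReflTransGen.cases_head (hT.anc v w hw hlt) with rfl | ⟨c, hc, hcw⟩
    · exact absurd hw g.irrefl
    · obtain ⟨hc1, rfl⟩ := hc
      have hc0 := hT.child_ne_zero (hT.disc_pos _ hv)
      have hcn := hT.lt_of_disc_pos c hc1
      have hadj := hT.adj_par hA hcn hc0
      have := huniq c hadj.symm (hT.mem_iff_of_anc hA hs hc1 hcw fun z h1 _ he => by
        have h2 := hT.disc_le_of_anc h1 hc1
        have h3 := hT.disc_par c hcn hc0
        rw [he] at h2
        omega)
      subst this
      exact ⟨hc0, rfl⟩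
  · left
    have hv0 : v ≠ 0 := hT.ne_zero_of_disc (by have := hT.disc_pos w hwn; omega)
    refine ⟨hv0, huniq _ (hT.adj_par hA hv hv0) ?_⟩
    have hanc : Anc disc par w (par v) := by
      rcases Relation.ReflTransGen.cases_tail (hT.anc w v hw.symm hlt) with rfl | ⟨c, h1, h2⟩
      · exact absurd hw g.irrefl
      · rw [h2.2]; exact h1
    refine (hT.mem_iff_of_anc hA hs (hT.disc_pos w hwn) hanc fun z h1 h2 he => ?_).symm
    have h3 := hT.disc_le_of_anc h2 (disc_pos_of_anc (hT.disc_pos w hwn) h1)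
    have h4 := hT.disc_par v hv hv0
    rw [he] at h3
    omega

/-- If `v` splits the graph, then only the edge to the parent leaves the subtree of `v`. -/
theorem cut_of_splits (hT : IsDfsTree n st A g ord disc par jin own)
    (hA : AdjArrays {v | v < n} st A g) {v u₁ u₂ : ℕ} {X : Set ℕ} (hs : Splits g v X u₁ u₂)
    (hv0 : v ≠ 0) {a b : ℕ} (ha : Anc disc par v a) (hb : ¬ Anc disc par v b) (hab : g.Adj a b) :
    a = v ∧ b = par v := by
  have hv := hA.mem v u₁ hs.adj_left
  have hvd := hT.disc_pos v hv
  have hpar := hT.adj_par hA hv hv0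
  wlog hX : par v ∈ X generalizing X u₁ u₂
  · have hX' : par v ∈ (insert v X)ᶜ := fun hn => hn.elim (fun he => hpar.ne he.symm) hX
    exact this hs.symm hX'
  have hu₁ : u₁ = par v := by
    rcases (hs.adj_iff _).1 hpar with h | h
    · exact h.symm
    · exact absurd (h ▸ hX) hs.right
  -- A child of `v` differs from `u₁ = par v`, so it is `u₂`, outside `X`; tree paths below it avoid
  -- `v`.
  have hsub : ∀ c, Anc disc par v c → c ∉ X := by
    intro c hc
    rcases Relation.ReflTransGen.cases_head hc with rfl | ⟨d, ⟨hd1, hd2⟩, hdc⟩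
    · exact hs.notMem
    · have hd0 : d ≠ 0 := hT.child_ne_zero (hd2 ▸ hvd)
      have hdn := hT.lt_of_disc_pos d hd1
      have h3 := hT.disc_par d hdn hd0
      have hdX : d ∉ X := by
        have hadj := hT.adj_par hA hdn hd0
        rw [hd2] at hadj
        rcases (hs.adj_iff _).1 hadj.symm with h | h
        · have h4 := hT.disc_par v hv hv0
          rw [← hu₁, ← h] at h4
          rw [hd2] at h3
          omega
        · exact h ▸ hs.right
      refine fun hn => hdX ((hT.mem_iff_of_anc hA hs hd1 hdc fun z h1 _ he => ?_).2 hn)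
      have h2 := hT.disc_le_of_anc h1 hd1
      rw [he, ← hd2] at h2
      omega
  have haX := hsub a ha
  have han := hA.mem a b hab
  have hbn := hA.mem b a hab.symm
  have hlt : disc b < disc a := by
    by_contra hn
    have : disc a < disc b := lt_of_le_of_ne (not_lt.1 hn) fun he =>
      hab.ne (hT.disc_inj han hbn he)
    exact hb (ha.trans (hT.anc a b hab this))
  -- The path from `b` down to `par v` avoids `v`, so `b ∈ X`. An edge from `X` to `a ∉ X` must end
  -- in `v`.
  have hbp := anc_par_of_anc (hT.anc b a hab.symm hlt) ha hb
  have hbX : b ∈ X := by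
    refine (hT.mem_iff_of_anc hA hs (hT.disc_pos b hbn) hbp fun z h1 h2 he => ?_).2 hX
    have h3 := hT.disc_le_of_anc h2 (disc_pos_of_anc (hT.disc_pos b hbn) h1)
    have h4 := hT.disc_par v hv hv0
    rw [he] at h3
    omega
  have hav : a = v := by
    by_contra hne
    exact hs.sep b hbX a haX hne hab.symm
  subst hav
  refine ⟨rfl, ?_⟩
  rcases (hs.adj_iff _).1 hab with h | h
  · exact h.trans hu₁
  · exact absurd (h ▸ hbX) hs.right

/-- If the root splits the graph, then only the edge to the root leaves the subtree of a child. -/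
theorem cut_of_splits_root (hT : IsDfsTree n st A g ord disc par jin own)
    (hA : AdjArrays {v | v < n} st A g) {c u₁ u₂ : ℕ} {X : Set ℕ} (hs : Splits g 0 X u₁ u₂)
    (hc : c < n) (hc0 : c ≠ 0) (hpc : par c = 0) {a b : ℕ} (ha : Anc disc par c a)
    (hb : ¬ Anc disc par c b) (hab : g.Adj a b) : a = c ∧ b = 0 := by
  have hcd := hT.disc_pos c hc
  have hadj : g.Adj c 0 := hpc ▸ hT.adj_par hA hc hc0
  have hc1 := hT.disc_par c hc hc0
  rw [hpc, hT.disc_root] at hc1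
  have han := hA.mem a b hab
  have hbn := hA.mem b a hab.symm
  have hlt : disc b < disc a := by
    by_contra hn
    have : disc a < disc b := lt_of_le_of_ne (not_lt.1 hn) fun he =>
      hab.ne (hT.disc_inj han hbn he)
    exact hb (ha.trans (hT.anc a b hab this))
  have hb0 : b = 0 := by
    have h1 := anc_par_of_anc (hT.anc b a hab.symm hlt) ha hb
    rw [hpc] at h1
    have h2 := hT.disc_le_of_anc h1 (hT.disc_pos b hbn)
    rw [hT.disc_root] at h2
    refine hT.disc_inj hbn (hA.mem 0 c hadj.symm) ?_
    have := hT.disc_pos b hbn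
    rw [hT.disc_root]
    omega
  subst hb0
  refine ⟨?_, rfl⟩
  -- The tree path from `c` to `a` avoids the root, so these two neighbours of the root are on the
  -- same side and coincide.
  have hside : c ∈ X ↔ a ∈ X := hT.mem_iff_of_anc hA hs hcd ha fun z h1 _ he => by
    have := hT.disc_le_of_anc h1 hcd
    rw [he, hT.disc_root] at this
    omega
  rcases (hs.adj_iff c).1 hadj.symm with rfl | rfl <;> rcases (hs.adj_iff a).1 hab.symm with rfl | rfl
  · rfl
  · exact absurd (hside.1 hs.left) hs.right
  · exact absurd (hside.2 hs.left) hs.right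
  · rfl

end IsDfsTree

/-! ### Counting the edges that leave a subtree -/

open scoped Classical in
/-- The edges between `X` and the rest of the vertices below `n`. -/
noncomputable def cutEdges (n : ℕ) (g : SimpleGraph ℕ) (X : Finset ℕ) : Finset (ℕ × ℕ) :=
  (X ×ˢ (Finset.range n \ X)).filter fun p => g.Adj p.1 p.2

theorem mem_cutEdges (hA : AdjArrays {v | v < n} st A g) {X : Finset ℕ} {p : ℕ × ℕ} :
    p ∈ cutEdges n g X ↔ p.1 ∈ X ∧ p.2 ∉ X ∧ g.Adj p.1 p.2 := by
  simp only [cutEdges, Finset.mem_filter, Finset.mem_product, Finset.mem_sdiff, Finset.mem_range]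
  exact ⟨fun h => ⟨h.1.1, h.1.2.2, h.2⟩, fun h => ⟨⟨h.1, hA.mem _ _ h.2.2.symm, h.2.1⟩, h.2.2⟩⟩

/-- An edge inside `X` is counted once as going up and once as going down; an edge leaving `X` goes
up by `hcut` and is counted only once. -/
theorem sum_up_eq {disc up down twin : ℕ → ℕ}
    (hL : IsLabelled n st A g disc par jin up down twin) {X : Finset ℕ}
    (hX : X ⊆ Finset.range n)
    (hcut : ∀ a ∈ X, ∀ b ∉ X, g.Adj a b → disc b < disc a) :
    ∑ a ∈ X, up a = ∑ a ∈ X, down a + (cutEdges n g X).card := by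
  classical
  have hsplit : ∀ (p : ℕ → ℕ → Prop) [DecidableRel p],
      ∑ a ∈ X, ((Finset.range n).filter fun b => p a b).card =
        ∑ a ∈ X, ∑ b ∈ X, (if p a b then 1 else 0) +
          ∑ a ∈ X, ∑ b ∈ Finset.range n \ X, (if p a b then 1 else 0) := by
    intro p _
    rw [← Finset.sum_add_distrib]
    refine Finset.sum_congr rfl fun a _ => ?_
    rw [Finset.card_filter, add_comm, Finset.sum_sdiff hX]
  have h1 : ∑ a ∈ X, up a =
      ∑ a ∈ X, ((Finset.range n).filter fun b => g.Adj a b ∧ disc b < disc a).card :=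
    Finset.sum_congr rfl fun a ha => by
      rw [hL.up_eq a (Finset.mem_range.1 (hX ha))]
  have h2 : ∑ a ∈ X, down a =
      ∑ a ∈ X, ((Finset.range n).filter fun b => g.Adj a b ∧ disc a < disc b).card :=
    Finset.sum_congr rfl fun a ha => by
      rw [hL.down_eq a (Finset.mem_range.1 (hX ha))]
  have h3 : ∑ a ∈ X, ∑ b ∈ Finset.range n \ X, (if g.Adj a b ∧ disc b < disc a then 1 else 0) =
      (cutEdges n g X).card := by
    rw [cutEdges, Finset.card_filter, Finset.sum_product]
    refine Finset.sum_congr rfl fun a ha => Finset.sum_congr rfl fun b hb => ?_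
    have := hcut a ha b (Finset.mem_sdiff.1 hb).2
    by_cases hab : g.Adj a b
    · simp [hab, this hab]
    · simp [hab]
  have h4 : ∑ a ∈ X, ∑ b ∈ Finset.range n \ X, (if g.Adj a b ∧ disc a < disc b then 1 else 0) =
      0 := by
    refine Finset.sum_eq_zero fun a ha => Finset.sum_eq_zero fun b hb => ?_
    have := hcut a ha b (Finset.mem_sdiff.1 hb).2
    exact if_neg fun h => lt_asymm h.2 (this h.1)
  have h5 : ∑ a ∈ X, ∑ b ∈ X, (if g.Adj a b ∧ disc b < disc a then 1 else 0) =
      ∑ a ∈ X, ∑ b ∈ X, (if g.Adj a b ∧ disc a < disc b then 1 else 0) := by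
    rw [Finset.sum_comm]
    refine Finset.sum_congr rfl fun a _ => Finset.sum_congr rfl fun b _ => ?_
    rw [g.adj_comm]
  rw [h1, h2, hsplit, hsplit, h3, h4, h5, add_zero]

open scoped Classical in
/-- The vertices that can be reached from `v` by tree edges to vertices with discovery number
greater than `i`. -/
noncomputable def below (n : ℕ) (disc par : ℕ → ℕ) (i v : ℕ) : Finset ℕ :=
  (Finset.range n).filter
    (Relation.ReflTransGen (fun x y => (0 < disc y ∧ par y = x) ∧ i < disc y) v)

theorem mem_below {i v b : ℕ} : b ∈ below n disc par i v ↔ b < n ∧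
    Relation.ReflTransGen (fun x y => (0 < disc y ∧ par y = x) ∧ i < disc y) v b := by
  simp [below]

theorem below_subset {i v : ℕ} : below n disc par i v ⊆ Finset.range n := by
  classical
  exact Finset.filter_subset _ _

theorem lt_disc_of_mem_below {i v b : ℕ} (h : b ∈ below n disc par i v) (hne : b ≠ v) :
    i < disc b := by
  rcases Relation.ReflTransGen.cases_tail (mem_below.1 h).2 with h1 | ⟨c, -, h2⟩
  exacts [absurd h1 hne, h2.2]

theorem below_self {i v : ℕ} (hv : v < n) : v ∈ below n disc par i v := mem_below.2 ⟨hv, .refl⟩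

namespace IsDfsTree

theorem mem_below_iff_anc (hT : IsDfsTree n st A g ord disc par jin own) {i v : ℕ} (hv : v < n)
    (hi : i ≤ disc v) {b : ℕ} : b ∈ below n disc par i v ↔ Anc disc par v b := by
  rw [mem_below]
  constructor
  · exact fun h => Relation.ReflTransGen.mono (fun x y hxy => hxy.1) _ _ h.2
  · intro h
    refine ⟨hT.lt_of_disc_pos b (disc_pos_of_anc (hT.disc_pos v hv) h), ?_⟩
    induction h with
    | refl => exact .refl
    | tail h1 h2 ih =>
      refine ih.tail ⟨h2, ?_⟩
      have h3 := hT.disc_le_of_anc h1 (hT.disc_pos v hv)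
      have h4 := disc_pos_of_anc (hT.disc_pos v hv) h1
      obtain ⟨h5, rfl⟩ := h2
      have := hT.disc_par _ (hT.lt_of_disc_pos _ h5) (hT.child_ne_zero h4)
      omega

/-- Parents are unique, so two paths to a common vertex can be traced back together; neither can run
through `v` or `w`, whose numbers are at most `i`. -/
theorem below_disjoint {i v w : ℕ} (hv : disc v ≤ i) (hw : disc w ≤ i)
    (hne : v ≠ w) : Disjoint (below n disc par i v) (below n disc par i w) := by
  rw [Finset.disjoint_left]
  intro b hbv hbw
  have h1 := (mem_below.1 hbv).2
  have h2 := (mem_below.1 hbw).2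
  clear hbv hbw
  induction h1 with
  | refl =>
    rcases Relation.ReflTransGen.cases_tail h2 with h3 | ⟨c, -, h4⟩
    · exact hne h3
    · exact absurd h4.2 (by omega)
  | tail h3 h4 ih =>
    rcases Relation.ReflTransGen.cases_tail h2 with rfl | ⟨c, h5, h6⟩
    · exact absurd h4.2 (by omega)
    · have := h6.1.2.symm.trans h4.1.2
      exact ih (this ▸ h5)

/-- Lowering the bound from `i + 1` to `i` admits a single further tree edge, that from `par w` to
`w`. This is the step of the sweep that adds the totals of `w` to those of its parent. -/
theorem below_pred (hT : IsDfsTree n st A g ord disc par jin own) {i w : ℕ} (hw : w < n)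
    (hi : disc w = i + 1) (hw0 : w ≠ 0) {v : ℕ} : below n disc par i v =
      if v = par w then below n disc par (i + 1) v ∪ below n disc par (i + 1) w
      else below n disc par (i + 1) v := by
  have hp := hT.disc_par w hw hw0
  have hnot : ∀ x, Relation.ReflTransGen (fun x y => (0 < disc y ∧ par y = x) ∧ i + 1 < disc y) x
      (par w) → x = par w := by
    intro x hx
    rcases Relation.ReflTransGen.cases_tail hx with h1 | ⟨c, -, h1⟩
    · exact h1.symm
    · exact absurd h1.2 (by omega)
  have hiff : ∀ b, Relation.ReflTransGen (fun x y => (0 < disc y ∧ par y = x) ∧ i < disc y) v b ↔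
      (Relation.ReflTransGen (fun x y => (0 < disc y ∧ par y = x) ∧ i + 1 < disc y) v b ∨
        (v = par w ∧
          Relation.ReflTransGen (fun x y => (0 < disc y ∧ par y = x) ∧ i + 1 < disc y) w b)) := by
    intro b
    constructor
    · intro h
      induction h with
      | refl => exact Or.inl .refl
      | tail _ h2 ih =>
        rename_i b c _
        by_cases hc : i + 1 < disc c
        · exact ih.imp (fun h => h.tail ⟨h2.1, hc⟩) fun h => ⟨h.1, h.2.tail ⟨h2.1, hc⟩⟩
        · have hcw : c = w := hT.disc_inj (hT.lt_of_disc_pos c h2.1.1) hw (by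
            have := h2.2
            omega)
          subst hcw
          obtain ⟨⟨-, rfl⟩, -⟩ := h2
          rcases ih with h3 | ⟨h3, -⟩
          · exact Or.inr ⟨hnot v h3, .refl⟩
          · exact Or.inr ⟨h3, .refl⟩
    · have hmono : ∀ x, Relation.ReflTransGen
          (fun x y => (0 < disc y ∧ par y = x) ∧ i + 1 < disc y) x b →
          Relation.ReflTransGen (fun x y => (0 < disc y ∧ par y = x) ∧ i < disc y) x b :=
        fun x h => Relation.ReflTransGen.mono (fun x y hxy => ⟨hxy.1, by omega⟩) _ _ h
      rintro (h | ⟨rfl, h⟩)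
      · exact hmono v h
      · exact .head ⟨⟨by omega, rfl⟩, by omega⟩ (hmono w h)
  ext b
  split_ifs with hvp
  · rw [Finset.mem_union, mem_below, mem_below, mem_below, hiff]
    tauto
  · rw [mem_below, mem_below, hiff]
    tauto

theorem lt_of_adj_below (hT : IsDfsTree n st A g ord disc par jin own)
    (hA : AdjArrays {v | v < n} st A g) {v a b : ℕ} (ha : Anc disc par v a)
    (hb : ¬ Anc disc par v b) (hab : g.Adj a b) : disc b < disc a := by
  by_contra hn
  have : disc a < disc b := lt_of_le_of_ne (not_lt.1 hn) fun he =>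
    hab.ne (hT.disc_inj (hA.mem a b hab) (hA.mem b a hab.symm) he)
  exact hb (ha.trans (hT.anc a b hab this))

end IsDfsTree

end Subtrees


/-! ### Recognizing splitting vertices -/

section Recognition

variable {n M : ℕ} {st A : ℕ → ℕ} {g : SimpleGraph ℕ} {ord disc par jin own : ℕ → ℕ}
  {up down twin : ℕ → ℕ}

theorem AdjArrays.block_of_splits {S : Set ℕ} (hA : AdjArrays S st A g) {v u₁ u₂ : ℕ} {X : Set ℕ}
    (hs : Splits g v X u₁ u₂) : st (v + 1) = st v + 2 := by
  have hv := hA.mem v u₁ hs.adj_left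
  obtain ⟨i, hi1, hi2, hi3⟩ := (hA.adj v hv u₁).1 hs.adj_left
  obtain ⟨j, hj1, hj2, hj3⟩ := (hA.adj v hv u₂).1 hs.adj_right
  have hij : i ≠ j := fun he => hs.ne (by rw [← hi3, ← hj3, he])
  have hall : ∀ l, st v ≤ l → l < st (v + 1) → l = i ∨ l = j := by
    intro l h1 h2
    rcases (hs.adj_iff (A l)).1 ((hA.adj v hv _).2 ⟨l, h1, h2, rfl⟩) with h | h
    · exact Or.inl (hA.inj v hv l i h1 h2 hi1 hi2 (h.trans hi3.symm))
    · exact Or.inr (hA.inj v hv l j h1 h2 hj1 hj2 (h.trans hj3.symm))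
  by_contra hne
  have h0 := hall (st v) le_rfl (by omega)
  have h1 := hall (st v + 1) (by omega) (by omega)
  have h2 := fun h => hall (st v + 2) (by omega) h
  omega

theorem AdjArrays.adj_iff_of_block {S : Set ℕ} (hA : AdjArrays S st A g) {v : ℕ} (hv : v ∈ S)
    (h2 : st (v + 1) = st v + 2) (w : ℕ) : g.Adj v w ↔ w = A (st v) ∨ w = A (st v + 1) := by
  rw [hA.adj v hv]
  constructor
  · rintro ⟨j, h3, h4, rfl⟩
    rcases Nat.eq_or_lt_of_le h3 with h | h
    · exact Or.inl (by rw [h])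
    · exact Or.inr (by rw [show j = st v + 1 by omega])
  · rintro (rfl | rfl)
    exacts [⟨_, le_rfl, by omega, rfl⟩, ⟨_, by omega, by omega, rfl⟩]

/-- If a vertex has two neighbours and only one edge leaves a set, then this vertex splits the
graph. -/
theorem AdjArrays.exists_splits {S : Set ℕ} (hA : AdjArrays S st A g) {v : ℕ} (hv : v ∈ S)
    (h2 : st (v + 1) = st v + 2) {X : Set ℕ} (hvX : v ∉ X) {x y : ℕ} (hx : g.Adj v x)
    (hy : g.Adj v y) (hxX : x ∈ X) (hyX : y ∉ X)
    (hsep : ∀ a ∈ X, ∀ b ∉ X, b ≠ v → ¬ g.Adj a b) : ∃ u₁ u₂, Splits g v X u₁ u₂ := by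
  have hiff := hA.adj_iff_of_block hv h2
  have hxy : x ≠ y := fun he => hyX (he ▸ hxX)
  refine ⟨x, y, hxX, hyX, hvX, fun w => ?_, hsep⟩
  rcases (hiff x).1 hx with rfl | rfl <;> rcases (hiff y).1 hy with rfl | rfl
  · exact absurd rfl hxy
  · exact hiff w
  · exact (hiff w).trans or_comm
  · exact absurd rfl hxy

namespace IsDfsTree

/-- By `sum_up_eq` the inequality says that fewer than two edges leave the subtree of `v`. The
additive form avoids truncated subtraction. -/
theorem card_cutEdges_lt_two_iff (hT : IsDfsTree n st A g ord disc par jin own)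
    (hA : AdjArrays {v | v < n} st A g)
    (hL : IsLabelled n st A g disc par jin up down twin) {v : ℕ} (hv : v < n) :
    (∑ a ∈ below n disc par (disc v) v, up a < ∑ a ∈ below n disc par (disc v) v, down a + 2) ↔
      ∀ a b c d, Anc disc par v a → ¬ Anc disc par v b → g.Adj a b → Anc disc par v c →
        ¬ Anc disc par v d → g.Adj c d → a = c ∧ b = d := by
  have hmem : ∀ b, b ∈ below n disc par (disc v) v ↔ Anc disc par v b := fun b =>
    hT.mem_below_iff_anc hv le_rfl
  rw [sum_up_eq hL below_subset fun a ha b hb hab => hT.lt_of_adj_below hA ((hmem a).1 ha)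
    (fun hn => hb ((hmem b).2 hn)) hab, Nat.add_lt_add_iff_left, Nat.lt_succ_iff,
    Finset.card_le_one]
  simp only [mem_cutEdges hA, hmem, Prod.forall, Prod.mk.injEq]
  exact ⟨fun h a b c d h1 h2 h3 h4 h5 h6 => h a b ⟨h1, h2, h3⟩ c d ⟨h4, h5, h6⟩,
    fun h a b h1 c d h2 => h a b c d h1.1 h1.2.1 h1.2.2 h2.1 h2.2.1 h2.2.2⟩

/-- Completeness of the test for vertices other than the root. -/
theorem sum_lt_of_splits (hT : IsDfsTree n st A g ord disc par jin own)
    (hA : AdjArrays {v | v < n} st A g)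
    (hL : IsLabelled n st A g disc par jin up down twin) {v u₁ u₂ : ℕ} {X : Set ℕ}
    (hs : Splits g v X u₁ u₂) (hv0 : v ≠ 0) :
    ∑ a ∈ below n disc par (disc v) v, up a < ∑ a ∈ below n disc par (disc v) v, down a + 2 := by
  rw [hT.card_cutEdges_lt_two_iff hA hL (hA.mem v u₁ hs.adj_left)]
  intro a b c d h1 h2 h3 h4 h5 h6
  obtain ⟨rfl, rfl⟩ := hT.cut_of_splits hA hs hv0 h1 h2 h3
  obtain ⟨rfl, rfl⟩ := hT.cut_of_splits hA hs hv0 h4 h5 h6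
  exact ⟨rfl, rfl⟩

theorem not_anc_par (hT : IsDfsTree n st A g ord disc par jin own) {v : ℕ} (hv : v < n)
    (hv0 : v ≠ 0) : ¬ Anc disc par v (par v) := fun h => by
  have h1 := hT.disc_le_of_anc h (hT.disc_pos v hv)
  have h2 := hT.disc_par v hv hv0
  omega

/-- Soundness of the test for vertices other than the root. -/
theorem exists_splits_of_sum_lt (hT : IsDfsTree n st A g ord disc par jin own)
    (hA : AdjArrays {v | v < n} st A g)
    (hL : IsLabelled n st A g disc par jin up down twin) {v : ℕ} (hv : v < n) (hv0 : v ≠ 0)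
    (h2 : st (v + 1) = st v + 2)
    (hlt : ∑ a ∈ below n disc par (disc v) v, up a <
      ∑ a ∈ below n disc par (disc v) v, down a + 2) :
    ∃ u₁ u₂, Splits g v {b | Anc disc par v b ∧ b ≠ v} u₁ u₂ := by
  rw [hT.card_cutEdges_lt_two_iff hA hL hv] at hlt
  have hpar := hT.adj_par hA hv hv0
  have hnp := hT.not_anc_par hv hv0
  have huniq : ∀ a b, Anc disc par v a → ¬ Anc disc par v b → g.Adj a b → a = v ∧ b = par v :=
    fun a b h1 h2 h3 => hlt a b v (par v) h1 h2 h3 .refl hnp hpar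
  -- the other neighbour
  obtain ⟨x, hx, hxp⟩ : ∃ x, g.Adj v x ∧ x ≠ par v := by
    have hiff := hA.adj_iff_of_block (S := {v | v < n}) hv h2
    have hne : A (st v) ≠ A (st v + 1) := fun he => by
      have := hA.inj v hv (st v) (st v + 1) le_rfl (by omega) (by omega) (by omega) he
      omega
    by_cases h : A (st v) = par v
    · exact ⟨_, (hiff _).2 (Or.inr rfl), fun he => hne (h.trans he.symm)⟩
    · exact ⟨_, (hiff _).2 (Or.inl rfl), h⟩
  have hxa : Anc disc par v x := by
    by_contra hn
    exact hxp (huniq v x .refl hn hx).2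
  refine hA.exists_splits (S := {v | v < n}) hv h2 (fun h => h.2 rfl) hx hpar ⟨hxa, hx.ne'⟩
    (fun h => hnp h.1) fun a ha b hb hbv hab => ha.2 (huniq a b ha.1 (fun h => hb ⟨h, hbv⟩) hab).1

/-- Only the root is discovered before the second vertex, so it is the parent of that vertex. The
test for the root uses the subtree of this child. -/
theorem par_ord_one (hT : IsDfsTree n st A g ord disc par jin own) (hn : 1 < n) :
    ord 1 < n ∧ ord 1 ≠ 0 ∧ par (ord 1) = 0 := by
  have h1 := hT.ord_lt 1 hn
  have h2 := hT.disc_ord 1 hn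
  have h3 : ord 1 ≠ 0 := hT.ne_zero_of_disc (by omega)
  refine ⟨h1, h3, hT.disc_inj (hT.par_lt _ h1 h3) (by omega) ?_⟩
  have h4 := hT.disc_par _ h1 h3
  have h5 := hT.disc_pos _ (hT.par_lt _ h1 h3)
  rw [hT.disc_root]
  omega

/-- Completeness of the test for the root. -/
theorem sum_lt_of_splits_root (hT : IsDfsTree n st A g ord disc par jin own)
    (hA : AdjArrays {v | v < n} st A g)
    (hL : IsLabelled n st A g disc par jin up down twin) {c u₁ u₂ : ℕ} {X : Set ℕ}
    (hs : Splits g 0 X u₁ u₂) (hc : c < n) (hc0 : c ≠ 0) (hpc : par c = 0) :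
    ∑ a ∈ below n disc par (disc c) c, up a < ∑ a ∈ below n disc par (disc c) c, down a + 2 := by
  rw [hT.card_cutEdges_lt_two_iff hA hL hc]
  intro a b x y h1 h2 h3 h4 h5 h6
  obtain ⟨rfl, rfl⟩ := hT.cut_of_splits_root hA hs hc hc0 hpc h1 h2 h3
  obtain ⟨rfl, rfl⟩ := hT.cut_of_splits_root hA hs hc hc0 hpc h4 h5 h6
  exact ⟨rfl, rfl⟩

/-- Soundness of the test for the root. -/
theorem exists_splits_root_of_sum_lt (hT : IsDfsTree n st A g ord disc par jin own)
    (hA : AdjArrays {v | v < n} st A g)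
    (hL : IsLabelled n st A g disc par jin up down twin) {c : ℕ} (hc : c < n) (hc0 : c ≠ 0)
    (hpc : par c = 0) (h2 : st (0 + 1) = st 0 + 2)
    (hlt : ∑ a ∈ below n disc par (disc c) c, up a <
      ∑ a ∈ below n disc par (disc c) c, down a + 2) :
    ∃ u₁ u₂, Splits g 0 {b | Anc disc par c b} u₁ u₂ := by
  rw [hT.card_cutEdges_lt_two_iff hA hL hc] at hlt
  have hadj : g.Adj c 0 := hpc ▸ hT.adj_par hA hc hc0
  have h0n := hA.mem 0 c hadj.symm
  have hn0 : ¬ Anc disc par c 0 := hpc ▸ hT.not_anc_par hc hc0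
  have huniq : ∀ a b, Anc disc par c a → ¬ Anc disc par c b → g.Adj a b → a = c ∧ b = 0 :=
    fun a b h1 h2 h3 => hlt a b c 0 h1 h2 h3 .refl hn0 hadj
  obtain ⟨x, hx, hxc⟩ : ∃ x, g.Adj 0 x ∧ x ≠ c := by
    have hiff := hA.adj_iff_of_block (S := {v | v < n}) h0n h2
    have hne : A (st 0) ≠ A (st 0 + 1) := fun he => by
      have := hA.inj 0 h0n (st 0) (st 0 + 1) le_rfl (by omega) (by omega) (by omega) he
      omega
    by_cases h : A (st 0) = c
    · exact ⟨_, (hiff _).2 (Or.inr rfl), fun he => hne (h.trans he.symm)⟩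
    · exact ⟨_, (hiff _).2 (Or.inl rfl), h⟩
  have hxa : ¬ Anc disc par c x := fun h => hxc (huniq x 0 h hn0 hx.symm).1
  exact hA.exists_splits (S := {v | v < n}) h0n h2 hn0 hadj.symm hx .refl hxa
    fun a ha b hb hb0 hab => hb0 (huniq a b ha hb hab).2

/-- Edges at a splitting vertex are tree edges by `par_of_splits`, so their positions have been
linked from the lower end, whether the edge goes up or down from `v`. -/
theorem twin_of_splits (hT : IsDfsTree n st A g ord disc par jin own)
    (hA : AdjArrays {v | v < n} st A g)
    (hL : IsLabelled n st A g disc par jin up down twin) {v u₁ u₂ : ℕ} {X : Set ℕ}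
    (hs : Splits g v X u₁ u₂) {j : ℕ} (h1 : st v ≤ j) (h2 : j < st (v + 1)) :
    st (A j) ≤ twin j ∧ twin j < st (A j + 1) ∧ A (twin j) = v := by
  have hv := hA.mem v u₁ hs.adj_left
  have hadj : g.Adj v (A j) := (hA.adj v hv _).2 ⟨j, h1, h2, rfl⟩
  rcases hT.par_of_splits hA hs hadj with ⟨hv0, hp⟩ | ⟨hw0, hp⟩
  · rw [(hL.twin_spec v hv hv0 j h1 h2 hp.symm).1, ← hp]
    exact ⟨hT.le_jin v hv hv0, hT.jin_lt v hv hv0, hT.target_jin v hv hv0⟩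
  · have hwn := hA.mem _ _ hadj.symm
    obtain ⟨i, hi1, hi2, hi3⟩ := (hA.adj (A j) hwn v).1 hadj.symm
    have hle := hT.le_jin _ hwn hw0
    have hlt := hT.jin_lt _ hwn hw0
    rw [hp] at hle hlt
    have hj : j = jin (A j) := hA.inj v hv j _ h1 h2 hle hlt (hT.target_jin _ hwn hw0).symm
    have := (hL.twin_spec _ hwn hw0 i hi1 hi2 (hi3.trans hp.symm)).2
    rw [← hj] at this
    rw [this]
    exact ⟨hi1, hi2, hi3⟩

end IsDfsTree

end Recognition

/-! ### Suppression in adjacency arrays -/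

section Reduction

/-- The state of the reduction: `S` is the set of the remaining vertices, `g` the current graph,
which is isolated outside of `S`, and `g₀` the original graph. -/
structure Reduction {V : Type} (k : ℕ) (G : SimpleGraph V) (n M : ℕ) (st : ℕ → ℕ)
    (g₀ : SimpleGraph ℕ) (A twin : ℕ → ℕ) (S : Finset ℕ) (g : SimpleGraph ℕ) : Prop where
  subset : ∀ v ∈ S, v < n
  arrays : AdjArrays (S : Set ℕ) st A g
  connected : (g.induce (S : Set ℕ)).Connected
  reduces : ReducesTo k G (g.induce (S : Set ℕ))
  -- The side `X` is the same as in `g₀`, so only its intersection with `S` has to be counted.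
  splits : ∀ v ∈ S, ∀ X u₁ u₂, Splits g₀ v X u₁ u₂ → ∃ w₁ w₂, Splits g v X w₁ w₂
  splits_conv : ∀ v X u₁ u₂, Splits g v X u₁ u₂ → ∃ Y w₁ w₂, Splits g₀ v Y w₁ w₂
  twin_spec : ∀ v ∈ S, (∃ X u₁ u₂, Splits g₀ v X u₁ u₂) → ∀ j, st v ≤ j → j < st (v + 1) →
    st (A j) ≤ twin j ∧ twin j < st (A j + 1) ∧ A (twin j) = v

variable {V : Type} {k : ℕ} {G : SimpleGraph V} {n M : ℕ} {st : ℕ → ℕ}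
  {g₀ : SimpleGraph ℕ} {A twin : ℕ → ℕ} {S : Finset ℕ} {g : SimpleGraph ℕ}

/-- The array of neighbours after suppression of `v`. -/
def suppressArr (st A twin : ℕ → ℕ) (v : ℕ) : ℕ → ℕ :=
  Function.update (Function.update A (twin (st v)) (A (st v + 1))) (twin (st v + 1)) (A (st v))

/-- The twins after suppression of `v`. -/
def suppressTwin (st twin : ℕ → ℕ) (v : ℕ) : ℕ → ℕ :=
  Function.update (Function.update twin (twin (st v)) (twin (st v + 1))) (twin (st v + 1))
    (twin (st v))

/-- In the blocks of the neighbours `a` and `b`, the entry `v` is replaced by `b` and `a`,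
respectively, and the two positions become twins of each other. No block changes its length. -/
theorem Reduction.suppress [Finite V] (h : Reduction k G n M st g₀ A twin S g) (hG : G.Connected)
    (hO : IsOffsets n M st) {v : ℕ} (hv : v ∈ S) {X : Set ℕ}
    (hs : ∃ u₁ u₂, Splits g₀ v X u₁ u₂) (h1 : k < (X ∩ S).ncard)
    (h2 : k < ((S : Set ℕ) \ insert v X).ncard) :
    Reduction k G n M st g₀ (suppressArr st A twin v) (suppressTwin st twin v) (S.erase v)
      (suppressAt g v) := by
  obtain ⟨u₁, u₂, hs₀⟩ := hs
  obtain ⟨w₁, w₂, hs⟩ := h.splits v hv X u₁ u₂ hs₀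
  have hblock := h.arrays.block_of_splits hs
  have hiff := h.arrays.adj_iff_of_block hv hblock
  have ht1 := h.twin_spec v hv ⟨X, u₁, u₂, hs₀⟩ (st v) le_rfl (by omega)
  have ht2 := h.twin_spec v hv ⟨X, u₁, u₂, hs₀⟩ (st v + 1) (by omega) (by omega)
  unfold suppressArr suppressTwin
  set a := A (st v) with ha
  set b := A (st v + 1) with hb
  set t₁ := twin (st v) with ht₁
  set t₂ := twin (st v + 1) with ht₂
  have hab : a ≠ b := fun he => by
    have := h.arrays.inj v hv (st v) (st v + 1) le_rfl (by omega) (by omega) (by omega) he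
    omega
  have hva : g.Adj v a := (hiff a).2 (Or.inl rfl)
  have hvb : g.Adj v b := (hiff b).2 (Or.inr rfl)
  have haS : a ∈ S := h.arrays.mem _ _ hva.symm
  have hbS : b ∈ S := h.arrays.mem _ _ hvb.symm
  -- The neighbours lie on different sides of `v`; non-adjacency keeps the lists free of
  -- repetitions.
  have hnadj : ¬ g.Adj a b := by
    rcases (hs.adj_iff a).1 hva with h3 | h3 <;> rcases (hs.adj_iff b).1 hvb with h4 | h4
    · exact absurd (h3.trans h4.symm) hab
    · rw [h3, h4]; exact hs.not_adj
    · rw [h3, h4]; exact fun hn => hs.not_adj hn.symm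
    · exact absurd (h3.trans h4.symm) hab
  have hx1 : ∀ x ∈ S, st x ≤ t₁ → t₁ < st (x + 1) → x = a := fun x hx h3 h4 =>
    hO.block_unique (h.subset x hx) (h.subset a haS) h3 h4 ht1.1 ht1.2.1
  have hx2 : ∀ x ∈ S, st x ≤ t₂ → t₂ < st (x + 1) → x = b := fun x hx h3 h4 =>
    hO.block_unique (h.subset x hx) (h.subset b hbS) h3 h4 ht2.1 ht2.2.1
  have htt : t₁ ≠ t₂ := fun he => hab (hx2 a haS (he ▸ ht1.1) (he ▸ ht1.2.1))
  -- the positions with target `v`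
  have htv : ∀ x ∈ S, ∀ j, st x ≤ j → j < st (x + 1) → A j = v → j = t₁ ∨ j = t₂ := by
    intro x hx j h3 h4 h5
    have hadj : g.Adj v x := ((h.arrays.adj x hx v).2 ⟨j, h3, h4, h5⟩).symm
    rcases (hiff x).1 hadj with rfl | rfl
    · exact Or.inl (h.arrays.inj _ hx j t₁ h3 h4 ht1.1 ht1.2.1 (h5.trans ht1.2.2.symm))
    · exact Or.inr (h.arrays.inj _ hx j t₂ h3 h4 ht2.1 ht2.2.1 (h5.trans ht2.2.2.symm))
  have hA1 : Function.update (Function.update A t₁ b) t₂ a t₁ = b := by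
    rw [Function.update_of_ne htt, Function.update_self]
  have hA2 : Function.update (Function.update A t₁ b) t₂ a t₂ = a := Function.update_self ..
  have hAo : ∀ j, j ≠ t₁ → j ≠ t₂ → Function.update (Function.update A t₁ b) t₂ a j = A j :=
    fun j h3 h4 => by rw [Function.update_of_ne h4, Function.update_of_ne h3]
  have hT1 : Function.update (Function.update twin t₁ t₂) t₂ t₁ t₁ = t₂ := by
    rw [Function.update_of_ne htt, Function.update_self]
  have hT2 : Function.update (Function.update twin t₁ t₂) t₂ t₁ t₂ = t₁ := Function.update_self ..
  have hTo : ∀ j, j ≠ t₁ → j ≠ t₂ → Function.update (Function.update twin t₁ t₂) t₂ t₁ j = twin j :=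
    fun j h3 h4 => by rw [Function.update_of_ne h4, Function.update_of_ne h3]
  have hsup : IsSuppressible (g.induce (S : Set ℕ)) k ⟨v, hv⟩ :=
    hs.isSuppressible_induce h.arrays.mem h.connected h1 h2
  have hcoe : ((S.erase v : Finset ℕ) : Set ℕ) = (S : Set ℕ) \ {v} := Finset.coe_erase v S
  refine ⟨fun x hx => h.subset x (Finset.mem_of_mem_erase hx), ⟨?_, ?_, ?_⟩, ?_, ?_, ?_, ?_, ?_⟩
  · intro x hx i j hi1 hi2 hj1 hj2 hij
    have hxS : x ∈ S := Finset.mem_of_mem_erase hx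
    -- a new target is not an old target
    have hnew : ∀ i j, st x ≤ i → i < st (x + 1) → st x ≤ j → j < st (x + 1) →
        (i = t₁ ∨ i = t₂) → Function.update (Function.update A t₁ b) t₂ a i =
          Function.update (Function.update A t₁ b) t₂ a j → i = j := by
      rintro i j hi1 hi2 hj1 hj2 (rfl | rfl) hij
      · have hxa := hx1 x hxS hi1 hi2
        by_cases h3 : j = t₁
        · exact h3.symm
        · by_cases h4 : j = t₂
          · exact absurd (hxa.symm.trans (hx2 x hxS (h4 ▸ hj1) (h4 ▸ hj2))) hab
          · rw [hA1, hAo j h3 h4] at hij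
            exact absurd (hxa ▸ (h.arrays.adj x hxS b).2 ⟨j, hj1, hj2, hij.symm⟩) hnadj
      · have hxb := hx2 x hxS hi1 hi2
        by_cases h4 : j = t₂
        · exact h4.symm
        · by_cases h3 : j = t₁
          · exact absurd ((hx1 x hxS (h3 ▸ hj1) (h3 ▸ hj2)).symm.trans hxb) hab
          · rw [hA2, hAo j h3 h4] at hij
            exact absurd (hxb ▸ (h.arrays.adj x hxS a).2 ⟨j, hj1, hj2, hij.symm⟩).symm hnadj
    by_cases h3 : i = t₁ ∨ i = t₂
    · exact hnew i j hi1 hi2 hj1 hj2 h3 hij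
    · by_cases h4 : j = t₁ ∨ j = t₂
      · exact (hnew j i hj1 hj2 hi1 hi2 h4 hij.symm).symm
      · rw [not_or] at h3 h4
        rw [hAo i h3.1 h3.2, hAo j h4.1 h4.2] at hij
        exact h.arrays.inj x hxS i j hi1 hi2 hj1 hj2 hij
  · intro x hx w
    have hxS : x ∈ S := Finset.mem_of_mem_erase hx
    have hxv : x ≠ v := Finset.ne_of_mem_erase hx
    rw [suppressAt_adj]
    constructor
    · rintro ⟨-, hwv, hxw | ⟨hxw, hvx, hvw⟩⟩
      · obtain ⟨j, h3, h4, h5⟩ := (h.arrays.adj x hxS w).1 hxw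
        refine ⟨j, h3, h4, ?_⟩
        rw [hAo j, h5]
        · rintro rfl; exact hwv (h5.symm.trans ht1.2.2)
        · rintro rfl; exact hwv (h5.symm.trans ht2.2.2)
      · rcases (hiff x).1 hvx with rfl | rfl <;> rcases (hiff w).1 hvw with rfl | rfl
        · exact absurd rfl hxw
        · exact ⟨t₁, ht1.1, ht1.2.1, hA1⟩
        · exact ⟨t₂, ht2.1, ht2.2.1, hA2⟩
        · exact absurd rfl hxw
    · rintro ⟨j, h3, h4, h5⟩
      by_cases hj1 : j = t₁
      · subst hj1
        have hxa := hx1 x hxS h3 h4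
        rw [hA1] at h5
        subst hxa h5
        exact ⟨hxv, hvb.ne', Or.inr ⟨hab, hva, hvb⟩⟩
      · by_cases hj2 : j = t₂
        · subst hj2
          have hxb := hx2 x hxS h3 h4
          rw [hA2] at h5
          subst hxb h5
          exact ⟨hxv, hva.ne', Or.inr ⟨hab.symm, hvb, hva⟩⟩
        · rw [hAo j hj1 hj2] at h5
          refine ⟨hxv, fun he => ?_, Or.inl ((h.arrays.adj x hxS w).2 ⟨j, h3, h4, h5⟩)⟩
          exact (htv x hxS j h3 h4 (h5.trans he)).elim hj1 hj2
  · rintro x w ⟨hxv, -, hxw | ⟨-, hvx, -⟩⟩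
    · exact Finset.mem_coe.2 (Finset.mem_erase.2 ⟨hxv, h.arrays.mem _ _ hxw⟩)
    · exact Finset.mem_coe.2 (Finset.mem_erase.2 ⟨hxv, h.arrays.mem _ _ hvx.symm⟩)
  · rw [hcoe]
    exact (suppressInduceIso g (S : Set ℕ) v hv).connected_iff.1
      (hsup.connected_suppress h.connected)
  · rw [hcoe]
    exact h.reduces.suppressAt hG hv hsup
  · intro x hx Y y₁ y₂ hY
    obtain ⟨z₁, z₂, hz⟩ := h.splits x (Finset.mem_of_mem_erase hx) Y y₁ y₂ hY
    exact hz.suppressAt hs (Finset.ne_of_mem_erase hx)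
  · intro x Y y₁ y₂ hY
    have hxv : x ≠ v := hY.adj_left.1
    obtain ⟨Z, z₁, z₂, hz⟩ := hY.of_suppressAt hs hxv
    exact h.splits_conv x Z z₁ z₂ hz
  · intro x hx hY j h3 h4
    have hxS : x ∈ S := Finset.mem_of_mem_erase hx
    by_cases hj1 : j = t₁
    · subst hj1
      rw [hA1, hT1, hA2]
      exact ⟨ht2.1, ht2.2.1, (hx1 x hxS h3 h4).symm⟩
    · by_cases hj2 : j = t₂
      · subst hj2
        rw [hA2, hT2, hA1]
        exact ⟨ht1.1, ht1.2.1, (hx2 x hxS h3 h4).symm⟩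
      · rw [hAo j hj1 hj2, hTo j hj1 hj2]
        obtain ⟨h5, h6, h7⟩ := h.twin_spec x hxS hY j h3 h4
        have hxv : x ≠ v := Finset.ne_of_mem_erase hx
        -- The twin of an untouched position carries the entry `x`, not `v`, so it is not
        -- overwritten either.
        rw [hAo _ (fun he => hxv (by rw [← h7, he, ht1.2.2]))
          (fun he => hxv (by rw [← h7, he, ht2.2.2]))]
        exact ⟨h5, h6, h7⟩

/-- A vertex that does not become suppressible when other vertices are suppressed. -/
def Settled (k : ℕ) (g₀ : SimpleGraph ℕ) (S : Finset ℕ) (v : ℕ) : Prop :=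
  (∀ X u₁ u₂, ¬ Splits g₀ v X u₁ u₂) ∨ ∃ X u₁ u₂, Splits g₀ v X u₁ u₂ ∧
    ((X ∩ S).ncard ≤ k ∨ ((S : Set ℕ) \ insert v X).ncard ≤ k)

/-- Removing vertices only shrinks both sides. Hence each vertex has to be tried only once. -/
theorem Settled.mono {S T : Finset ℕ} (hST : T ⊆ S) {v : ℕ} (h : Settled k g₀ S v) :
    Settled k g₀ T v := by
  have hST' : (T : Set ℕ) ⊆ S := Finset.coe_subset.2 hST
  refine h.imp_right fun ⟨X, u₁, u₂, h1, h2⟩ => ⟨X, u₁, u₂, h1, h2.imp (fun h => ?_) fun h => ?_⟩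
  · exact (Set.ncard_le_ncard (Set.inter_subset_inter_right _ hST')
      (S.finite_toSet.inter_of_right _)).trans h
  · exact (Set.ncard_le_ncard (Set.sdiff_subset_sdiff_left hST') S.finite_toSet.sdiff).trans h

/-- A suppressible vertex splits the current graph and therefore also `g₀`. The set `X` that settles
it still splits the current graph, so both its sides would have more than `k` vertices. -/
theorem Reduction.not_isSuppressible (h : Reduction k G n M st g₀ A twin S g) {v : ℕ}
    (hv : v ∈ S) (hset : Settled k g₀ S v) :
    ¬ IsSuppressible (g.induce (S : Set ℕ)) k ⟨v, hv⟩ := by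
  intro hsup
  obtain ⟨Y, y₁, y₂, hY⟩ := hsup.exists_splits
  obtain ⟨Z, z₁, z₂, hZ⟩ := h.splits_conv _ _ _ _ (hY.of_induce h.arrays.mem)
  rcases hset with h1 | ⟨X, u₁, u₂, hX, hle⟩
  · exact h1 Z z₁ z₂ hZ
  · obtain ⟨w₁, w₂, hw⟩ := h.splits v hv X u₁ u₂ hX
    obtain ⟨h3, h4⟩ := hsup.lt_ncard_induce h.arrays.mem hv hw
    omega

end Reduction


/-! ### Suppressing all suppressible vertices -/

notation "rI" => (14 : ℕ)
notation "rV" => (15 : ℕ)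
notation "rPar" => (16 : ℕ)
notation "rS" => (17 : ℕ)
notation "rU" => (18 : ℕ)
notation "rD" => (19 : ℕ)
notation "rFst" => (20 : ℕ)
notation "rSnd" => (21 : ℕ)
notation "rTwFst" => (22 : ℕ)
notation "rTwSnd" => (23 : ℕ)
notation "rAdjFst" => (24 : ℕ)
notation "rAdjSnd" => (25 : ℕ)
notation "rLive" => (26 : ℕ)
notation "aBelow" => (11 : ℕ)
notation "aDead" => (12 : ℕ)

section Sweep

/-- Suppresses the vertex `rV`, whose edges are at the positions `rFst` and `rSnd`. -/
def suppressProg : Prog :=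
  .load rAdjFst aAdj rFst ;; .load rAdjSnd aAdj rSnd ;; .load rTwFst aTwin rFst ;;
    .load rTwSnd aTwin rSnd ;; .store aAdj rTwFst rAdjSnd ;; .store aAdj rTwSnd rAdjFst ;;
    .store aTwin rTwFst rTwSnd ;; .store aTwin rTwSnd rTwFst ;; .store aDead rV rOne ;;
    .sub rLive rLive rOne

/-- Suppresses the vertex `rV` if it has degree two, `rU < rD + 2`, and both `rS` and
`rLive - rS - 1` are greater than `k`. -/
def tryProg : Prog :=
  .add rTmp rD rOne ;; .add rTmp rTmp rOne ;;
    .ite rU rTmp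
      (.load rFst aStart rV ;; .add rTmp rV rOne ;; .load rTmp aStart rTmp ;;
        .add rSnd rFst rOne ;; .add rAux rSnd rOne ;;
        .ite rAux rTmp (.const rTmp 0) (.ite rSnd rTmp
          (.ite rK rS (.sub rAux rLive rS ;; .sub rAux rAux rOne ;;
            .ite rK rAux suppressProg (.const rTmp 0)) (.const rTmp 0)) (.const rTmp 0)))
      (.const rTmp 0)

variable {n M : ℕ} {st A : ℕ → ℕ} {g₀ : SimpleGraph ℕ} {ord disc par jin own : ℕ → ℕ}
  {up down twin : ℕ → ℕ}

theorem tryProg_eval_of_pos {s : Store} (h1 : s.reg rOne = 1) (hst : s.arr aStart = st)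
    (hc : s.reg rU < s.reg rD + 2) (h2 : st (s.reg rV + 1) = st (s.reg rV) + 2)
    (hs : s.reg rK < s.reg rS) (hl : s.reg rK < s.reg rLive - s.reg rS - 1) :
    (tryProg.eval s).arr aAdj = suppressArr st (s.arr aAdj) (s.arr aTwin) (s.reg rV) ∧
    (tryProg.eval s).arr aTwin = suppressTwin st (s.arr aTwin) (s.reg rV) ∧
    (tryProg.eval s).arr aDead = Function.update (s.arr aDead) (s.reg rV) 1 ∧
    (tryProg.eval s).reg rLive = s.reg rLive - 1 := by
  refine ⟨?_, ?_, ?_, ?_⟩ <;>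
    simp [tryProg, suppressProg, Prog.eval, h1, hst, hc, h2, hs, hl, suppressArr, suppressTwin]

theorem tryProg_eval_of_neg {s : Store} (h1 : s.reg rOne = 1) (hst : s.arr aStart = st)
    (h : ¬ (s.reg rU < s.reg rD + 2 ∧ st (s.reg rV + 1) = st (s.reg rV) + 2 ∧
      s.reg rK < s.reg rS ∧ s.reg rK < s.reg rLive - s.reg rS - 1)) :
    (tryProg.eval s).arr = s.arr ∧ (tryProg.eval s).reg rLive = s.reg rLive := by
  by_cases hc : s.reg rU < s.reg rD + 2
  · by_cases h2 : st (s.reg rV) + 2 < st (s.reg rV + 1)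
    · constructor <;> simp [tryProg, Prog.eval, h1, hst, hc, h2]
    · by_cases h3 : st (s.reg rV) + 1 < st (s.reg rV + 1)
      · by_cases hs : s.reg rK < s.reg rS
        · have hl : ¬ s.reg rK < s.reg rLive - s.reg rS - 1 := fun hl =>
            h ⟨hc, by omega, hs, hl⟩
          constructor <;> simp [tryProg, Prog.eval, h1, hst, hc, h2, h3, hs, hl, -not_lt]
        · constructor <;> simp [tryProg, Prog.eval, h1, hst, hc, h2, h3, hs, -not_lt]
      · constructor <;> simp [tryProg, Prog.eval, h1, hst, hc, h2, h3, -not_lt]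
  · constructor <;> simp [tryProg, Prog.eval, h1, hc, -not_lt]

/-- The memory represents the state of the reduction with the set `S` of remaining vertices. -/
structure Represents {V : Type} (k : ℕ) (G : SimpleGraph V) (n M : ℕ) (st : ℕ → ℕ)
    (g₀ : SimpleGraph ℕ) (S : Finset ℕ) (s : Store) : Prop where
  exists_reduction : ∃ g, Reduction k G n M st g₀ (s.arr aAdj) (s.arr aTwin) S g
  dead : ∀ v < n, s.arr aDead v = if v ∈ S then 0 else 1
  live : s.reg rLive = S.card

variable {V : Type} [Finite V] {k : ℕ} {G : SimpleGraph V} {S : Finset ℕ}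

/-- The set `X` is left open so as to cover all vertices: it is the subtree without its top vertex
in general, and the subtree of a child for the root. The counts are required only for blocks of
length two, since the root of a one-vertex graph has no child. -/
theorem Represents.tryProg {s : Store} (h : Represents k G n M st g₀ S s) (hG : G.Connected)
    (hO : IsOffsets n M st) (h1 : s.reg rOne = 1) (hk : s.reg rK = k) (hst : s.arr aStart = st)
    (hv : s.reg rV ∈ S) {X : Set ℕ}
    (hX : st (s.reg rV + 1) = st (s.reg rV) + 2 → s.reg rS = (X ∩ S).ncard ∧
      s.reg rLive - s.reg rS - 1 = ((S : Set ℕ) \ insert (s.reg rV) X).ncard)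
    (hsound : s.reg rU < s.reg rD + 2 → st (s.reg rV + 1) = st (s.reg rV) + 2 →
      ∃ u₁ u₂, Splits g₀ (s.reg rV) X u₁ u₂)
    (hcompl : ∀ Y u₁ u₂, Splits g₀ (s.reg rV) Y u₁ u₂ →
      s.reg rU < s.reg rD + 2 ∧ st (s.reg rV + 1) = st (s.reg rV) + 2) :
    ∃ S', (S' = S ∨ S' = S.erase (s.reg rV)) ∧ Represents k G n M st g₀ S' (tryProg.eval s) ∧
      (s.reg rV ∈ S' → Settled k g₀ S' (s.reg rV)) := by
  obtain ⟨g, hg⟩ := h.exists_reduction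
  by_cases hc : s.reg rU < s.reg rD + 2 ∧ st (s.reg rV + 1) = st (s.reg rV) + 2 ∧
      s.reg rK < s.reg rS ∧ s.reg rK < s.reg rLive - s.reg rS - 1
  · obtain ⟨e1, e2, e3, e4⟩ := tryProg_eval_of_pos h1 hst hc.1 hc.2.1 hc.2.2.1 hc.2.2.2
    refine ⟨_, Or.inr rfl, ⟨⟨suppressAt g (s.reg rV), ?_⟩, fun v hvn => ?_, ?_⟩, fun h => absurd h (by simp)⟩
    · rw [e1, e2]
      exact hg.suppress hG hO hv (hsound hc.1 hc.2.1) (by rw [← (hX hc.2.1).1, ← hk]; exact hc.2.2.1)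
        (by rw [← (hX hc.2.1).2, ← hk]; exact hc.2.2.2)
    · rw [e3, Function.update_apply]
      split_ifs with h2 h3 h3
      · exact absurd (h2 ▸ h3) (by simp)
      · rfl
      · rw [h.dead v hvn, if_pos (Finset.mem_of_mem_erase h3)]
      · rw [h.dead v hvn, if_neg fun h4 => h3 (Finset.mem_erase.2 ⟨h2, h4⟩)]
    · rw [e4, h.live, Finset.card_erase_of_mem hv]
  · obtain ⟨e1, e2⟩ := tryProg_eval_of_neg h1 hst hc
    refine ⟨S, Or.inl rfl, ⟨⟨g, by rw [e1]; exact hg⟩, by rw [e1]; exact h.dead,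
      by rw [e2]; exact h.live⟩, fun _ => ?_⟩
    by_cases hc' : s.reg rU < s.reg rD + 2 ∧ st (s.reg rV + 1) = st (s.reg rV) + 2
    · obtain ⟨u₁, u₂, hs⟩ := hsound hc'.1 hc'.2
      refine Or.inr ⟨X, u₁, u₂, hs, ?_⟩
      rw [← (hX hc'.2).1, ← (hX hc'.2).2]
      by_contra hn
      exact hc ⟨hc'.1, hc'.2, by omega, by omega⟩
    · exact Or.inl fun Y u₁ u₂ hY => hc' (hcompl Y u₁ u₂ hY)

def sweepHead : Prog :=
  .sub rI rI rOne ;; .load rV aOrd rI ;; .load rPar aPar rV ;; .load rU aUp rV ;;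
    .load rD aDown rV ;; .load rS aBelow rV

/-- `1 - aDead` is `1` exactly for a surviving vertex, so `rS` becomes the number of survivors in
its whole subtree. -/
def sweepTail : Prog :=
  .load rTmp aDead rV ;; .sub rTmp rOne rTmp ;; .add rS rS rTmp ;;
    .load rTmp aBelow rPar ;; .add rTmp rTmp rS ;; .store aBelow rPar rTmp ;;
    .load rTmp aUp rPar ;; .add rTmp rTmp rU ;; .store aUp rPar rTmp ;;
    .load rTmp aDown rPar ;; .add rTmp rTmp rD ;; .store aDown rPar rTmp

def sweepBody : Prog := sweepHead ;; tryProg ;; sweepTail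

/-- Tries to suppress all vertices, from the leaves of the search tree to the root. -/
def sweepProg : Prog :=
  -- The loop ends after the vertex with number `2`, a child of the root. The root is then tried
  -- with the totals that this child has left in the registers.
  (.add rI rN rZero ;; .add rLive rN rZero) ;; .while rOne rI sweepBody ;; .const rV 0 ;; tryProg

/-- The memory when all vertices at positions `≥ i` of the search order have been tried. -/
structure SweepMem {V : Type} (k : ℕ) (G : SimpleGraph V) (n M : ℕ) (st : ℕ → ℕ)
    (g₀ : SimpleGraph ℕ) (ord disc par up down : ℕ → ℕ) (i : ℕ) (S : Finset ℕ) (s : Store) :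
    Prop where
  represents : Represents k G n M st g₀ S s
  reg_i : s.reg rI = i
  le : i ≤ n
  mem : ∀ v < n, disc v ≤ i → v ∈ S
  up_eq : ∀ v < n, disc v ≤ i → s.arr aUp v = ∑ b ∈ below n disc par i v, up b
  down_eq : ∀ v < n, disc v ≤ i → s.arr aDown v = ∑ b ∈ below n disc par i v, down b
  below_eq : ∀ v < n, disc v ≤ i →
    s.arr aBelow v = ((below n disc par i v).filter fun b => b ∈ S ∧ b ≠ v).card
  settled : ∀ v ∈ S, i < disc v → Settled k g₀ S v
  -- The totals of the vertex tried last; for `i = 1` they serve the root.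
  last : i < n → s.reg rU = ∑ b ∈ below n disc par (i + 1) (ord i), up b ∧
    s.reg rD = ∑ b ∈ below n disc par (i + 1) (ord i), down b ∧
    s.reg rS = ((below n disc par (i + 1) (ord i)).filter fun b => b ∈ S).card

theorem sweepHead_eval {s : Store} (h1 : s.reg rOne = 1) (hord : s.arr aOrd = ord)
    (hpar : s.arr aPar = par) {i : ℕ} (hi : s.reg rI = i + 1) :
    (sweepHead.eval s).reg rI = i ∧ (sweepHead.eval s).reg rV = ord i ∧
    (sweepHead.eval s).reg rPar = par (ord i) ∧ (sweepHead.eval s).reg rU = s.arr aUp (ord i) ∧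
    (sweepHead.eval s).reg rD = s.arr aDown (ord i) ∧
    (sweepHead.eval s).reg rS = s.arr aBelow (ord i) := by
  simp [sweepHead, Prog.eval, h1, hord, hpar, hi]

theorem sweepTail_eval (s : Store) (h1 : s.reg rOne = 1) :
    (sweepTail.eval s).reg rS = s.reg rS + (1 - s.arr aDead (s.reg rV)) ∧
    (sweepTail.eval s).arr aBelow = Function.update (s.arr aBelow) (s.reg rPar)
      (s.arr aBelow (s.reg rPar) + (s.reg rS + (1 - s.arr aDead (s.reg rV)))) ∧
    (sweepTail.eval s).arr aUp = Function.update (s.arr aUp) (s.reg rPar)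
      (s.arr aUp (s.reg rPar) + s.reg rU) ∧
    (sweepTail.eval s).arr aDown = Function.update (s.arr aDown) (s.reg rPar)
      (s.arr aDown (s.reg rPar) + s.reg rD) := by
  simp [sweepTail, Prog.eval, h1]

theorem ncard_sdiff_insert {S : Finset ℕ} {v : ℕ} {X : Set ℕ} (hv : v ∈ S) (hvX : v ∉ X) :
    ((S : Set ℕ) \ insert v X).ncard = S.card - (X ∩ S).ncard - 1 := by
  have h1 : (S : Set ℕ) \ insert v X = (S : Set ℕ) \ insert v (X ∩ S) := by
    ext x
    simp only [Set.mem_sdiff, Set.mem_insert_iff, Set.mem_inter_iff]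
    tauto
  have h2 : (X ∩ S).Finite := S.finite_toSet.inter_of_right _
  rw [h1, Set.ncard_sdiff (Set.insert_subset hv Set.inter_subset_right) (h2.insert v),
    Set.ncard_coe_finset, Set.ncard_insert_of_notMem (fun h => hvX h.1) h2, Nat.sub_sub]

/-- All proper descendants of `w = ord i` have been tried, so the array entries at `w` are totals
over its subtree and decide whether `w` is suppressible. Thereafter they are merged into the entries
of the parent as in `below_pred`. -/
theorem SweepMem.step {i : ℕ} {s : Store}
    (h : SweepMem k G n M st g₀ ord disc par up down (i + 1) S s) (hi : 0 < i) {A₀ twin₀ : ℕ → ℕ}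
    (hG : G.Connected) (hO : IsOffsets n M st) (hA : AdjArrays {v | v < n} st A₀ g₀)
    (hT : IsDfsTree n st A₀ g₀ ord disc par jin own)
    (hL : IsLabelled n st A₀ g₀ disc par jin up down twin₀)
    (h1 : s.reg rOne = 1) (hk : s.reg rK = k) (hst : s.arr aStart = st) (hord : s.arr aOrd = ord)
    (hpar : s.arr aPar = par) :
    ∃ S', SweepMem k G n M st g₀ ord disc par up down i S' (sweepBody.eval s) := by
  have hin : i < n := h.le
  set w := ord i with hw
  have hwn : w < n := hT.ord_lt i hin
  have hdw : disc w = i + 1 := hT.disc_ord i hin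
  have hw0 : w ≠ 0 := hT.ne_zero_of_disc (by omega)
  have hpn := hT.par_lt w hwn hw0
  have hdp := hT.disc_par w hwn hw0
  have hwS : w ∈ S := h.mem w hwn hdw.le
  obtain ⟨a1, a2, a3, a4, a5, a6⟩ := sweepHead_eval h1 hord hpar h.reg_i
  have f1 := Prog.eval_frame (p := sweepHead) (by simp [sweepHead, Prog.LoopFree]) s
  set s₁ := sweepHead.eval s with hs₁
  have g1 : ∀ a, s₁.arr a = s.arr a := fun a => f1.2 a (by simp [sweepHead, Prog.arrs])
  have hrep : Represents k G n M st g₀ S s₁ := by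
    obtain ⟨⟨g, hg⟩, h5, h6⟩ := h.represents
    exact ⟨⟨g, by rw [g1, g1]; exact hg⟩, by rw [g1]; exact h5, (f1.1 _ (by decide)).trans h6⟩
  -- the vertex `w` is tried
  have hanc : ∀ b, b ∈ below n disc par (i + 1) w ↔ Anc disc par w b := fun b =>
    hT.mem_below_iff_anc hwn hdw.ge
  set X : Set ℕ := {b | Anc disc par w b ∧ b ≠ w} with hX
  have hXS : (X ∩ S).ncard = s.arr aBelow w := by
    rw [h.below_eq w hwn hdw.le, ← Set.ncard_coe_finset]
    congr 1
    ext b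
    simp only [hX, Set.mem_inter_iff, Set.mem_ofPred_eq, Finset.mem_coe, Finset.mem_filter, hanc]
    tauto
  have hwX : w ∉ X := fun h => h.2 rfl
  have hlt : (s₁.reg rU < s₁.reg rD + 2) ↔ ∑ a ∈ below n disc par (disc w) w, up a <
      ∑ a ∈ below n disc par (disc w) w, down a + 2 := by
    rw [a4, a5, h.up_eq w hwn hdw.le, h.down_eq w hwn hdw.le, hdw]
  obtain ⟨S', hS', hrep', hset⟩ := hrep.tryProg (X := X) hG hO ((f1.1 _ (by decide)).trans h1)
    ((f1.1 _ (by decide)).trans hk) ((g1 _).trans hst) (by rw [a2]; exact hwS)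
    (fun _ => ⟨by rw [a6, hXS], by rw [a2, ncard_sdiff_insert hwS hwX, hXS, hrep.live, a6]⟩)
    (by
      rw [a2, hlt]
      exact fun h3 h4 => hT.exists_splits_of_sum_lt hA hL hwn hw0 h4 h3)
    (by
      rw [a2, hlt]
      exact fun Y u₁ u₂ hY => ⟨hT.sum_lt_of_splits hA hL hY hw0, hA.block_of_splits hY⟩)
  rw [a2] at hS' hset
  have f2 := Prog.eval_frame (p := tryProg) (by simp [tryProg, suppressProg, Prog.LoopFree]) s₁
  set s₂ := tryProg.eval s₁ with hs₂
  have hSS : S' ⊆ S := by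
    rcases hS' with rfl | rfl
    exacts [subset_rfl, Finset.erase_subset _ _]
  have hrep'_lt : ∀ v ∈ S', v < n := by
    obtain ⟨⟨g, hg⟩, -⟩ := hrep'
    exact hg.subset
  have hmem' : ∀ b, b ≠ w → (b ∈ S' ↔ b ∈ S) := by
    intro b hb
    rcases hS' with rfl | rfl
    · rfl
    · exact ⟨Finset.mem_of_mem_erase, fun h => Finset.mem_erase.2 ⟨hb, h⟩⟩
  have b1 : s₂.reg rI = i := (f2.1 _ (by decide)).trans a1
  have b2 : s₂.reg rV = w := (f2.1 _ (by decide)).trans a2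
  have b3 : s₂.reg rPar = par w := (f2.1 _ (by decide)).trans a3
  have b4 : s₂.reg rU = s.arr aUp w := (f2.1 _ (by decide)).trans a4
  have b5 : s₂.reg rD = s.arr aDown w := (f2.1 _ (by decide)).trans a5
  have b6 : s₂.reg rS = s.arr aBelow w := (f2.1 _ (by decide)).trans a6
  have b7 : s₂.reg rOne = 1 := ((f2.1 _ (by decide)).trans (f1.1 _ (by decide))).trans h1
  have b8 : s₂.arr aUp = s.arr aUp := (f2.2 _ (by decide)).trans (g1 _)
  have b9 : s₂.arr aDown = s.arr aDown := (f2.2 _ (by decide)).trans (g1 _)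
  have b10 : s₂.arr aBelow = s.arr aBelow := (f2.2 _ (by decide)).trans (g1 _)
  obtain ⟨c1, c2, c3, c4⟩ := sweepTail_eval s₂ b7
  have f3 := Prog.eval_frame (p := sweepTail) (by simp [sweepTail, Prog.LoopFree]) s₂
  have hs₃ : sweepBody.eval s = sweepTail.eval s₂ := rfl
  rw [hs₃]
  set s₃ := sweepTail.eval s₂
  rw [b6, b2, hrep'.dead w hwn] at c1
  rw [b10, b3, b6, b2, hrep'.dead w hwn] at c2
  rw [b8, b3, b4] at c3
  rw [b9, b3, b5] at c4
  have hbelow := fun v => hT.below_pred hwn hdw hw0 (v := v)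
  have hdisj : ∀ v, disc v ≤ i → Disjoint (below n disc par (i + 1) v)
      (below n disc par (i + 1) w) := fun v hv =>
    IsDfsTree.below_disjoint (by omega) hdw.le fun he => by rw [he] at hv; omega
  have hsum : ∀ f F : ℕ → ℕ,
      (∀ v < n, disc v ≤ i + 1 → F v = ∑ b ∈ below n disc par (i + 1) v, f b) → ∀ v < n, disc v ≤ i →
      Function.update F (par w) (F (par w) + F w) v = ∑ b ∈ below n disc par i v, f b := by
    intro f F hF v hv hdv
    rw [hbelow]
    split_ifs with he
    · subst he
      rw [Function.update_self, Finset.sum_union (hdisj _ hdv), hF _ hpn (by omega),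
        hF w hwn hdw.le]
    · rw [Function.update_of_ne he, hF v hv (by omega)]
  -- The array entry leaves out `w` itself, which is counted now, provided that it has survived.
  have hcard : s.arr aBelow w + (1 - if w ∈ S' then 0 else 1) =
      ((below n disc par (i + 1) w).filter fun b => b ∈ S').card := by
    rw [h.below_eq w hwn hdw.le]
    have hins : ((below n disc par (i + 1) w).filter fun b => b ∈ S') =
        if w ∈ S' then insert w ((below n disc par (i + 1) w).filter fun b => b ∈ S ∧ b ≠ w)
        else (below n disc par (i + 1) w).filter fun b => b ∈ S ∧ b ≠ w := by
      have hself := below_self (disc := disc) (par := par) (i := i + 1) hwn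
      ext b
      by_cases hb : b = w
      · subst hb
        split_ifs with h3 <;> simp [h3, hself]
      · split_ifs with h3 <;> simp [hb, hmem' b hb]
    rw [hins]
    split_ifs with h3
    · rw [Finset.card_insert_of_notMem (by simp)]
    · rfl
  refine ⟨S', ?_, (f3.1 _ (by decide)).trans b1, hin.le, ?_, ?_, ?_, ?_, ?_, fun _ => ?_⟩
  · obtain ⟨⟨g, hg⟩, h5, h6⟩ := hrep'
    refine ⟨⟨g, ?_⟩, ?_, (f3.1 _ (by decide)).trans h6⟩
    · rw [f3.2 aAdj (by decide), f3.2 aTwin (by decide)]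
      exact hg
    · rw [f3.2 aDead (by decide)]
      exact h5
  · intro v hv hdv
    exact (hmem' v fun he => by rw [he] at hdv; omega).2 (h.mem v hv (by omega))
  · rw [c3]
    exact hsum up _ h.up_eq
  · rw [c4]
    exact hsum down _ h.down_eq
  · intro v hv hdv
    have hfil : (below n disc par (i + 1) v).filter (fun b => b ∈ S' ∧ b ≠ v) =
        (below n disc par (i + 1) v).filter fun b => b ∈ S ∧ b ≠ v := by
      refine Finset.filter_congr fun b hb => ?_
      rw [hmem' b]
      rintro rfl
      exact Finset.disjoint_left.1 (hdisj v hdv) hb (below_self hwn)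
    rw [c2, hcard, hbelow]
    split_ifs with he
    · subst he
      rw [Function.update_self, Finset.filter_union, Finset.card_union_of_disjoint, hfil,
        h.below_eq _ hpn (by omega)]
      · congr 2
        refine Finset.filter_congr fun b hb => ⟨fun h3 => ⟨h3, ?_⟩, fun h3 => h3.1⟩
        rintro rfl
        exact Finset.disjoint_left.1 (hdisj _ hdv) (below_self hpn) hb
      · exact Finset.disjoint_filter_filter (hdisj _ hdv)
    · rw [Function.update_of_ne he, hfil, h.below_eq v hv (by omega)]
  · intro v hv hdv
    by_cases he : v = w
    · rw [he] at hv ⊢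
      exact hset hv
    · have h3 : disc v ≠ i + 1 := fun h3 => he (hT.disc_inj (hrep'_lt v hv) hwn (h3.trans hdw.symm))
      exact (h.settled v (hSS hv) (by omega)).mono hSS
  · rw [f3.1 rU (by decide), f3.1 rD (by decide), b4, b5, c1, hcard]
    exact ⟨h.up_eq w hwn hdw.le, h.down_eq w hwn hdw.le, rfl⟩

/-- All vertices have been tried. -/
structure IsReduced {V : Type} (k : ℕ) (G : SimpleGraph V) (n M : ℕ) (st : ℕ → ℕ)
    (g₀ : SimpleGraph ℕ) (S : Finset ℕ) (s : Store) : Prop where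
  represents : Represents k G n M st g₀ S s
  settled : ∀ v ∈ S, Settled k g₀ S v

/-- The root is tested through the subtree of its child `ord 1`. If there is no other vertex, the
registers are meaningless, but then the root does not have degree two. -/
theorem SweepMem.isReduced {s : Store} (h : SweepMem k G n M st g₀ ord disc par up down 1 S s)
    {A₀ twin₀ : ℕ → ℕ} (hG : G.Connected) (hO : IsOffsets n M st)
    (hA : AdjArrays {v | v < n} st A₀ g₀) (hT : IsDfsTree n st A₀ g₀ ord disc par jin own)
    (hL : IsLabelled n st A₀ g₀ disc par jin up down twin₀)
    (h1 : s.reg rOne = 1) (hk : s.reg rK = k) (hst : s.arr aStart = st) :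
    ∃ S', IsReduced k G n M st g₀ S' ((Prog.const rV 0 ;; tryProg).eval s) := by
  have h0n : 0 < n := h.le
  set s₁ := s.setReg rV 0 with hs₁
  have hrep : Represents k G n M st g₀ S s₁ :=
    ⟨h.represents.exists_reduction, h.represents.dead, h.represents.live⟩
  have a2 : s₁.reg rV = 0 := by simp [hs₁]
  have hreg : ∀ x, x ≠ rV → s₁.reg x = s.reg x := fun x hx => by simp [hs₁, hx]
  have h0S : 0 ∈ S := h.mem 0 h0n hT.disc_root.le
  have hn1 : ∀ x, g₀.Adj 0 x → 1 < n := fun x hx => by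
    have h3 : x < n := hA.mem _ _ hx.symm
    have h4 := hx.ne
    omega
  have hn2 : st (0 + 1) = st 0 + 2 → 1 < n := fun h2 =>
    hn1 _ ((hA.adj_iff_of_block (v := 0) h0n h2 _).2 (Or.inl rfl))
  have hlt : 1 < n → ((s₁.reg rU < s₁.reg rD + 2) ↔
      ∑ a ∈ below n disc par (disc (ord 1)) (ord 1), up a <
      ∑ a ∈ below n disc par (disc (ord 1)) (ord 1), down a + 2) := fun hn => by
    obtain ⟨h3, h4, -⟩ := h.last hn
    rw [hreg _ (by decide), hreg _ (by decide), h3, h4, hT.disc_ord 1 hn]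
  obtain ⟨S', hS', hrep', hset⟩ := hrep.tryProg (X := {b | Anc disc par (ord 1) b}) hG hO
    ((hreg _ (by decide)).trans h1) ((hreg _ (by decide)).trans hk) hst (by rw [a2]; exact h0S)
    (by
      rw [a2]
      intro h2
      have hn := hn2 h2
      obtain ⟨h3, h4, h5⟩ := hT.par_ord_one hn
      have hS : s₁.reg rS = ({b | Anc disc par (ord 1) b} ∩ (S : Set ℕ)).ncard := by
        rw [hreg _ (by decide), (h.last hn).2.2, ← Set.ncard_coe_finset]
        congr 1
        ext b
        simp [hT.mem_below_iff_anc h3 (hT.disc_ord 1 hn).ge]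
      refine ⟨hS, ?_⟩
      rw [ncard_sdiff_insert h0S, hrep.live, hS]
      exact h5 ▸ hT.not_anc_par h3 h4)
    (by
      rw [a2]
      intro h3 h2
      have hn := hn2 h2
      obtain ⟨h4, h5, h6⟩ := hT.par_ord_one hn
      exact hT.exists_splits_root_of_sum_lt hA hL h4 h5 h6 h2 ((hlt hn).1 h3))
    (by
      rw [a2]
      intro Y u₁ u₂ hY
      have hn := hn1 _ hY.adj_left
      obtain ⟨h4, h5, h6⟩ := hT.par_ord_one hn
      exact ⟨(hlt hn).2 (hT.sum_lt_of_splits_root hA hL hY h4 h5 h6), hA.block_of_splits hY⟩)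
  rw [a2] at hS' hset
  have hSS : S' ⊆ S := by
    rcases hS' with rfl | rfl
    exacts [subset_rfl, Finset.erase_subset _ _]
  refine ⟨S', hrep', fun v hv => ?_⟩
  by_cases he : v = 0
  · rw [he] at hv ⊢
    exact hset hv
  · have hvn : v < n := by
      obtain ⟨⟨g, hg⟩, -⟩ := hrep'
      exact hg.subset v hv
    have h3 := hT.disc_pos v hvn
    have h4 : disc v ≠ 1 := fun h4 => he (hT.disc_inj hvn h0n (h4.trans hT.disc_root.symm))
    exact (h.settled v (hSS hv) (by omega)).mono hSS

theorem Reduction.initial {V : Type} {G : SimpleGraph V} {A : ℕ → ℕ} (e : G ≃g g₀.induce {v | v < n})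
    (hG : G.Connected) (hA : AdjArrays {v | v < n} st A g₀)
    (hT : IsDfsTree n st A g₀ ord disc par jin own)
    (hL : IsLabelled n st A g₀ disc par jin up down twin) :
    Reduction k G n M st g₀ A twin (Finset.range n) g₀ := by
  have hcoe : ((Finset.range n : Finset ℕ) : Set ℕ) = {v | v < n} := by ext; simp
  refine ⟨fun v => Finset.mem_range.1, ?_, ?_, ?_, fun v _ X u₁ u₂ h => ⟨_, _, h⟩,
    fun v X u₁ u₂ h => ⟨_, _, _, h⟩, fun v _ ⟨X, u₁, u₂, h⟩ j h1 h2 =>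
      hT.twin_of_splits hA hL h h1 h2⟩
  all_goals rw [hcoe]
  · exact hA
  · exact e.connected_iff.1 hG
  · exact .iso e

theorem sweepProg_spec {A : ℕ → ℕ} (hn : 0 < n) (e : G ≃g g₀.induce {v | v < n})
    (hG : G.Connected) (hO : IsOffsets n M st) (hA : AdjArrays {v | v < n} st A g₀)
    (hT : IsDfsTree n st A g₀ ord disc par jin own)
    (hL : IsLabelled n st A g₀ disc par jin up down twin) {s : Store} (hsn : s.reg rN = n)
    (hk : s.reg rK = k) (h0 : s.reg rZero = 0) (h1 : s.reg rOne = 1) (hst : s.arr aStart = st)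
    (hAdj : s.arr aAdj = A) (hord : s.arr aOrd = ord) (hpar : s.arr aPar = par)
    (hup : s.arr aUp = up) (hdown : s.arr aDown = down) (htwin : s.arr aTwin = twin)
    (hbelow : s.arr aBelow = fun _ => 0) (hdead : s.arr aDead = fun _ => 0) :
    HaltsWithin sweepProg s (50 * n + 40) fun s' => ∃ S, IsReduced k G n M st g₀ S s' := by
  have hinit : HaltsWithin (.add rI rN rZero ;; .add rLive rN rZero) s 2 fun s' =>
      SweepMem k G n M st g₀ ord disc par up down n (Finset.range n) s' := by
    -- No discovery number exceeds `n`, so no tree edge is admitted yet and all totals consist of a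
    -- single term.
    have hself : ∀ v < n, below n disc par n v = {v} := by
      intro v hv
      ext b
      rw [Finset.mem_singleton]
      refine ⟨fun hb => ?_, fun hb => by rw [hb]; exact below_self hv⟩
      by_contra hne
      have h3 := lt_disc_of_mem_below hb hne
      have h4 := hT.disc_le b (mem_below.1 hb).1
      omega
    refine HaltsWithin.of_loopFree (by simp [Prog.LoopFree]) ?_
    refine ⟨⟨⟨g₀, ?_⟩, fun v hv => ?_, ?_⟩, ?_, le_rfl, fun v hv _ => Finset.mem_range.2 hv,
      fun v hv _ => ?_, fun v hv _ => ?_, fun v hv _ => ?_, fun v hv h3 => ?_,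
      fun h => absurd h (lt_irrefl _)⟩
    · simpa [Prog.eval, hAdj, htwin] using Reduction.initial e hG hA hT hL
    · simp [Prog.eval, hdead, hv]
    · simp [Prog.eval, hsn, h0]
    · simp [Prog.eval, hsn, h0]
    · simp [Prog.eval, hup, hself v hv]
    · simp [Prog.eval, hdown, hself v hv]
    · simp [Prog.eval, hbelow, hself v hv, Finset.filter_singleton]
    · have := hT.disc_le v (Finset.mem_range.1 hv)
      omega
  refine ((hinit.frame).seq (T₂ := (n - 1) * (sweepBody.cost + 1) + 1 + (Prog.const rV 0 ;; tryProg).cost)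
    fun s₁ hs₁ => ?_).mono ?_ fun _ h => h
  · obtain ⟨hI, hf⟩ := hs₁
    have f0 : ∀ a, s₁.arr a = s.arr a := fun a => hf.2 a (by simp [Prog.arrs])
    refine (HaltsWithin.while (by simp [sweepBody, sweepHead, tryProg, suppressProg, sweepTail, Prog.LoopFree])
      (fun m s' => ∃ S, SweepMem k G n M st g₀ ord disc par up down (m + 1) S s')
      (m := n - 1) ?_ ?_).frame.seq fun s₂ hs₂ => ?_
    · rintro m s' ⟨S, hS⟩ hf' hlt
      have e1 : s'.reg rOne = 1 := ((hf'.1 _ (by decide)).trans (hf.1 _ (by decide))).trans h1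
      rw [e1, hS.reg_i] at hlt
      obtain ⟨m', rfl⟩ : ∃ m', m = m' + 1 := ⟨m - 1, by omega⟩
      exact ⟨m', by omega, hS.step (by omega) hG hO hA hT hL e1
        (((hf'.1 _ (by decide)).trans (hf.1 _ (by decide))).trans hk)
        (((hf'.2 _ (by decide)).trans (f0 _)).trans hst)
        (((hf'.2 _ (by decide)).trans (f0 _)).trans hord)
        (((hf'.2 _ (by decide)).trans (f0 _)).trans hpar)⟩
    · exact ⟨_, by rwa [Nat.sub_add_cancel hn]⟩
    · obtain ⟨⟨⟨m, S, hS⟩, hge⟩, hf'⟩ := hs₂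
      have e1 : s₂.reg rOne = 1 := ((hf'.1 _ (by decide)).trans (hf.1 _ (by decide))).trans h1
      rw [e1, hS.reg_i] at hge
      obtain rfl : m = 0 := by omega
      exact HaltsWithin.of_loopFree (by simp [tryProg, suppressProg, Prog.LoopFree])
        (hS.isReduced hG hO hA hT hL e1
          (((hf'.1 _ (by decide)).trans (hf.1 _ (by decide))).trans hk)
          (((hf'.2 _ (by decide)).trans (f0 _)).trans hst))
  · simp [sweepBody, sweepHead, tryProg, suppressProg, sweepTail, Prog.cost]
    omega

end Sweep


/-! ### Writing down the remaining graph -/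

notation "aNew" => (13 : ℕ)
notation "rOutN" => (32 : ℕ)
notation "rOutK" => (33 : ℕ)
notation "aOutStart" => (32 : ℕ)
notation "aOutAdj" => (33 : ℕ)

section Output

/-- `rU` counts the survivors and `rD` the total length of their blocks. The end of the block is
added before its start is subtracted, so nothing is truncated. -/
def relabelBody : Prog :=
  .load rTmp aDead rI ;; .ite rTmp rOne
    (.store aNew rI rU ;; .store aOutStart rU rD ;; .add rU rU rOne ;; .add rAux rI rOne ;;
      .load rTmp aStart rAux ;; .add rD rD rTmp ;; .load rTmp aStart rI ;; .sub rD rD rTmp)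
    (.const rTmp 0) ;; .add rI rI rOne

/-- Numbers the remaining vertices and computes the starting positions of their lists. -/
def relabelProg : Prog :=
  (.const rI 0 ;; .const rU 0 ;; .const rD 0) ;; .while rI rN relabelBody ;;
    .store aOutStart rU rD

def copyBody : Prog :=
  .load rTmp aOwn rPos ;; .load rTmp aDead rTmp ;; .ite rTmp rOne
    (.load rTmp aAdj rPos ;; .load rTmp aNew rTmp ;; .store aOutAdj rD rTmp ;; .add rD rD rOne)
    (.const rTmp 0) ;; .add rPos rPos rOne

/-- Writes the lists of the remaining vertices. -/
def copyProg : Prog :=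
  (.const rPos 0 ;; .const rD 0 ;; .load rEnd aStart rN) ;; .while rPos rEnd copyBody ;;
    .add rOutN rU rZero ;; .add rOutK rK rZero

/-- The elements of `S` below `n`. -/
def remaining (S : Finset ℕ) (n : ℕ) : List ℕ := (List.range n).filter (· ∈ S)

theorem remaining_succ (S : Finset ℕ) (n : ℕ) :
    remaining S (n + 1) = remaining S n ++ if n ∈ S then [n] else [] := by
  simp only [remaining, List.range_succ, List.filter_append]
  split_ifs with h <;> simp [h]

theorem mem_remaining {S : Finset ℕ} {n v : ℕ} : v ∈ remaining S n ↔ v < n ∧ v ∈ S := by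
  simp [remaining]

theorem nodup_remaining (S : Finset ℕ) (n : ℕ) : (remaining S n).Nodup :=
  List.nodup_range.filter _

/-- The total length of the blocks of the vertices in a list. -/
def totalLength (st : ℕ → ℕ) (l : List ℕ) : ℕ := (l.map fun v => st (v + 1) - st v).sum

/-- With default value `0`, writing the cell right behind the end of a list appends to it. -/
theorem update_getD (l : List ℕ) (x : ℕ) :
    Function.update (fun i => l.getD i 0) l.length x = fun i => (l ++ [x]).getD i 0 := by
  funext i
  rw [Function.update_apply]
  split_ifs with h
  · simp [h]
  · rcases Nat.lt_or_gt_of_ne h with h | h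
    · simp [List.getD_eq_getElem?_getD, List.getElem?_append_left h]
    · simp [List.getD_eq_getElem?_getD, List.getElem?_eq_none h.le,
        List.getElem?_append_right h.le, Nat.sub_ne_zero_of_lt h]

variable {n M : ℕ} {st A own : ℕ → ℕ} {S : Finset ℕ} {k : ℕ}

/-- The memory when the vertices below `j` have been numbered. -/
structure RelabelMem (st : ℕ → ℕ) (S : Finset ℕ) (j : ℕ) (s : Store) : Prop where
  reg_i : s.reg rI = j
  count : s.reg rU = (remaining S j).length
  pos : s.reg rD = totalLength st (remaining S j)
  new : ∀ v ∈ remaining S j, (remaining S j)[s.arr aNew v]? = some v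
  start : s.arr aOutStart = fun i =>
    if i < (remaining S j).length then totalLength st ((remaining S j).take i) else 0

theorem RelabelMem.step {j : ℕ} {s : Store} (h : RelabelMem st S j s)
    (hst : s.arr aStart = st) (hone : s.reg rOne = 1)
    (hdead : s.arr aDead j = if j ∈ S then 0 else 1) (hmono : st j ≤ st (j + 1)) :
    RelabelMem st S (j + 1) (relabelBody.eval s) := by
  obtain ⟨h1, h2, h3, h4, h5⟩ := h
  by_cases hj : j ∈ S
  · rw [if_pos hj] at hdead
    have hs := remaining_succ S j
    rw [if_pos hj] at hs
    have hself : ∀ v ∈ remaining S j, v ≠ j := fun v hv => by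
      have := (mem_remaining.1 hv).1
      omega
    refine ⟨?_, ?_, ?_, fun v hv => ?_, ?_⟩
    · simp [relabelBody, Prog.eval, hone, hdead, h1]
    · simp [relabelBody, Prog.eval, hone, hdead, h1, hs, h2]
    · simp [relabelBody, Prog.eval, hone, hdead, h1, hs, h3, totalLength, hst]
      omega
    · rw [hs] at hv ⊢
      rcases List.mem_append.1 hv with hv | hv
      · have h6 := h4 v hv
        simp only [relabelBody, Prog.eval, hone, hdead, h1, h2, hst, Store.setArr_arr,
          Store.setReg_reg, Store.setReg_arr, Store.setArr_reg]
        simp [Function.update_of_ne (hself v hv)]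
        rw [List.getElem?_append_left (List.getElem?_eq_some_iff.1 h6).1, h6]
      · obtain rfl := List.mem_singleton.1 hv
        simp [relabelBody, Prog.eval, hone, hdead, h1, h2]
    · have e : (relabelBody.eval s).arr aOutStart =
          Function.update (s.arr aOutStart) (s.reg rU) (s.reg rD) := by
        simp [relabelBody, Prog.eval, hone, hdead, h1]
      rw [e, hs, h2, h3, h5]
      funext i
      rw [Function.update_apply, List.length_append, List.length_singleton]
      split_ifs with h6 h7 h7 h8 h9 <;> try omega
      · rw [h6, List.take_left]
      · rw [List.take_append_of_le_length h7.le]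
  · rw [if_neg hj] at hdead
    have hs := remaining_succ S j
    rw [if_neg hj, List.append_nil] at hs
    refine ⟨?_, ?_, ?_, ?_, ?_⟩
    · simp [relabelBody, Prog.eval, hone, hdead, h1]
    all_goals
      rw [hs]
      simpa [relabelBody, Prog.eval, hone, hdead, h1]

theorem relabelProg_spec (hO : IsOffsets n M st) {s : Store} (hsn : s.reg rN = n)
    (hone : s.reg rOne = 1) (hst : s.arr aStart = st)
    (hdead : ∀ v < n, s.arr aDead v = if v ∈ S then 0 else 1)
    (hout : s.arr aOutStart = fun _ => 0) :
    HaltsWithin relabelProg s (15 * n + 10) fun s' =>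
      s'.reg rU = (remaining S n).length ∧
      (∀ v ∈ remaining S n, (remaining S n)[s'.arr aNew v]? = some v) ∧
      s'.arr aOutStart = fun i =>
        if i ≤ (remaining S n).length then totalLength st ((remaining S n).take i) else 0 := by
  have hinit : HaltsWithin (.const rI 0 ;; .const rU 0 ;; .const rD 0) s 3 (RelabelMem st S 0) := by
    refine HaltsWithin.of_loopFree (by simp [Prog.LoopFree]) ⟨?_, ?_, ?_, ?_, ?_⟩ <;>
      simp [Prog.eval, remaining, totalLength, hout]
  refine (hinit.frame.seq (T₂ := n * (relabelBody.cost + 1) + 1 + 1) fun s₁ hs₁ => ?_).mono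
    (by simp [relabelBody, Prog.cost]; omega) fun _ h => h
  obtain ⟨hI, hf⟩ := hs₁
  refine (HaltsWithin.while (by simp [relabelBody, Prog.LoopFree])
    (fun m s' => ∃ j, j + m = n ∧ RelabelMem st S j s') (m := n) ?_ ⟨0, by omega, hI⟩).frame.seq
    fun s₂ hs₂ => ?_
  · rintro m s' ⟨j, hj, hS⟩ hf' hlt
    have e0 : s'.reg rN = n := ((hf'.1 _ (by decide)).trans (hf.1 _ (by decide))).trans hsn
    rw [e0, hS.reg_i] at hlt
    refine ⟨m - 1, by omega, j + 1, by omega, hS.step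
      (((hf'.2 _ (by decide)).trans (hf.2 _ (by decide))).trans hst)
      (((hf'.1 _ (by decide)).trans (hf.1 _ (by decide))).trans hone) ?_ (hO.mono j hlt)⟩
    rw [hf'.2 _ (by decide), hf.2 _ (by decide)]
    exact hdead j hlt
  · obtain ⟨⟨⟨m, j, hj, hS⟩, hge⟩, hf'⟩ := hs₂
    have e0 : s₂.reg rN = n := ((hf'.1 _ (by decide)).trans (hf.1 _ (by decide))).trans hsn
    rw [e0, hS.reg_i] at hge
    obtain rfl : j = n := by omega
    refine HaltsWithin.of_loopFree (by trivial) ⟨?_, ?_, ?_⟩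
    · simpa [Prog.eval] using hS.count
    · simpa [Prog.eval] using hS.new
    · simp only [Prog.eval, Store.setArr_arr, if_true, hS.count, hS.pos, hS.start]
      funext i
      rw [Function.update_apply]
      split_ifs with h6 h7 h7 h8 h9 <;> try omega
      · rw [h6, List.take_length]

/-- The positions below `j` that belong to vertices in `S`. -/
def remainingPos (own : ℕ → ℕ) (S : Finset ℕ) (j : ℕ) : List ℕ :=
  (List.range j).filter fun i => own i ∈ S

theorem remainingPos_succ (own : ℕ → ℕ) (S : Finset ℕ) (j : ℕ) :
    remainingPos own S (j + 1) = remainingPos own S j ++ if own j ∈ S then [j] else [] := by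
  simp only [remainingPos, List.range_succ, List.filter_append]
  split_ifs with h <;> simp [h]

/-- The memory when the positions below `j` have been copied. -/
structure CopyMem (A own new : ℕ → ℕ) (S : Finset ℕ) (j : ℕ) (s : Store) : Prop where
  reg_pos : s.reg rPos = j
  pos : s.reg rD = (remainingPos own S j).length
  out : s.arr aOutAdj = fun i => ((remainingPos own S j).map fun i => new (A i)).getD i 0

theorem CopyMem.step {new : ℕ → ℕ} {j : ℕ} {s : Store} (h : CopyMem A own new S j s)
    (hone : s.reg rOne = 1) (hA : s.arr aAdj = A) (hown : s.arr aOwn = own)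
    (hnew : s.arr aNew = new) (hdead : s.arr aDead (own j) = if own j ∈ S then 0 else 1) :
    CopyMem A own new S (j + 1) (copyBody.eval s) := by
  obtain ⟨h1, h2, h3⟩ := h
  have hs := remainingPos_succ own S j
  by_cases hj : own j ∈ S
  · rw [if_pos hj] at hdead hs
    refine ⟨?_, ?_, ?_⟩
    · simp [copyBody, Prog.eval, hone, hown, hdead, h1]
    · simp [copyBody, Prog.eval, hone, hown, hdead, h1, hs, h2]
    · have e : (copyBody.eval s).arr aOutAdj =
          Function.update (s.arr aOutAdj) (s.reg rD) (new (A j)) := by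
        simp [copyBody, Prog.eval, hone, hown, hdead, h1, hA, hnew]
      rw [e, h3, h2, hs, List.map_append, List.map_singleton, ← update_getD, List.length_map]
  · rw [if_neg hj] at hdead hs
    rw [List.append_nil] at hs
    refine ⟨?_, ?_, ?_⟩
    · simp [copyBody, Prog.eval, hone, hown, hdead, h1]
    · simp [copyBody, Prog.eval, hone, hown, hdead, h1, hs, h2]
    · have e : (copyBody.eval s).arr aOutAdj = s.arr aOutAdj := by
        simp [copyBody, Prog.eval, hone, hown, hdead, h1]
      rw [e, h3, hs]

theorem copyProg_spec (hO : IsOffsets n M st) {s : Store} (hsn : s.reg rN = n)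
    (hk : s.reg rK = k) (hzero : s.reg rZero = 0) (hone : s.reg rOne = 1)
    (hst : s.arr aStart = st) (hA : s.arr aAdj = A) (hown : s.arr aOwn = own)
    (hlt : ∀ j < M, own j < n)
    (hdead : ∀ v < n, s.arr aDead v = if v ∈ S then 0 else 1)
    (hout : s.arr aOutAdj = fun _ => 0) :
    HaltsWithin copyProg s (15 * M + 10) fun s' =>
      s'.reg rOutN = s.reg rU ∧ s'.reg rOutK = k ∧
      s'.arr aOutAdj = fun i =>
        ((remainingPos own S M).map fun i => s.arr aNew (A i)).getD i 0 := by
  have hinit : HaltsWithin (.const rPos 0 ;; .const rD 0 ;; .load rEnd aStart rN) s 3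
      fun s' => CopyMem A own (s.arr aNew) S 0 s' ∧ s'.reg rEnd = M := by
    refine HaltsWithin.of_loopFree (by simp [Prog.LoopFree]) ⟨⟨?_, ?_, ?_⟩, ?_⟩ <;>
      simp [Prog.eval, remainingPos, hout, hst, hsn, hO.last]
  refine (hinit.frame.seq (T₂ := M * (copyBody.cost + 1) + 1 + 2) fun s₁ hs₁ => ?_).mono
    (by simp [copyBody, Prog.cost]; omega) fun _ h => h
  obtain ⟨⟨hI, hM⟩, hf⟩ := hs₁
  refine (HaltsWithin.while (by simp [copyBody, Prog.LoopFree])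
    (fun m s' => ∃ j, j + m = M ∧ CopyMem A own (s.arr aNew) S j s') (m := M) ?_
    ⟨0, by omega, hI⟩).frame.seq fun s₂ hs₂ => ?_
  · rintro m s' ⟨j, hj, hS⟩ hf' hlt'
    have e0 : s'.reg rEnd = M := (hf'.1 _ (by decide)).trans hM
    rw [e0, hS.reg_pos] at hlt'
    refine ⟨m - 1, by omega, j + 1, by omega, hS.step
      (((hf'.1 _ (by decide)).trans (hf.1 _ (by decide))).trans hone)
      (((hf'.2 _ (by decide)).trans (hf.2 _ (by decide))).trans hA)
      (((hf'.2 _ (by decide)).trans (hf.2 _ (by decide))).trans hown)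
      ((hf'.2 _ (by decide)).trans (hf.2 _ (by decide))) ?_⟩
    rw [hf'.2 _ (by decide), hf.2 _ (by decide)]
    exact hdead _ (hlt j hlt')
  · obtain ⟨⟨⟨m, j, hj, hS⟩, hge⟩, hf'⟩ := hs₂
    have e0 : s₂.reg rEnd = M := (hf'.1 _ (by decide)).trans hM
    have e1 : s₂.reg rU = s.reg rU := (hf'.1 _ (by decide)).trans (hf.1 _ (by decide))
    have e2 : s₂.reg rZero = 0 := ((hf'.1 _ (by decide)).trans (hf.1 _ (by decide))).trans hzero
    have e3 : s₂.reg rK = k := ((hf'.1 _ (by decide)).trans (hf.1 _ (by decide))).trans hk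
    rw [e0, hS.reg_pos] at hge
    obtain rfl : j = M := by omega
    refine HaltsWithin.of_loopFree (by simp [Prog.LoopFree]) ⟨?_, ?_, ?_⟩
    · simp [Prog.eval, e1, e2]
    · simp [Prog.eval, e2, e3]
    · simpa [Prog.eval] using hS.out

/-- Blocks are consecutive and ordered by their owners, so scanning all positions once yields the
blocks of the survivors one after another. -/
theorem remainingPos_eq_flatMap (hO : IsOffsets n M st)
    (hown : ∀ v < n, ∀ j, st v ≤ j → j < st (v + 1) → own j = v) {v : ℕ} (hv : v ≤ n) :
    remainingPos own S (st v) =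
      (remaining S v).flatMap fun u => List.range' (st u) (st (u + 1) - st u) := by
  induction v with
  | zero => simp [hO.zero, remainingPos, remaining]
  | succ v ih =>
    have hr : List.range (st (v + 1)) =
        List.range (st v) ++ List.range' (st v) (st (v + 1) - st v) := by
      have h := List.range'_append_1 (s := 0) (m := st v) (n := st (v + 1) - st v)
      rw [Nat.zero_add, Nat.add_sub_cancel' (hO.mono v hv)] at h
      rw [List.range_eq_range', List.range_eq_range', h]
    have hmem : ∀ j ∈ List.range' (st v) (st (v + 1) - st v), own j = v := by
      intro j hj
      rw [List.mem_range'_1] at hj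
      exact hown v hv j hj.1 (by omega)
    rw [remaining_succ, List.flatMap_append, ← ih (Nat.le_of_succ_le hv), remainingPos, hr,
      List.filter_append, ← remainingPos]
    congr 1
    split_ifs with h
    · rw [List.filter_eq_self.2 fun j hj => by simpa [hmem j hj] using h]
      simp
    · rw [List.filter_eq_nil_iff.2 fun j hj => by simpa [hmem j hj] using h]
      simp

/-- The remaining graph and its adjacency lists, on the vertices renamed to `0, 1, …`. -/
theorem exists_renamed_graph {g : SimpleGraph ℕ} (hO : IsOffsets n M st)
    (hown : ∀ v < n, ∀ j, st v ≤ j → j < st (v + 1) → own j = v) (hS : ∀ v ∈ S, v < n)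
    (hA : AdjArrays (S : Set ℕ) st A g) {new : ℕ → ℕ}
    (hnew : ∀ v ∈ remaining S n, (remaining S n)[new v]? = some v) :
    ∃ (H : SimpleGraph (Fin (remaining S n).length))
      (L : Fin (remaining S n).length → List (Fin (remaining S n).length)),
      IsAdjLists L H ∧ Nonempty (g.induce (S : Set ℕ) ≃g H) ∧
      (∀ i, listStart L i = totalLength st ((remaining S n).take i)) ∧
      concatLists L = (remainingPos own S M).map fun i => new (A i) := by
  have hmem : ∀ {v}, v ∈ remaining S n ↔ v ∈ S :=
    fun {v} => mem_remaining.trans ⟨fun h => h.2, fun h => ⟨hS v h, h⟩⟩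
  set l := remaining S n with hl
  have hget : ∀ c : Fin l.length, l.get c ∈ S := fun c => hmem.1 (l.get_mem c)
  have hlt : ∀ v ∈ l, new v < l.length := fun v hv => (List.getElem?_eq_some_iff.1 (hnew v hv)).1
  have hgn : ∀ v (hv : v ∈ l), l.get ⟨new v, hlt v hv⟩ = v := fun v hv =>
    (List.getElem?_eq_some_iff.1 (hnew v hv)).2
  have hng : ∀ c : Fin l.length, new (l.get c) = c := fun c => by
    have h := hgn _ (l.get_mem c)
    have := (List.nodup_iff_injective_get.1 (nodup_remaining S n)) h
    exact congrArg Fin.val this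
  -- the targets of the edges
  have htgt : ∀ v ∈ l, ∀ j ∈ List.range' (st v) (st (v + 1) - st v), A j ∈ l := by
    intro v hv j hj
    rw [List.mem_range'_1] at hj
    exact hmem.2 (hA.mem _ _ ((hA.adj v (hmem.1 hv) _).2 ⟨j, hj.1, by omega, rfl⟩).symm)
  -- The list of `v` with renamed targets, which are survivors by `htgt`.
  let F : ∀ v, v ∈ l → List (Fin l.length) := fun v hv =>
    (List.range' (st v) (st (v + 1) - st v)).pmap (fun j hj => ⟨new (A j), hlt _ hj⟩) (htgt v hv)
  let L : Fin l.length → List (Fin l.length) := fun c => F (l.get c) (l.get_mem c)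
  have hofFn : List.ofFn L = l.pmap F fun _ h => h := by
    refine List.ext_getElem (by simp) fun i h1 h2 => ?_
    simp [L]
  have hFlen : ∀ v hv, (F v hv).length = st (v + 1) - st v := fun v hv => by simp [F]
  have hFval : ∀ v hv, (F v hv).map Fin.val =
      (List.range' (st v) (st (v + 1) - st v)).map fun j => new (A j) := fun v hv => by
    simp [F, List.map_pmap]
  refine ⟨g.comap fun c => l.get c, L, fun c => ⟨?_, fun d => ?_⟩, ⟨?_⟩, fun i => ?_, ?_⟩
  · refine List.Nodup.of_map Fin.val ?_
    rw [hFval _ (l.get_mem c)]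
    refine List.Nodup.map_on (fun i hi j hj hij => ?_) List.nodup_range'
    have hi' := htgt _ (l.get_mem c) i hi
    have hj' := htgt _ (l.get_mem c) j hj
    have hAij : A i = A j := by
      have h := hnew _ hi'
      rw [hij, hnew _ hj'] at h
      exact (Option.some.inj h).symm
    rw [List.mem_range'_1] at hi hj
    exact hA.inj _ (hget c) i j hi.1 (by omega) hj.1 (by omega) hAij
  · simp only [L, F, List.mem_pmap, SimpleGraph.comap_adj]
    rw [hA.adj _ (hget c)]
    constructor
    · rintro ⟨j, hj, rfl⟩
      rw [hgn _ (htgt _ (l.get_mem c) j hj)]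
      rw [List.mem_range'_1] at hj
      exact ⟨j, hj.1, by omega, rfl⟩
    · rintro ⟨j, h1, h2, h3⟩
      exact ⟨j, List.mem_range'_1.2 ⟨h1, by omega⟩, Fin.ext (by rw [← hng d, ← h3])⟩
  · refine ⟨(((List.Nodup.getEquiv l (nodup_remaining S n)).trans
      (Equiv.subtypeEquivRight fun v => hmem)).symm : (S : Set ℕ) ≃ _), ?_⟩
    intro a b
    simp [SimpleGraph.comap_adj]
  · rw [listStart, hofFn, totalLength, List.length_flatten, List.map_take, List.map_take]
    congr 2
    exact List.ext_getElem (by simp) fun i h1 h2 => by simp [hFlen]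
  · rw [concatLists, hofFn, ← hO.last, remainingPos_eq_flatMap hO hown le_rfl, List.map_flatten,
      List.map_flatMap, List.flatMap_def, List.map_pmap, ← hl]
    congr 1
    exact List.ext_getElem (by simp) fun i h1 h2 => by simp [hFval]

end Output


/-! ### Reading adjacency lists -/

section Input

variable {n : ℕ} {L : Fin n → List (Fin n)} {G : SimpleGraph (Fin n)}

theorem ofFn_eq_append (L : Fin n → List (Fin n)) (v : Fin n) :
    List.ofFn L = (List.ofFn L).take v ++ L v :: (List.ofFn L).drop (v + 1) := by
  conv_lhs => rw [← List.take_append_drop v (List.ofFn L)]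
  rw [List.drop_eq_getElem_cons (by simp)]
  simp

theorem listStart_zero (L : Fin n → List (Fin n)) : listStart L 0 = 0 := by simp [listStart]

theorem listStart_succ (L : Fin n → List (Fin n)) (v : Fin n) :
    listStart L (v + 1) = listStart L v + (L v).length := by
  rw [listStart, List.take_add_one, List.getElem?_eq_getElem (by simp)]
  simp [listStart]

theorem length_concatLists (L : Fin n → List (Fin n)) :
    (concatLists L).length = listStart L n := by
  rw [concatLists, listStart, List.take_of_length_le (by simp), List.length_map]

theorem concatLists_getD (L : Fin n → List (Fin n)) (v : Fin n) {i : ℕ} (hi : i < (L v).length) :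
    (concatLists L).getD (listStart L v + i) 0 = (L v)[i] := by
  have h : concatLists L = ((List.ofFn L).take v).flatten.map Fin.val ++ ((L v).map Fin.val ++
      ((List.ofFn L).drop (v + 1)).flatten.map Fin.val) := by
    rw [concatLists]
    conv_lhs => rw [ofFn_eq_append L v]
    simp
  have hlen : (((List.ofFn L).take v).flatten.map Fin.val).length = listStart L v := by
    rw [List.length_map, listStart]
  rw [h, List.getD_append_right _ _ _ _ (by rw [hlen]; exact Nat.le_add_right _ _), hlen,
    Nat.add_sub_cancel_left, List.getD_append _ _ _ _ (by simpa using hi)]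
  simp [List.getD_eq_getElem?_getD, hi]

theorem inputStore_start (k : ℕ) (L : Fin n → List (Fin n)) {i : ℕ} (hi : i ≤ n) :
    (inputStore k L).arr aStart i = listStart L i := by
  simp [inputStore, hi]

theorem isOffsets_inputStore (k : ℕ) (L : Fin n → List (Fin n)) :
    IsOffsets n (listStart L n) ((inputStore k L).arr aStart) := by
  refine ⟨?_, ?_, fun v hv => ?_⟩
  · rw [inputStore_start k L (Nat.zero_le n), listStart_zero]
  · rw [inputStore_start k L le_rfl]
  · rw [inputStore_start k L hv.le, inputStore_start k L hv, listStart_succ L ⟨v, hv⟩]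
    exact Nat.le_add_right _ _

theorem inputStore_adj (k : ℕ) (L : Fin n → List (Fin n)) (v : Fin n) {j : ℕ}
    (h1 : (inputStore k L).arr aStart v ≤ j) (h2 : j < (inputStore k L).arr aStart (v + 1)) :
    ∃ i, ∃ hi : i < (L v).length, j = listStart L v + i ∧
      (inputStore k L).arr aAdj j = ((L v)[i] : ℕ) := by
  rw [inputStore_start k L v.2.le] at h1
  rw [inputStore_start k L v.2, listStart_succ] at h2
  obtain ⟨i, rfl⟩ := Nat.exists_eq_add_of_le h1
  have hi : i < (L v).length := by omega
  exact ⟨i, hi, rfl, concatLists_getD L v hi⟩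

theorem adjArrays_inputStore (k : ℕ) (hL : IsAdjLists L G) :
    AdjArrays {v | v < n} ((inputStore k L).arr aStart) ((inputStore k L).arr aAdj)
      (G.map Fin.valEmbedding) := by
  refine ⟨fun v hv i j h1 h2 h3 h4 hij => ?_, fun v hv w => ?_, fun v w h => ?_⟩
  · obtain ⟨i', hi', rfl, h5⟩ := inputStore_adj k L ⟨v, hv⟩ h1 h2
    obtain ⟨j', hj', rfl, h6⟩ := inputStore_adj k L ⟨v, hv⟩ h3 h4
    rw [h5, h6] at hij
    rw [((hL ⟨v, hv⟩).1.getElem_inj_iff).1 (Fin.ext hij)]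
  · rw [SimpleGraph.map_adj]
    constructor
    · rintro ⟨a, b, hab, ha, rfl⟩
      obtain rfl : a = ⟨v, hv⟩ := Fin.ext ha
      obtain ⟨i, hi, rfl⟩ := List.getElem_of_mem (((hL _).2 b).2 hab)
      refine ⟨listStart L v + i, ?_, ?_, concatLists_getD L _ hi⟩
      · rw [inputStore_start k L (le_of_lt hv)]
        exact Nat.le_add_right _ _
      · rw [inputStore_start k L hv, listStart_succ L ⟨v, hv⟩]
        exact Nat.add_lt_add_left hi _
    · rintro ⟨j, h1, h2, rfl⟩
      obtain ⟨i, hi, rfl, h5⟩ := inputStore_adj k L ⟨v, hv⟩ h1 h2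
      exact ⟨⟨v, hv⟩, (L ⟨v, hv⟩)[i], ((hL _).2 _).1 (List.getElem_mem hi), rfl, h5.symm⟩
  · rw [SimpleGraph.map_adj] at h
    obtain ⟨a, b, -, rfl, -⟩ := h
    exact a.2

theorem nonempty_iso_induce_map (G : SimpleGraph (Fin n)) :
    Nonempty (G ≃g (G.map Fin.valEmbedding).induce {v | v < n}) := by
  refine ⟨⟨⟨fun v => ⟨v, v.2⟩, fun v => ⟨v, v.2⟩, fun _ => rfl, fun _ => rfl⟩, ?_⟩⟩
  intro a b
  exact SimpleGraph.map_adj_apply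

/-- The handshake lemma for adjacency lists. -/
theorem listStart_eq_two_mul (hL : IsAdjLists L G) :
    listStart L n = 2 * G.edgeSet.ncard := by
  classical
  have h1 : listStart L n = ∑ v, G.degree v := by
    rw [← length_concatLists, concatLists, List.length_map, List.length_flatten, List.map_ofFn,
      List.sum_ofFn]
    refine Finset.sum_congr rfl fun v _ => ?_
    rw [← SimpleGraph.card_neighborFinset_eq_degree]
    have : G.neighborFinset v = (L v).toFinset := by
      ext w
      simp [(hL v).2 w]
    rw [this, List.toFinset_card_of_nodup (hL v).1]
    rfl
  rw [h1, SimpleGraph.sum_degrees_eq_twice_card_edges, Set.ncard_eq_toFinset_card']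
  simp [SimpleGraph.edgeFinset]

end Input


/-! ### The reduction -/

section Core

/-- Computes a reduced graph in the registers and arrays from `32` on. -/
def coreProg : Prog := dfsProg ;; labelProg ;; sweepProg ;; relabelProg ;; copyProg

/-- The registers and arrays from `32` on hold exactly the instance `(L, k)`. -/
structure HoldsShifted {n : ℕ} (s : Store) (k : ℕ) (L : Fin n → List (Fin n)) : Prop where
  reg_eq : ∀ x, s.reg (x + 32) = (inputStore k L).reg x
  arr_eq : ∀ a, s.arr (a + 32) = (inputStore k L).arr a

/-- The result of the reduction. -/
structure IsReduction {n n' : ℕ} (k : ℕ) (G : SimpleGraph (Fin n)) (H : SimpleGraph (Fin n'))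
    (L : Fin n' → List (Fin n')) (s : Store) : Prop where
  adjLists : IsAdjLists L H
  reducesTo : ReducesTo k G H
  not_isSuppressible : ∀ v, ¬ IsSuppressible H k v
  holds : HoldsShifted s k L
  card_le : n' ≤ n
  length_le : listStart L n' ≤ 2 * G.edgeSet.ncard
  reg_k : s.reg rK = k
  reg_zero : s.reg rZero = 0
  reg_one : s.reg rOne = 1

theorem coreProg_spec {n : ℕ} (k : ℕ) {G : SimpleGraph (Fin n)} {L : Fin n → List (Fin n)}
    (hG : G.Connected) (hL : IsAdjLists L G) :
    HaltsWithin coreProg (inputStore k L) (200 * (n + G.edgeSet.ncard)) fun s =>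
      ∃ (n' : ℕ) (H : SimpleGraph (Fin n')) (L' : Fin n' → List (Fin n')),
        IsReduction k G H L' s := by
  have hn : 0 < n := Fin.pos_iff_nonempty.2 hG.nonempty
  have hO := isOffsets_inputStore k L
  have hA := adjArrays_inputStore k hL
  obtain ⟨e⟩ := nonempty_iso_induce_map G
  have hM := listStart_eq_two_mul hL
  set s := inputStore k L with hs
  have hsn : s.reg rN = n := rfl
  have hsk : s.reg rK = k := rfl
  have hsr : ∀ x, 2 ≤ x → s.reg x = 0 := fun x hx => by
    simp [hs, inputStore, show x ≠ 0 by omega, show x ≠ 1 by omega]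
  have hsa : ∀ a, 2 ≤ a → s.arr a = fun _ => 0 := fun a ha => by
    funext i
    simp [hs, inputStore, show a ≠ 0 by omega, show a ≠ 1 by omega]
  -- With `listStart L n = 2 * |E|`, the bounds of the five programs add up to `110 * |E| + 85 * n +
  -- 68`; the constant term is absorbed because `n > 0`.
  refine HaltsWithin.mono ((dfsProg_spec hn hO hA (e.connected_iff.1 hG) hsn rfl rfl
    (hsr _ (by decide)) (hsr _ (by decide)) fun a ha _ => hsa a ha).frame.seq fun s₁ hs₁ => ?_)
    (T := 20 * (listStart L n + n) + 5 + (20 * listStart L n + 3 + (50 * n + 40 +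
      (15 * n + 10 + (15 * listStart L n + 10))))) (by omega) fun _ h => h
  obtain ⟨⟨h1, hT⟩, f1⟩ := hs₁
  have r1 : ∀ x, x ∉ dfsProg.regs → s₁.reg x = s.reg x := f1.1
  have a1 : ∀ a, a ∉ dfsProg.arrs → s₁.arr a = s.arr a := f1.2
  refine (labelProg_spec hO hA hT ((r1 _ (by decide)).trans hsn) h1 (a1 _ (by decide))
    (a1 _ (by decide)) rfl rfl rfl rfl fun a h3 h4 => ?_).frame.seq fun s₂ hs₂ => ?_
  · rw [a1 a (by interval_cases a <;> decide)]
    exact hsa a (by omega)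
  obtain ⟨hLab, f2⟩ := hs₂
  have r2 : ∀ x, x ∉ dfsProg.regs → x ∉ labelProg.regs → s₂.reg x = s.reg x :=
    fun x h3 h4 => (f2.1 x h4).trans (r1 x h3)
  have a2 : ∀ a, a ∉ dfsProg.arrs → a ∉ labelProg.arrs → s₂.arr a = s.arr a :=
    fun a h3 h4 => (f2.2 a h4).trans (a1 a h3)
  have h1' : s₂.reg rOne = 1 := (f2.1 _ (by decide)).trans h1
  refine (sweepProg_spec (k := k) hn e hG hO hA hT hLab
    ((r2 _ (by decide) (by decide)).trans hsn) ((r2 _ (by decide) (by decide)).trans hsk)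
    ((r2 _ (by decide) (by decide)).trans (hsr _ (by decide))) h1' (a2 _ (by decide) (by decide))
    (a2 _ (by decide) (by decide)) (f2.2 _ (by decide)) (f2.2 _ (by decide)) rfl rfl rfl
    ((a2 _ (by decide) (by decide)).trans (hsa _ (by decide)))
    ((a2 _ (by decide) (by decide)).trans (hsa _ (by decide)))).frame.seq fun s₃ hs₃ => ?_
  obtain ⟨⟨S, ⟨⟨g, hg⟩, hdead, -⟩, hset⟩, f3⟩ := hs₃
  have r3 : ∀ x, x ∉ dfsProg.regs → x ∉ labelProg.regs → x ∉ sweepProg.regs →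
      s₃.reg x = s.reg x := fun x h3 h4 h5 => (f3.1 x h5).trans (r2 x h3 h4)
  have a3 : ∀ a, a ∉ dfsProg.arrs → a ∉ labelProg.arrs → a ∉ sweepProg.arrs →
      s₃.arr a = s.arr a := fun a h3 h4 h5 => (f3.2 a h5).trans (a2 a h3 h4)
  have h1'' : s₃.reg rOne = 1 := (f3.1 _ (by decide)).trans h1'
  refine (relabelProg_spec hO ((r3 _ (by decide) (by decide) (by decide)).trans hsn) h1''
    (a3 _ (by decide) (by decide) (by decide)) hdead
    ((a3 _ (by decide) (by decide) (by decide)).trans (hsa _ (by decide)))).frame.seq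
    fun s₄ hs₄ => ?_
  obtain ⟨⟨hcount, hnew, hstart⟩, f4⟩ := hs₄
  have r4 : ∀ x, x ∉ dfsProg.regs → x ∉ labelProg.regs → x ∉ sweepProg.regs →
      x ∉ relabelProg.regs → s₄.reg x = s.reg x :=
    fun x h3 h4 h5 h6 => (f4.1 x h6).trans (r3 x h3 h4 h5)
  have a4 : ∀ a, a ∉ dfsProg.arrs → a ∉ labelProg.arrs → a ∉ sweepProg.arrs →
      a ∉ relabelProg.arrs → s₄.arr a = s.arr a :=
    fun a h3 h4 h5 h6 => (f4.2 a h6).trans (a3 a h3 h4 h5)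
  have eA : s₄.arr aAdj = s₃.arr aAdj := f4.2 _ (by decide)
  have eOwn : s₄.arr aOwn = s₁.arr aOwn :=
    ((f4.2 _ (by decide)).trans (f3.2 _ (by decide))).trans (f2.2 _ (by decide))
  have eDead : s₄.arr aDead = s₃.arr aDead := f4.2 _ (by decide)
  have h1₄ : s₄.reg rOne = 1 := (f4.1 _ (by decide)).trans h1''
  refine (copyProg_spec (k := k) (S := S) hO
    ((r4 _ (by decide) (by decide) (by decide) (by decide)).trans hsn)
    ((r4 _ (by decide) (by decide) (by decide) (by decide)).trans hsk)
    ((r4 _ (by decide) (by decide) (by decide) (by decide)).trans (hsr _ (by decide))) h1₄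
    (a4 _ (by decide) (by decide) (by decide) (by decide)) eA eOwn (fun j hj => ?_)
    (by rw [eDead]; exact hdead)
    ((a4 _ (by decide) (by decide) (by decide) (by decide)).trans (hsa _ (by decide)))).frame.mono
    le_rfl fun s₅ hs₅ => ?_
  · obtain ⟨v, hv, h3, h4⟩ := hO.exists_block hj
    rw [hT.own_eq v hv j h3 h4]
    exact hv
  obtain ⟨⟨hN, hK, hAdj⟩, f5⟩ := hs₅
  obtain ⟨H, L', hL', ⟨e'⟩, hls, hcl⟩ := exists_renamed_graph hO hT.own_eq hg.subset hg.arrays hnew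
  refine ⟨_, H, L', hL', ?_, fun v hv => ?_, ⟨?_, ?_⟩, ?_, ?_, ?_, ?_, ?_⟩
  · exact hg.reduces.trans (.iso e') inferInstance hG
  · have h3 := hv.iso e' (e'.connected_iff.1 hg.connected)
    exact hg.not_isSuppressible (e'.symm v).2 (hset _ (e'.symm v).2) h3
  · rintro (_ | _ | x)
    · exact hN.trans hcount
    · exact hK
    -- None of the programs writes to a register from `34` on, so these still hold their initial
    -- value `0`.
    · have hx : ∀ l : List ℕ, (∀ y ∈ l, y < 34) → x + 1 + 1 + 32 ∉ l := fun l hl hx => by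
        have := hl _ hx
        omega
      rw [f5.1 _ (hx _ (by decide)), r4 _ (hx _ (by decide)) (hx _ (by decide))
        (hx _ (by decide)) (hx _ (by decide))]
      simp [hs, inputStore]
  · rintro (_ | _ | a)
    · rw [f5.2 _ (by decide), hstart]
      funext i
      simp [inputStore, hls]
    · rw [hAdj]
      funext i
      simp [inputStore, hcl]
    · have hx : ∀ l : List ℕ, (∀ y ∈ l, y < 34) → a + 1 + 1 + 32 ∉ l := fun l hl hx => by
        have := hl _ hx
        omega
      rw [f5.2 _ (hx _ (by decide)), a4 _ (hx _ (by decide)) (hx _ (by decide))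
        (hx _ (by decide)) (hx _ (by decide))]
      funext i
      simp [hs, inputStore]
  · exact (List.length_filter_le _ _).trans List.length_range.le
  · rw [← hM, ← length_concatLists, hcl, List.length_map]
    exact (List.length_filter_le _ _).trans List.length_range.le
  · exact (f5.1 _ (by decide)).trans
      ((r4 _ (by decide) (by decide) (by decide) (by decide)).trans hsk)
  · exact (f5.1 _ (by decide)).trans
      ((r4 _ (by decide) (by decide) (by decide) (by decide)).trans (hsr _ (by decide)))
  · exact (f5.1 _ (by decide)).trans h1₄

end Core


section Results

variable {n n' k : ℕ} {G : SimpleGraph (Fin n)} {H : SimpleGraph (Fin n')}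
  {L : Fin n' → List (Fin n')}

/-! ### Consequences of a reduction -/

theorem IsReduction.connected {s : Store} (h : IsReduction k G H L s) (hG : G.Connected) :
    H.Connected := (h.reducesTo.olaPlus_iff inferInstance hG).1

theorem IsReduction.olaPlus_le_iff {s : Store} (h : IsReduction k G H L s) (hG : G.Connected) :
    olaPlus H ≤ k ↔ olaPlus G ≤ k := (h.reducesTo.olaPlus_iff inferInstance hG).2.1

theorem IsReduction.olaPlus_eq {s : Store} (h : IsReduction k G H L s) (hG : G.Connected)
    (hk : olaPlus G ≤ k) : olaPlus H = olaPlus G :=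
  (h.reducesTo.olaPlus_iff inferInstance hG).2.2 hk

theorem IsReduction.size_le {s : Store} (h : IsReduction k G H L s) (hG : G.Connected)
    (hk : olaPlus G ≤ k) : n' ≤ 5 * k + 2 ∧ H.edgeSet.ncard ≤ 6 * k + 1 := by
  have hH := h.connected hG
  have hkH := (h.olaPlus_le_iff hG).2 hk
  refine ⟨?_, ncard_edgeSet_le_of_not_isSuppressible hH h.not_isSuppressible hkH⟩
  simpa using card_le_of_not_isSuppressible hH h.not_isSuppressible hkH

theorem HoldsShifted.start {s : Store} (h : HoldsShifted s k L) {i : ℕ} (hi : i ≤ n') :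
    s.arr aOutStart i = listStart L i := by
  have := congrFun (h.arr_eq 0) i
  rw [inputStore_start k L hi] at this
  exact this

theorem HoldsShifted.adj {s : Store} (h : HoldsShifted s k L) (i : ℕ) :
    s.arr aOutAdj i = (concatLists L).getD i 0 := congrFun (h.arr_eq 1) i

theorem HoldsShifted.reg_n {s : Store} (h : HoldsShifted s k L) : s.reg rOutN = n' := h.reg_eq 0

/-- The later programs use registers `4` to `31` and arrays below `32` as working space, apart from
the final writing of the result. -/
theorem IsReduction.frame {s s' : Store} {p : Prog} (h : IsReduction k G H L s)
    (hf : p.Frame s s') (hreg : ∀ x ∈ p.regs, 4 ≤ x ∧ x < 32) (harr : ∀ a ∈ p.arrs, a < 32) :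
    IsReduction k G H L s' where
  adjLists := h.adjLists
  reducesTo := h.reducesTo
  not_isSuppressible := h.not_isSuppressible
  card_le := h.card_le
  length_le := h.length_le
  holds := ⟨fun x => (hf.1 _ fun hx => absurd (hreg _ hx).2 (by omega)).trans (h.holds.reg_eq x),
    fun a => (hf.2 _ fun ha => absurd (harr _ ha) (by omega)).trans (h.holds.arr_eq a)⟩
  reg_k := (hf.1 _ fun hx => absurd (hreg _ hx).1 (by omega)).trans h.reg_k
  reg_zero := (hf.1 _ fun hx => absurd (hreg _ hx).1 (by omega)).trans h.reg_zero
  reg_one := (hf.1 _ fun hx => absurd (hreg _ hx).1 (by omega)).trans h.reg_one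

/-! ### Writing an instance as output -/

def copyCell (a b : ℕ) : Prog :=
  .load rTmp a rI ;; .store b rI rTmp ;; .add rI rI rOne

/-- Copies the cells below `rEnd` of the array `a` to the array `b`. -/
def copyArr (a b : ℕ) : Prog := .const rI 0 ;; .while rI rEnd (copyCell a b)

theorem copyArr_spec {a b : ℕ} (hab : a ≠ b) {s : Store} (hone : s.reg rOne = 1) :
    HaltsWithin (copyArr a b) s (4 * s.reg rEnd + 2) fun s' =>
      ∀ i < s.reg rEnd, s'.arr b i = s.arr a i := by
  have hinit : HaltsWithin (.const rI 0) s 1 fun s' => s'.reg rI = 0 :=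
    HaltsWithin.of_loopFree (by trivial) (by simp [Prog.eval])
  refine (hinit.frame.seq (T₂ := s.reg rEnd * ((copyCell a b).cost + 1) + 1)
    fun s₁ hs₁ => ?_).mono (by simp [copyCell, Prog.cost]; omega) fun _ h => h
  obtain ⟨hI, hf⟩ := hs₁
  have r1 : ∀ x, x ≠ rI → s₁.reg x = s.reg x := fun x hx => hf.1 x (by simpa [Prog.regs] using hx)
  refine (HaltsWithin.while (by simp [copyCell, Prog.LoopFree])
    (fun m s' => s'.reg rI + m = s.reg rEnd ∧ ∀ i < s'.reg rI, s'.arr b i = s.arr a i)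
    (m := s.reg rEnd) ?_ ⟨by omega, by omega⟩).frame.mono le_rfl ?_
  · rintro m s' ⟨hm, hI'⟩ hf' hlt
    have e1 : s'.reg rOne = 1 :=
      ((hf'.1 _ (by simp [copyCell, Prog.regs])).trans (r1 _ (by decide))).trans hone
    have e2 : s'.reg rEnd = s.reg rEnd :=
      (hf'.1 _ (by simp [copyCell, Prog.regs])).trans (r1 _ (by decide))
    have e3 : s'.arr a = s.arr a :=
      (hf'.2 _ (by simpa [copyCell, Prog.arrs] using hab)).trans (hf.2 _ (by simp [Prog.arrs]))
    rw [e2] at hlt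
    have e4 : ((copyCell a b).eval s').reg rI = s'.reg rI + 1 := by
      simp [copyCell, Prog.eval, e1]
    have e5 : ((copyCell a b).eval s').arr b =
        Function.update (s'.arr b) (s'.reg rI) (s.arr a (s'.reg rI)) := by
      simp [copyCell, Prog.eval, e3]
    refine ⟨m - 1, by omega, by rw [e4]; omega, fun i hi => ?_⟩
    rw [e4] at hi
    rw [e5, Function.update_apply]
    split_ifs with h
    · rw [h]
    · exact hI' i (by omega)
  · rintro s' ⟨⟨⟨m, hm, hI'⟩, hge⟩, hf'⟩ i hi
    have e2 : s'.reg rEnd = s.reg rEnd :=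
      (hf'.1 _ (by simp [copyCell, Prog.regs])).trans (r1 _ (by decide))
    exact hI' i (by omega)

/-- Copies the reduced instance to the output registers and arrays. -/
def outputProg : Prog :=
  .add rEnd rOutN rOne ;; copyArr aOutStart aStart ;; .load rEnd aOutStart rOutN ;;
    copyArr aOutAdj aAdj ;; .add rN rOutN rZero

theorem outputProg_spec {s : Store} (h : IsReduction k G H L s) :
    HaltsWithin outputProg s (20 * (n + G.edgeSet.ncard) + 20) fun s' =>
      HoldsInstance s' k L := by
  have h1 : HaltsWithin (.add rEnd rOutN rOne) s 1 fun s' => s'.reg rEnd = n' + 1 :=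
    HaltsWithin.of_loopFree (by trivial) (by simp [Prog.eval, h.holds.reg_n, h.reg_one])
  have hc := h.card_le
  have hl := h.length_le
  refine HaltsWithin.mono (T := 1 + (4 * (n' + 1) + 2 + (1 + (4 * listStart L n' + 2 + 1))))
    (h1.frame.seq fun s₁ hs₁ => ?_) (by omega) fun _ h => h
  obtain ⟨hE, f1⟩ := hs₁
  have i1 := h.frame f1 (by decide) (by decide)
  have c1 := (copyArr_spec (a := aOutStart) (b := aStart) (by decide) i1.reg_one).frame
  rw [hE] at c1
  refine c1.seq fun s₂ hs₂ => ?_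
  obtain ⟨hS, f2⟩ := hs₂
  have i2 := i1.frame f2 (by decide) (by decide)
  have h2 : HaltsWithin (.load rEnd aOutStart rOutN) s₂ 1
      fun s' => s'.reg rEnd = listStart L n' := by
    refine HaltsWithin.of_loopFree (by trivial) ?_
    simp only [Prog.eval, Store.setReg_reg, if_true]
    rw [i2.holds.reg_n, i2.holds.start le_rfl]
  refine h2.frame.seq fun s₃ hs₃ => ?_
  obtain ⟨hE', f3⟩ := hs₃
  have i3 := i2.frame f3 (by decide) (by decide)
  have c2 := (copyArr_spec (a := aOutAdj) (b := aAdj) (by decide) i3.reg_one).frame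
  rw [hE'] at c2
  refine c2.seq fun s₄ hs₄ => ?_
  obtain ⟨hA, f4⟩ := hs₄
  have i4 := i3.frame f4 (by decide) (by decide)
  refine HaltsWithin.of_loopFree (by trivial) ⟨?_, ?_, fun i hi => ?_, fun i hi => ?_⟩
  · simp [Prog.eval, i4.holds.reg_n, i4.reg_zero]
  · simp [Prog.eval, i4.reg_k]
  · have e : s₄.arr aStart = s₂.arr aStart :=
      (f4.2 _ (by decide)).trans (f3.2 _ (by decide))
    simp only [Prog.eval, Store.setReg_arr]
    rw [e, hS i (by omega), i1.holds.start hi]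
  · simp only [Prog.eval, Store.setReg_arr]
    rw [hA i (by rwa [← length_concatLists]), i3.holds.adj]

/-! ### A small instance with a negative answer -/

/-- Writes the elements of a list to the cells `i, i + 1, …` of the array `a`. -/
def writeList (a : ℕ) : List ℕ → ℕ → Prog
  | [], _ => .const rTmp 0
  | x :: l, i => .const rI i ;; .const rTmp x ;; .store a rI rTmp ;; writeList a l (i + 1)

theorem loopFree_writeList (a : ℕ) (l : List ℕ) (i : ℕ) : (writeList a l i).LoopFree := by
  induction l generalizing i with
  | nil => trivial
  | cons x l ih => exact ⟨trivial, trivial, trivial, ih _⟩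

theorem writeList_eval (a : ℕ) (l : List ℕ) (i : ℕ) (s : Store) :
    (∀ j < l.length, ((writeList a l i).eval s).arr a (i + j) = l.getD j 0) ∧
    ∀ j < i, ((writeList a l i).eval s).arr a j = s.arr a j := by
  induction l generalizing i s with
  | nil => simp [writeList, Prog.eval]
  | cons x l ih =>
    obtain ⟨h1, h2⟩ := ih (i + 1) (((s.setReg rI i).setReg rTmp x).setArr a i x)
    have e : (writeList a (x :: l) i).eval s =
        (writeList a l (i + 1)).eval (((s.setReg rI i).setReg rTmp x).setArr a i x) := by
      simp [writeList, Prog.eval]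
    rw [e]
    refine ⟨fun j hj => ?_, fun j hj => ?_⟩
    · rcases j with _ | j
      · rw [show i + 0 = i from rfl, h2 i (Nat.lt_succ_self i)]
        simp
      · rw [← Nat.add_assoc, Nat.add_right_comm, h1 j (by simpa using hj)]
        simp
    · rw [h2 j (by omega)]
      simp [Function.update_of_ne hj.ne]

/-- Adjacency lists of the complete graph on four vertices. -/
def completeLists (v : Fin 4) : List (Fin 4) := (List.finRange 4).filter (· ≠ v)

theorem isAdjLists_completeLists : IsAdjLists completeLists ⊤ := by
  intro v
  refine ⟨(List.nodup_finRange 4).filter _, fun w => ?_⟩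
  rw [completeLists, List.mem_filter, SimpleGraph.top_adj]
  simp only [List.mem_finRange, true_and, decide_eq_true_eq]
  exact ne_comm

theorem listStart_completeLists : ∀ i ≤ 4, listStart completeLists i = [0, 3, 6, 9, 12].getD i 0 := by
  decide

theorem concatLists_completeLists :
    concatLists completeLists = [1, 2, 3, 0, 2, 3, 0, 1, 3, 0, 1, 2] := by decide

theorem ncard_edgeSet_complete : (⊤ : SimpleGraph (Fin 4)).edgeSet.ncard = 6 := by
  have := listStart_eq_two_mul isAdjLists_completeLists
  rw [show listStart completeLists 4 = 2 * 6 from listStart_completeLists 4 le_rfl] at this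
  omega

/-- `ncard_edgeSet_add_one_le` with six edges and four vertices gives a cost of at least `3`. -/
theorem one_lt_olaPlus_complete : 1 < olaPlus (⊤ : SimpleGraph (Fin 4)) := by
  have := ncard_edgeSet_add_one_le (⊤ : SimpleGraph (Fin 4))
  rw [ncard_edgeSet_complete, Nat.card_eq_fintype_card, Fintype.card_fin] at this
  omega

/-- Writes the complete graph on four vertices with the parameter `1`. -/
def completeProg : Prog :=
  writeList aStart [0, 3, 6, 9, 12] 0 ;;
    writeList aAdj [1, 2, 3, 0, 2, 3, 0, 1, 3, 0, 1, 2] 0 ;; .const rN 4 ;; .const rK 1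

theorem completeProg_spec (s : Store) :
    HaltsWithin completeProg s 60 fun s' => HoldsInstance s' 1 completeLists := by
  have h1 := writeList_eval aStart [0, 3, 6, 9, 12] 0 s
  set s₁ := (writeList aStart [0, 3, 6, 9, 12] 0).eval s with hs₁
  have h2 := writeList_eval aAdj [1, 2, 3, 0, 2, 3, 0, 1, 3, 0, 1, 2] 0 s₁
  have f2 := Prog.eval_frame (loopFree_writeList aAdj [1, 2, 3, 0, 2, 3, 0, 1, 3, 0, 1, 2] 0) s₁
  set s₂ := (writeList aAdj [1, 2, 3, 0, 2, 3, 0, 1, 3, 0, 1, 2] 0).eval s₁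
  have e : completeProg.eval s = (s₂.setReg rN 4).setReg rK 1 := rfl
  refine (HaltsWithin.of_loopFree (p := completeProg)
    ⟨loopFree_writeList _ _ _, loopFree_writeList _ _ _, trivial, trivial⟩ ?_).mono
    (by decide) fun _ h => h
  rw [e]
  refine ⟨by simp, by simp, fun i hi => ?_, fun i hi => ?_⟩
  · rw [listStart_completeLists i hi, Store.setReg_arr, Store.setReg_arr, f2.2 _ (by decide)]
    have := h1.1 i (Nat.lt_succ_of_le hi)
    rwa [Nat.zero_add] at this
  · rw [concatLists_completeLists] at hi ⊢
    have := h2.1 i hi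
    rwa [Nat.zero_add] at this

/-! ### Testing the size of the reduced graph -/

/-- Computes `5 * k + 3` and `12 * k + 3`. -/
def boundProg : Prog :=
  .add rU rK rK ;; .add rU rU rU ;; .add rV rU rK ;; .const rTmp 3 ;; .add rV rV rTmp ;;
    .add rD rU rU ;; .add rD rD rU ;; .add rD rD rTmp ;; .load rTmp aOutStart rOutN

/-- Executes `p` if the reduced graph has at most `5 * k + 2` vertices and at most `6 * k + 1`
edges, and `q` otherwise. -/
def ifSmall (p q : Prog) : Prog := boundProg ;; .ite rOutN rV (.ite rTmp rD p q) q

/-- The total length of the lists is twice the number of edges, so `|E| ≤ 6k + 1` is tested as `2|E|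
< 12k + 3`. -/
theorem ifSmall_spec {p q : Prog} {s : Store} (h : IsReduction k G H L s) {T : ℕ}
    {Q : Store → Prop}
    (hp : n' ≤ 5 * k + 2 → H.edgeSet.ncard ≤ 6 * k + 1 →
      ∀ s', IsReduction k G H L s' → HaltsWithin p s' T Q)
    (hq : ¬ (n' ≤ 5 * k + 2 ∧ H.edgeSet.ncard ≤ 6 * k + 1) →
      ∀ s', IsReduction k G H L s' → HaltsWithin q s' T Q) :
    HaltsWithin (ifSmall p q) s (9 + (T + 1 + 1)) Q := by
  have hm := listStart_eq_two_mul h.adjLists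
  have hb : HaltsWithin boundProg s 9 fun s' => s'.reg rV = 5 * k + 3 ∧ s'.reg rD = 12 * k + 3 ∧
      s'.reg rTmp = 2 * H.edgeSet.ncard := by
    refine HaltsWithin.of_loopFree (by simp [boundProg, Prog.LoopFree]) ⟨?_, ?_, ?_⟩
    · simp [boundProg, Prog.eval, h.reg_k]
      ring
    · simp [boundProg, Prog.eval, h.reg_k]
      ring
    · rw [← hm, ← h.holds.start le_rfl]
      simp [boundProg, Prog.eval, h.holds.reg_n]
  refine hb.frame.seq fun s' hs' => ?_
  obtain ⟨⟨h1, h2, h3⟩, hf⟩ := hs'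
  have h' := h.frame hf (by decide) (by decide)
  refine HaltsWithin.ite (fun h4 => HaltsWithin.ite (fun h5 => ?_) fun h5 => ?_) fun h4 => ?_
  · rw [h'.holds.reg_n, h1] at h4
    rw [h3, h2] at h5
    exact hp (by omega) (by omega) s' h'
  · rw [h3, h2] at h5
    exact hq (by omega) s' h'
  · rw [h'.holds.reg_n, h1] at h4
    exact (hq (by omega) s' h').mono (Nat.le_succ _) fun _ h => h

/-! ### Running a program on shifted registers and arrays -/

/-- The program that uses the register `x + d` and the array `a + d` instead of `x` and `a`. -/
def Prog.shift (d : ℕ) : Prog → Prog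
  | .const x c => .const (x + d) c
  | .add x y z => .add (x + d) (y + d) (z + d)
  | .sub x y z => .sub (x + d) (y + d) (z + d)
  | .load x a y => .load (x + d) (a + d) (y + d)
  | .store a y x => .store (a + d) (y + d) (x + d)
  | .seq p q => .seq (p.shift d) (q.shift d)
  | .ite x y p q => .ite (x + d) (y + d) (p.shift d) (q.shift d)
  | .while x y p => .while (x + d) (y + d) (p.shift d)

/-- The registers and arrays of `σ` from `d` on are those of `s`. -/
structure Store.IsShift (d : ℕ) (s σ : Store) : Prop where
  reg_eq : ∀ x, σ.reg (x + d) = s.reg x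
  arr_eq : ∀ a, σ.arr (a + d) = s.arr a

theorem Store.IsShift.setReg {d : ℕ} {s σ : Store} (h : s.IsShift d σ) (x c : ℕ) :
    (s.setReg x c).IsShift d (σ.setReg (x + d) c) :=
  ⟨fun y => by simp [h.reg_eq], h.arr_eq⟩

theorem Store.IsShift.setArr {d : ℕ} {s σ : Store} (h : s.IsShift d σ) (a i c : ℕ) :
    (s.setArr a i c).IsShift d (σ.setArr (a + d) i c) :=
  ⟨h.reg_eq, fun b => by simp [h.arr_eq]⟩

/-- A shifted program sees only registers and arrays from `d` on. So the given procedure runs there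
as on a fresh input, in the same number of steps, whatever the reduction has left below `d`. -/
theorem Run.shift {d : ℕ} {p : Prog} {s s' : Store} {t : ℕ} (h : Run p s t s') {σ : Store}
    (hσ : s.IsShift d σ) : ∃ σ', Run (p.shift d) σ t σ' ∧ s'.IsShift d σ' := by
  induction h generalizing σ with
  | const x c s => exact ⟨_, .const _ _ _, hσ.setReg x c⟩
  | add x y z s =>
    refine ⟨_, .add _ _ _ _, ?_⟩
    rw [hσ.reg_eq, hσ.reg_eq]
    exact hσ.setReg _ _
  | sub x y z s =>
    refine ⟨_, .sub _ _ _ _, ?_⟩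
    rw [hσ.reg_eq, hσ.reg_eq]
    exact hσ.setReg _ _
  | load x a y s =>
    refine ⟨_, .load _ _ _ _, ?_⟩
    rw [hσ.reg_eq, hσ.arr_eq]
    exact hσ.setReg _ _
  | store a y x s =>
    refine ⟨_, .store _ _ _ _, ?_⟩
    rw [hσ.reg_eq, hσ.reg_eq]
    exact hσ.setArr _ _ _
  | seq _ _ ih1 ih2 =>
    obtain ⟨σ₁, h1, h2⟩ := ih1 hσ
    obtain ⟨σ₂, h3, h4⟩ := ih2 h2
    exact ⟨σ₂, .seq h1 h3, h4⟩
  | iteTrue hlt _ ih =>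
    obtain ⟨σ₁, h1, h2⟩ := ih hσ
    exact ⟨σ₁, .iteTrue (by rwa [hσ.reg_eq, hσ.reg_eq]) h1, h2⟩
  | iteFalse hlt _ ih =>
    obtain ⟨σ₁, h1, h2⟩ := ih hσ
    exact ⟨σ₁, .iteFalse (by rwa [hσ.reg_eq, hσ.reg_eq]) h1, h2⟩
  | whileTrue hlt _ _ ih1 ih2 =>
    obtain ⟨σ₁, h1, h2⟩ := ih1 hσ
    obtain ⟨σ₂, h3, h4⟩ := ih2 h2
    exact ⟨σ₂, .whileTrue (by rwa [hσ.reg_eq, hσ.reg_eq]) h1 h3, h4⟩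
  | whileFalse hlt => exact ⟨σ, .whileFalse (by rwa [hσ.reg_eq, hσ.reg_eq]), hσ⟩

theorem le_of_mem_regs_shift {d : ℕ} {p : Prog} {x : ℕ} (hx : x ∈ (p.shift d).regs) : d ≤ x := by
  induction p with
  | const | add | sub | load =>
    simp only [Prog.shift, Prog.regs, List.mem_singleton] at hx
    omega
  | store => simp [Prog.shift, Prog.regs] at hx
  | seq p q ih1 ih2 => exact (List.mem_append.1 hx).elim ih1 ih2
  | ite x y p q ih1 ih2 => exact (List.mem_append.1 hx).elim ih1 ih2
  | _ =>
    rename_i ih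
    exact ih hx

/-- Reduces the graph and then applies the decision procedure `A`. -/
def decideProg (A : Prog) : Prog :=
  coreProg ;; ifSmall (A.shift 32 ;; .add rN rOutN rZero) (.const rN 0)

theorem decideProg_spec {A : Prog} {T N M : ℕ} (hA : DecidesWithin A k (5 * k + 2) (6 * k + 1) T) :
    DecidesWithin (decideProg A) k N M (300 * (M + N + T)) := by
  intro n G L₀ hG hL hn hm
  have hn0 : 0 < n := Fin.pos_iff_nonempty.2 hG.nonempty
  refine HaltsWithin.mono (T := 200 * (n + G.edgeSet.ncard) + (9 + (T + 1 + 1 + 1)))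
    ((coreProg_spec k hG hL).seq fun s hs => ?_) (by omega) fun _ h => h
  obtain ⟨n', H, L, h⟩ := hs
  refine ifSmall_spec h (fun h1 h2 s' h' => ?_) fun hnot s' h' => ?_
  · obtain ⟨t, s₁, hrun, ht, hs₁⟩ := hA n' H L (h.connected hG) h.adjLists h1 h2
    obtain ⟨σ, hrun', hσ⟩ := hrun.shift ⟨h'.holds.reg_eq, h'.holds.arr_eq⟩
    -- The shifted run does not touch the registers below `32`, so adding `rZero` just copies its
    -- answer.
    have hz : σ.reg rZero = 0 :=
      (hrun'.reg_eq fun hx => absurd (le_of_mem_regs_shift hx) (by decide)).trans h'.reg_zero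
    refine ⟨_, _, .seq hrun' (.add _ _ _ _), by omega, ?_⟩
    rw [← h.olaPlus_le_iff hG, ← hs₁, ← hσ.reg_eq 0]
    simp [hz]
  -- A reduced graph that is too large proves that the answer is negative.
  · refine (HaltsWithin.of_loopFree (p := .const rN 0) trivial ?_).mono
      (by simp [Prog.cost]) fun _ h => h
    simpa [Prog.eval] using fun hk => hnot (h.size_le hG (not_lt.1 hk))

/-- Reduces the graph and writes it as output, or a small negative instance if it is too large. -/
def kernelProg : Prog := coreProg ;; ifSmall outputProg completeProg

end Results

end LinArr

/-! ### The main theorem -/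

theorem theorem2p11 :
    -- suppressing an `ola⁺(G)`-suppressible vertex preserves `ola⁺`
    (∀ (V : Type) [Finite V] (G : SimpleGraph V) (v : V), G.Connected →
      LinArr.IsSuppressible G (LinArr.olaPlus G) v →
        LinArr.olaPlus (LinArr.suppress G v) = LinArr.olaPlus G) ∧
    -- deciding takes time `O(m + n + f(5k+2, 6k+1))`
    (∃ C : ℕ, ∀ A : LinArr.Prog, ∃ B : LinArr.Prog, ∀ k : ℕ, 1 ≤ k → ∀ T : ℕ,
      LinArr.DecidesWithin A k (5 * k + 2) (6 * k + 1) T →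
        ∀ n m : ℕ, LinArr.DecidesWithin B k n m (C * (m + n + T))) ∧
    -- the reduction by suppressions, in linear time
    (∃ (R : LinArr.Prog) (C : ℕ), ∀ k : ℕ, 1 ≤ k →
      ∀ (n : ℕ) (G : SimpleGraph (Fin n)) (L : Fin n → List (Fin n)),
        G.Connected → LinArr.IsAdjLists L G →
          ∃ (t : ℕ) (s : LinArr.Store) (n' : ℕ) (H : SimpleGraph (Fin n'))
            (L' : Fin n' → List (Fin n')),
            LinArr.Run R (LinArr.inputStore k L) t s ∧
            t ≤ C * (n + G.edgeSet.ncard) ∧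
            LinArr.HoldsInstance s k L' ∧ LinArr.IsAdjLists L' H ∧
            LinArr.ReducesTo k G H ∧ (∀ v, ¬ LinArr.IsSuppressible H k v) ∧
            H.Connected ∧
            (LinArr.olaPlus H ≤ k ↔ LinArr.olaPlus G ≤ k) ∧
            (LinArr.olaPlus G ≤ k →
              LinArr.olaPlus H = LinArr.olaPlus G ∧
                n' ≤ 5 * k + 2 ∧ H.edgeSet.ncard ≤ 6 * k + 1)) ∧
    -- the linear kernel, in linear time
    (∃ (K : LinArr.Prog) (C : ℕ), ∀ k : ℕ, 1 ≤ k →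
      ∀ (n : ℕ) (G : SimpleGraph (Fin n)) (L : Fin n → List (Fin n)),
        G.Connected → LinArr.IsAdjLists L G →
          ∃ (t : ℕ) (s : LinArr.Store) (k' n' : ℕ) (H : SimpleGraph (Fin n'))
            (L' : Fin n' → List (Fin n')),
            LinArr.Run K (LinArr.inputStore k L) t s ∧
            t ≤ C * (n + G.edgeSet.ncard) ∧
            LinArr.HoldsInstance s k' L' ∧ LinArr.IsAdjLists L' H ∧
            1 ≤ k' ∧ k' ≤ k ∧ H.Connected ∧
            n' ≤ 5 * k + 2 ∧ H.edgeSet.ncard ≤ 6 * k + 1 ∧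
            (LinArr.olaPlus H ≤ k' ↔ LinArr.olaPlus G ≤ k)) := by
  refine ⟨fun V _ G v hG hv => hv.olaPlus_suppress hG le_rfl,
    ⟨300, fun A => ⟨LinArr.decideProg A, fun k _ T hA n m => LinArr.decideProg_spec hA⟩⟩,
    ⟨LinArr.coreProg ;; LinArr.outputProg, 300, fun k hk n G L hG hL => ?_⟩,
    ⟨LinArr.kernelProg, 300, fun k hk n G L hG hL => ?_⟩⟩
  · have hn : 0 < n := Fin.pos_iff_nonempty.2 hG.nonempty
    obtain ⟨t₁, s₁, hr₁, ht₁, n', H, L', h⟩ := LinArr.coreProg_spec k hG hL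
    obtain ⟨t₂, s₂, hr₂, ht₂, hs₂⟩ := LinArr.outputProg_spec h
    exact ⟨_, s₂, n', H, L', .seq hr₁ hr₂, by omega, hs₂, h.adjLists, h.reducesTo,
      h.not_isSuppressible, h.connected hG, h.olaPlus_le_iff hG,
      fun hk => ⟨h.olaPlus_eq hG hk, h.size_le hG hk⟩⟩
  · have hn : 0 < n := Fin.pos_iff_nonempty.2 hG.nonempty
    obtain ⟨t₁, s₁, hr₁, ht₁, n', H, L', h⟩ := LinArr.coreProg_spec k hG hL
    by_cases hsmall : n' ≤ 5 * k + 2 ∧ H.edgeSet.ncard ≤ 6 * k + 1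
    · obtain ⟨t₂, s₂, hr₂, ht₂, hs₂⟩ := LinArr.ifSmall_spec h (q := LinArr.completeProg)
        (fun _ _ s' h' => LinArr.outputProg_spec h') fun hn => absurd hsmall hn
      exact ⟨_, s₂, k, n', H, L', .seq hr₁ hr₂, by omega, hs₂, h.adjLists, hk, le_rfl,
        h.connected hG, hsmall.1, hsmall.2, h.olaPlus_le_iff hG⟩
    -- The answer is negative, and `K₄` with parameter `1` is an equivalent instance; its four
    -- vertices and six edges respect the bounds since `k ≥ 1`.
    · obtain ⟨t₂, s₂, hr₂, ht₂, hs₂⟩ := LinArr.ifSmall_spec h (p := LinArr.outputProg)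
        (fun h1 h2 => absurd ⟨h1, h2⟩ hsmall) fun _ s' _ => LinArr.completeProg_spec s'
      refine ⟨_, s₂, 1, 4, ⊤, _, .seq hr₁ hr₂, by omega, hs₂, LinArr.isAdjLists_completeLists,
        le_rfl, hk, SimpleGraph.connected_top, by omega, ?_, ?_⟩
      · rw [LinArr.ncard_edgeSet_complete]
        omega
      · exact iff_of_false (not_le.2 LinArr.one_lt_olaPlus_complete)
          fun hk => hsmall (h.size_le hG hk)
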